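/- Let $\sigma,K,T>0$ be constants. For $\rho>0$ consider the modified Black–Scholes equation with constant volatility $\sigma$ and constant arbitrage measure $\rho$, $$\frac{\partial\Phi}{\partial t}+\frac{\sigma^2}{2}x^2\frac{\partial^2\Phi}{\partial x^2}=\rho\,\Phi\Bigl(1+\bigl(\tfrac1\Phi\tfrac{\partial\Phi}{\partial x}x\bigr)^2\Bigr)^{1/2}\qquad(0<t<T,\ x>0),\qquad \Phi(T,x)=(x-K)^+ .\tag{1}$$ A solution of (1) means a function that is continuous on $[0,T]\times(0,\infty)$, nowhere zero and of class $C^{1,2}$ on $(0,T)\times(0,\infty)$, satisfies (1), and obeys $|\Phi(t,x)|\le A(1+x^m)$ for some $A$ and $m\in\mathbb N$. Let $u_0$ be the solution of $(\partial_\tau-\partial_y^2)u_0=0$ on $(0,\infty)\times\mathbb R$ with $u_0(0,y)=\max\{e^{y/2}-e^{-y/2},0\}$, where a solution is continuous on $[0,\infty)\times\mathbb R$, of class $C^{1,2}$ for $\tau>0$, and for each $\tau_1>0$ bounded by some $Ae^{a|y|}$ on $[0,\tau_1]\times\mathbb R$; such a solution exists. Put $$f(v_1,v_2)=-\frac{2}{\sigma^2}\sqrt{\tfrac54v_1^2+v_1v_2+v_2^2},\qquad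 G(\tau,y;s,z)=\frac{1}{2\sqrt{\pi(\tau-s)}}\exp\Bigl(-\frac{(y-z)^2}{4(\tau-s)}\Bigr),$$ $$U_1(\tau,y)=\int_0^\tau ds\int_{-\infty}^\infty dz\,G(\tau,y;s,z)\,f(u_0(s,z),u_0'(s,z)),$$ $$U_2(\tau,y)=\int_0^\tau ds\int_{-\infty}^\infty dz\,G(\tau,y;s,z)\bigl[f_{,1}(u_0(s,z),u_0'(s,z))\,U_1(s,z)+f_{,2}(u_0(s,z),u_0'(s,z))\,U_1'(s,z)\bigr],$$ where $'$ is the derivative in the second argument and $f_{,j}$ the derivative of $f$ in its $j$-th variable. For $\tau>0$ the integrands are absolutely integrable on $(0,\tau)\times\mathbb R$, $U_1$ is differentiable in $y$, and $f$ is differentiable at $(u_0,u_0')$, so these formulas make sense. Let $u=u_0+\rho U_1+\rho^2U_2$ and $$\Phi_\rho^{\rm app}(t,x)=K e^{\frac12\log\frac xK-\frac18\sigma^2(T-t)}\,u\Bigl(\tfrac12\sigma^2(T-t),\log\tfrac xK\Bigr).$$ Then $\Phi_\rho^{\rm app}$ is, up to $O(\rho^3)$, the solution of (1) for small $\rho>0$,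 in the following sense. (a) For every $\rho>0$, $\Phi^{\rm app}_\rho$ is of class $C^{1,2}$ on $(0,T)\times(0,\infty)$ and $\Phi^{\rm app}_\rho(T,x)=(x-K)^+$ for all $x>0$; and for each $(t,x)\in(0,T)\times(0,\infty)$ the difference of the two sides of the differential equation in (1), evaluated at $\Phi^{\rm app}_\rho$, is $O(\rho^3)$ as $\rho\downarrow0$. (b) There are $\rho_0>0$ and $C$, depending only on $\sigma,K,T$ (and $u_0$, which is universal), such that for every $\rho\in(0,\rho_0)$ every solution $\Phi$ of (1) satisfies $$|\Phi(t,x)-\Phi^{\rm app}_\rho(t,x)|\le C\rho^3(1+x)\qquad(0\le t\le T,\ x>0).$$ -/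

import Mathlib

open Set Filter Topology MeasureTheory Asymptotics

noncomputable section

/-- `w (t, x)` is of class `C^{1,2}` on `S` (once in the first, twice in the second variable). Used
only for open sets `S`. -/
structure IsC12On (w : ℝ → ℝ → ℝ) (S : Set (ℝ × ℝ)) : Prop where
  diff_fst : ∀ p ∈ S, DifferentiableAt ℝ (fun t => w t p.2) p.1
  diff_snd : ∀ p ∈ S, DifferentiableAt ℝ (w p.1) p.2
  diff_snd_snd : ∀ p ∈ S, DifferentiableAt ℝ (deriv (w p.1)) p.2
  cont_fst : ContinuousOn (fun p : ℝ × ℝ => deriv (fun t => w t p.2) p.1) S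
  cont_snd : ContinuousOn (fun p : ℝ × ℝ => deriv (w p.1) p.2) S
  cont_snd_snd : ContinuousOn (fun p : ℝ × ℝ => deriv (deriv (w p.1)) p.2) S

/-- Left-hand side minus right-hand side of the modified Black-Scholes equation
`∂Φ/∂t + (σ²/2) x² ∂²Φ/∂x² = ρ Φ (1 + ((1/Φ) (∂Φ/∂x) x)²)^{1/2}` at the point `(t, x)`. -/
def modifiedBSDefect (σ ρ : ℝ) (Φ : ℝ → ℝ → ℝ) (t x : ℝ) : ℝ :=
  deriv (fun t' => Φ t' x) t + σ ^ 2 / 2 * x ^ 2 * deriv (deriv (Φ t)) x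
    - ρ * Φ t x * √(1 + (1 / Φ t x * deriv (Φ t) x * x) ^ 2)

/-- Classical solutions, of at most polynomial growth, of the modified Black-Scholes equation on
`(0, T) × (0, ∞)` with the call payoff as terminal value. -/
structure IsModifiedBSCall (σ ρ K T : ℝ) (Φ : ℝ → ℝ → ℝ) : Prop where
  cont : ContinuousOn (fun p : ℝ × ℝ => Φ p.1 p.2) (Icc 0 T ×ˢ Ioi 0)
  c12 : IsC12On Φ (Ioo 0 T ×ˢ Ioi 0)
  ne_zero : ∀ t ∈ Ioo 0 T, ∀ x > 0, Φ t x ≠ 0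
  pde : ∀ t ∈ Ioo 0 T, ∀ x > 0, modifiedBSDefect σ ρ Φ t x = 0
  terminal : ∀ x > 0, Φ T x = max (x - K) 0
  growth : ∃ (A : ℝ) (m : ℕ), ∀ t ∈ Icc 0 T, ∀ x > 0, |Φ t x| ≤ A * (1 + x ^ m)

/-- Classical solutions, of at most exponential growth, of the heat equation on `(0, ∞) × ℝ` with
the transformed call payoff as initial value. -/
structure IsCallHeatSolution (u₀ : ℝ → ℝ → ℝ) : Prop where
  cont : ContinuousOn (fun p : ℝ × ℝ => u₀ p.1 p.2) (Ici 0 ×ˢ univ)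
  c12 : IsC12On u₀ (Ioi 0 ×ˢ univ)
  heat : ∀ τ > 0, ∀ y, deriv (fun s => u₀ s y) τ - deriv (deriv (u₀ τ)) y = 0
  initial : ∀ y, u₀ 0 y = max (Real.exp (y / 2) - Real.exp (-(y / 2))) 0
  growth : ∀ τ₁ > 0, ∃ A a : ℝ, ∀ τ ∈ Icc 0 τ₁, ∀ y, |u₀ τ y| ≤ A * Real.exp (a * |y|)

/-- The nonlinearity: under `Φ(t, x) = K e^{y/2 - τ/4} u(τ, y)`, `x = K e^y`, `τ = σ²(T - t)/2`,
the modified Black-Scholes equation for `Φ > 0` becomes `∂u/∂τ = ∂²u/∂y² + ρ f(u, ∂u/∂y)`. -/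
def bsNonlin (σ v₁ v₂ : ℝ) : ℝ :=
  -(2 / σ ^ 2) * √(5 / 4 * v₁ ^ 2 + v₁ * v₂ + v₂ ^ 2)

/-- The heat kernel `G(τ, y; s, z)`, for `s < τ`. -/
def heatG (τ y s z : ℝ) : ℝ :=
  1 / (2 * √(Real.pi * (τ - s))) * Real.exp (-(y - z) ^ 2 / (4 * (τ - s)))

/-- The source `f(u₀, u₀')` of `U₁`. -/
def source₁ (σ : ℝ) (u₀ : ℝ → ℝ → ℝ) (s z : ℝ) : ℝ :=
  bsNonlin σ (u₀ s z) (deriv (u₀ s) z)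

def U₁ (σ : ℝ) (u₀ : ℝ → ℝ → ℝ) (τ y : ℝ) : ℝ :=
  ∫ s in (0 : ℝ)..τ, ∫ z, heatG τ y s z * source₁ σ u₀ s z

/-- The source `f_{,1}(u₀, u₀') U₁ + f_{,2}(u₀, u₀') U₁'` of `U₂`. -/
def source₂ (σ : ℝ) (u₀ : ℝ → ℝ → ℝ) (s z : ℝ) : ℝ :=
  deriv (fun v => bsNonlin σ v (deriv (u₀ s) z)) (u₀ s z) * U₁ σ u₀ s z
    + deriv (fun v => bsNonlin σ (u₀ s z) v) (deriv (u₀ s) z) * deriv (U₁ σ u₀ s) z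

def U₂ (σ : ℝ) (u₀ : ℝ → ℝ → ℝ) (τ y : ℝ) : ℝ :=
  ∫ s in (0 : ℝ)..τ, ∫ z, heatG τ y s z * source₂ σ u₀ s z

/-- `u = u₀ + ρ U₁ + ρ² U₂`. -/
def uApprox (σ ρ : ℝ) (u₀ : ℝ → ℝ → ℝ) (τ y : ℝ) : ℝ :=
  u₀ τ y + ρ * U₁ σ u₀ τ y + ρ ^ 2 * U₂ σ u₀ τ y

/-- The approximate call price. -/
def callApprox (σ ρ K T : ℝ) (u₀ : ℝ → ℝ → ℝ) (t x : ℝ) : ℝ :=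
  K * Real.exp (1 / 2 * Real.log (x / K) - 1 / 8 * σ ^ 2 * (T - t))
    * uApprox σ ρ u₀ (1 / 2 * σ ^ 2 * (T - t)) (Real.log (x / K))

end

/-!
After the substitution `Φ(t, x) = K e^{y/2 - τ/4} u(τ, y)`, with `x = K e^y` and
`τ = σ²(T - t)/2`, the equation for a positive price becomes `∂u/∂τ = ∂²u/∂y² - cρ |(u, u/2 + u')|`,
where `c = 2/σ²` and `|·|` is the Euclidean norm of the plane. The expansion in `ρ` works because
this norm, although singular at the origin, is expanded around a vector whose length is known. With
`P = halfHeat (1/2)`, the heat flow of `e^{y/2} 1_{y > 0}`, the unperturbed solution satisfies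
`u₀/2 + u₀' = P` and `0 < u₀ ≤ P`, so that `P ≤ |(u₀, u₀/2 + u₀')| ≤ 2P`.

*Size of the corrections.* The first source is at most a multiple of `P` and its spatial derivative
at most a multiple of `P' = P/2 + Γ`, with `Γ` the Gauss kernel. Both `P` and `P'` are propagated by
the heat semigroup (`heatAvg_heatAvg`), whence `|U₁|` and `|U₁'|` are at most a multiple of `τ P'`
(`abs_U₁_le`, `abs_U₁Y_le`). Since `τ Γ² ≤ C P` (`exists_mul_gaussKer_sq_le`), the quotient
`|(U₁, U₁')|² / P` grows at most like `e^{|y|/2}`. This controls the second-order Taylor remainder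
of the norm, and also the spatial derivative of the second source.

*Regularity.* A source bounded up to time zero whose spatial derivative is `O(s^{-1/2})` has a
Duhamel potential of class `C^{1,2}` that solves the inhomogeneous heat equation
(`IsSmoothSource.hasParabolicJet`). One spatial derivative falls on the source, the second on the
Gaussian density, and the time derivative comes from Fubini's theorem on a triangle. Both sources
are of this kind.

*Comparison.* Inserting the approximation into the equation therefore leaves a residual that is
`O(ρ³ (1 + x))` (`exists_abs_approxResidual_le`). A solution of the equation with the call payoff is
positive, and the norm is Lipschitz, so the difference of the solution and the approximation obeys a
linear parabolic inequality with bounded coefficients; the maximum principle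
(`abs_le_of_parabolic_inequality`) bounds it by the residual. The same principle shows that every
`u₀` is the explicit one, `callHeat`.
-/

/-! ### Time convolution of kernels with square-root singularities -/

lemma ae_mem_Ioo_of_mem_uIoc {τ : ℝ} (hτ : 0 < τ) :
    ∀ᵐ s : ℝ, s ∈ uIoc 0 τ → s ∈ Ioo 0 τ := by
  filter_upwards [(Set.countable_singleton τ).ae_notMem volume] with s hs hmem
  rw [uIoc_of_le hτ.le] at hmem
  exact ⟨hmem.1, lt_of_le_of_ne hmem.2 hs⟩

lemma ContinuousOn.aestronglyMeasurable_uIoc {τ : ℝ} (hτ : 0 < τ) {f : ℝ → ℝ}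
    (hf : ContinuousOn f (Ioo 0 τ)) : AEStronglyMeasurable f (volume.restrict (uIoc 0 τ)) := by
  rw [uIoc_of_le hτ.le, ← Measure.restrict_congr_set Ioo_ae_eq_Ioc]
  exact hf.aestronglyMeasurable measurableSet_Ioo

lemma intervalIntegrable_one_div_sqrt (a b : ℝ) :
    IntervalIntegrable (fun s => 1 / √s) volume a b := by
  have h : (fun s : ℝ => 1 / √s) = fun s => (√s)⁻¹ := by ext; simp
  have h0 : ∀ b : ℝ, IntervalIntegrable (fun s : ℝ => (√s)⁻¹) volume 0 b := by
    intro b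
    rcases le_total 0 b with hb | hb
    · refine (intervalIntegral.intervalIntegrable_rpow' (r := -(1 / 2)) (by norm_num)).congr ?_
      intro s hs
      rw [uIoc_of_le hb] at hs
      simp only [Real.rpow_neg hs.1.le, ← Real.sqrt_eq_rpow]
    · refine (intervalIntegrable_const (c := (0 : ℝ))).congr ?_
      intro s hs
      rw [uIoc_of_ge hb] at hs
      simp [Real.sqrt_eq_zero_of_nonpos hs.2]
  rw [h]
  exact (h0 a).symm.trans (h0 b)

lemma integral_one_div_sqrt {τ : ℝ} (hτ : 0 ≤ τ) : ∫ s in (0 : ℝ)..τ, 1 / √s = 2 * √τ := by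
  have h : ∫ s in (0 : ℝ)..τ, 1 / √s = ∫ s in (0 : ℝ)..τ, s ^ (-(1 / 2) : ℝ) := by
    refine intervalIntegral.integral_congr fun s hs => ?_
    rw [uIcc_of_le hτ] at hs
    simp only [Real.rpow_neg hs.1, one_div]
    rw [Real.sqrt_eq_rpow, one_div]
  rw [h, integral_rpow (Or.inl (by norm_num))]
  norm_num
  rw [← Real.sqrt_eq_rpow]
  ring

lemma one_div_sqrt_mul_sqrt_le {s r : ℝ} (hs : 0 < s) (hr : 0 < r) :
    1 / (√s * √r) ≤ 1 / √(s + r) * (1 / √s + 1 / √r) := by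
  have h1 := Real.sqrt_pos.2 hs
  have h2 := Real.sqrt_pos.2 hr
  have h3 := Real.sqrt_pos.2 (add_pos hs hr)
  have h4 : √(s + r) ≤ √s + √r := Real.sqrt_le_iff.2 ⟨by positivity, by
    nlinarith [Real.sq_sqrt hs.le, Real.sq_sqrt hr.le, mul_pos h1 h2]⟩
  rw [div_add_div _ _ h1.ne' h2.ne', div_mul_div_comm,
    div_le_div_iff₀ (by positivity) (by positivity)]
  have : 0 < √s * √r := by positivity
  nlinarith

lemma intervalIntegrable_beta {τ : ℝ} (hτ : 0 < τ) :
    IntervalIntegrable (fun s => 1 / (√s * √(τ - s))) volume 0 τ := by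
  have h2 : IntervalIntegrable (fun s => 1 / √(τ - s)) volume 0 τ := by
    have := (intervalIntegrable_one_div_sqrt 0 τ).comp_sub_left τ
    simpa using this.symm
  refine (((intervalIntegrable_one_div_sqrt 0 τ).add h2).const_mul (1 / √τ)).mono_fun ?_ ?_
  · refine ContinuousOn.aestronglyMeasurable_uIoc hτ ?_
    refine continuousOn_const.div (by fun_prop) fun s hs => ?_
    have h1 := Real.sqrt_pos.2 hs.1
    have h2 := Real.sqrt_pos.2 (sub_pos.2 hs.2)
    positivity
  · rw [EventuallyLE, ae_restrict_iff' measurableSet_uIoc]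
    filter_upwards [ae_mem_Ioo_of_mem_uIoc hτ] with s hs hmem
    have hs := hs hmem
    have := one_div_sqrt_mul_sqrt_le hs.1 (sub_pos.2 hs.2)
    rw [add_sub_cancel] at this
    rw [Real.norm_of_nonneg (by positivity), Real.norm_of_nonneg (by positivity)]
    exact this

lemma integral_beta_le {τ : ℝ} (hτ : 0 < τ) :
    ∫ s in (0 : ℝ)..τ, 1 / (√s * √(τ - s)) ≤ 4 := by
  have h2 : IntervalIntegrable (fun s => 1 / √(τ - s)) volume 0 τ := by
    have := (intervalIntegrable_one_div_sqrt 0 τ).comp_sub_left τ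
    simpa using this.symm
  have h1 := intervalIntegrable_one_div_sqrt 0 τ
  have hle : ∫ s in (0 : ℝ)..τ, 1 / (√s * √(τ - s))
      ≤ ∫ s in (0 : ℝ)..τ, 1 / √τ * (1 / √s + 1 / √(τ - s)) := by
    refine intervalIntegral.integral_mono_on_of_le_Ioo hτ.le (intervalIntegrable_beta hτ)
      ((h1.add h2).const_mul _) fun s hs => ?_
    have := one_div_sqrt_mul_sqrt_le hs.1 (sub_pos.2 hs.2)
    rwa [add_sub_cancel] at this
  refine hle.trans ?_
  rw [intervalIntegral.integral_const_mul, intervalIntegral.integral_add h1 h2,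
    intervalIntegral.integral_comp_sub_left (fun s => 1 / √s), sub_self, sub_zero,
    integral_one_div_sqrt hτ.le]
  have h3 := Real.sqrt_pos.2 hτ
  rw [show 1 / √τ * (2 * √τ + 2 * √τ) = 4 by field_simp; norm_num]

/-- A kernel `e s r y` (source time `s`, elapsed time `r`, position `y`) that is continuous for
`s, r > 0`, with inverse square root singularities in both times and growth `e^{|y|/2}`. -/
structure IsSingularKernel (e : ℝ → ℝ → ℝ → ℝ) : Prop where
  cont : ContinuousOn (fun p : ℝ × ℝ × ℝ => e p.1 p.2.1 p.2.2) {p | 0 < p.1 ∧ 0 < p.2.1}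
  bound : ∀ τ₁ > 0, ∃ A ≥ 0, ∀ s ∈ Ioc 0 τ₁, ∀ r ∈ Ioc 0 τ₁, ∀ y,
    |e s r y| ≤ A / (√s * √r) * Real.exp (|y| / 2)

/-- Convolution of a kernel in time. -/
noncomputable def timeConv (e : ℝ → ℝ → ℝ → ℝ) (τ y : ℝ) : ℝ := ∫ s in (0 : ℝ)..τ, e s (τ - s) y

namespace IsSingularKernel

variable {e e' : ℝ → ℝ → ℝ → ℝ}

lemma continuousOn_slice (he : IsSingularKernel e) (τ y : ℝ) :
    ContinuousOn (fun s => e s (τ - s) y) (Ioo 0 τ) :=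
  he.cont.comp (f := fun s : ℝ => (s, τ - s, y)) (by fun_prop)
    fun _ hs => ⟨hs.1, sub_pos.2 hs.2⟩

lemma bound_slice (he : IsSingularKernel e) {τ₁ : ℝ} (hτ₁ : 0 < τ₁) :
    ∃ A ≥ 0, ∀ τ ∈ Ioc 0 τ₁, ∀ s ∈ Ioo 0 τ, ∀ y,
      |e s (τ - s) y| ≤ A * Real.exp (|y| / 2) * (1 / (√s * √(τ - s))) := by
  obtain ⟨A, hA, h⟩ := he.bound τ₁ hτ₁
  refine ⟨A, hA, fun τ hτ s hs y => (h s ⟨hs.1, hs.2.le.trans hτ.2⟩ (τ - s)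
    ⟨sub_pos.2 hs.2, by linarith [hs.1, hτ.2]⟩ y).trans (le_of_eq ?_)⟩
  ring

lemma intervalIntegrable (he : IsSingularKernel e) {τ : ℝ} (hτ : 0 < τ) (y : ℝ) :
    IntervalIntegrable (fun s => e s (τ - s) y) volume 0 τ := by
  obtain ⟨A, hA, h⟩ := he.bound_slice hτ
  refine ((intervalIntegrable_beta hτ).const_mul (A * Real.exp (|y| / 2))).mono_fun
    ((he.continuousOn_slice τ y).aestronglyMeasurable_uIoc hτ) ?_
  rw [EventuallyLE, ae_restrict_iff' measurableSet_uIoc]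
  filter_upwards [ae_mem_Ioo_of_mem_uIoc hτ] with s hs hmem
  rw [Real.norm_eq_abs, Real.norm_of_nonneg (by positivity)]
  exact h τ ⟨hτ, le_rfl⟩ s (hs hmem) y

lemma abs_timeConv_le (he : IsSingularKernel e) {τ₁ : ℝ} (hτ₁ : 0 < τ₁) :
    ∃ C ≥ 0, ∀ τ ∈ Ioc 0 τ₁, ∀ y, |timeConv e τ y| ≤ C * Real.exp (|y| / 2) := by
  obtain ⟨A, hA, h⟩ := he.bound_slice hτ₁
  refine ⟨4 * A, by positivity, fun τ hτ y => ?_⟩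
  have hi := (intervalIntegrable_beta hτ.1).const_mul (A * Real.exp (|y| / 2))
  have h1 : |timeConv e τ y|
      ≤ ∫ s in (0 : ℝ)..τ, A * Real.exp (|y| / 2) * (1 / (√s * √(τ - s))) := by
    refine intervalIntegral.norm_integral_le_of_norm_le (f := fun s => e s (τ - s) y)
      hτ.1.le ?_ hi
    filter_upwards [ae_mem_Ioo_of_mem_uIoc hτ.1] with s hs hmem
    rw [uIoc_of_le hτ.1.le] at hs
    exact h τ hτ s (hs hmem) y
  rw [intervalIntegral.integral_const_mul] at h1
  have h2 := mul_le_mul_of_nonneg_left (integral_beta_le hτ.1)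
    (show 0 ≤ A * Real.exp (|y| / 2) by positivity)
  linarith

lemma timeConv_eq_unit (e : ℝ → ℝ → ℝ → ℝ) (τ y : ℝ) :
    timeConv e τ y = ∫ θ in (0 : ℝ)..1, τ * e (τ * θ) (τ * (1 - θ)) y := by
  have := intervalIntegral.smul_integral_comp_mul_left (a := 0) (b := 1)
    (fun s => e s (τ - s) y) τ
  simp only [mul_zero, mul_one] at this
  rw [timeConv, ← this, smul_eq_mul, ← intervalIntegral.integral_const_mul]
  simp only [mul_sub, mul_one]

/-- Rescaling time to the unit interval makes the domain of integration independent of `τ`, so that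
dominated convergence applies in spite of the moving singularity. -/
lemma continuousOn_timeConv (he : IsSingularKernel e) :
    ContinuousOn (fun p : ℝ × ℝ => timeConv e p.1 p.2) (Ioi 0 ×ˢ univ) := by
  rintro ⟨τ₀, y₀⟩ ⟨hτ₀ : 0 < τ₀, -⟩
  refine ContinuousAt.continuousWithinAt ?_
  simp only [timeConv_eq_unit]
  obtain ⟨A, hA, h⟩ := he.bound (2 * τ₀) (by positivity)
  have hnhds : ∀ᶠ p : ℝ × ℝ in 𝓝 (τ₀, y₀), p.1 ∈ Ioo 0 (2 * τ₀) ∧ |p.2| < |y₀| + 1 := by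
    refine (continuousAt_fst.eventually_mem (Ioo_mem_nhds hτ₀ (by simp; linarith))).and ?_
    exact (continuous_snd.abs.continuousAt).eventually_lt continuousAt_const (by simp)
  have hbeta := intervalIntegrable_beta one_pos
  refine intervalIntegral.continuousAt_of_dominated_interval
    (bound := fun θ => A * Real.exp ((|y₀| + 1) / 2) * (1 / (√θ * √(1 - θ)))) ?_ ?_
    (hbeta.const_mul _) ?_
  · filter_upwards [hnhds] with p hp
    refine ContinuousOn.aestronglyMeasurable_uIoc one_pos ?_
    refine continuousOn_const.mul ?_
    exact he.cont.comp (f := fun θ : ℝ => (p.1 * θ, p.1 * (1 - θ), p.2)) (by fun_prop)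
      fun θ hθ => ⟨mul_pos hp.1.1 hθ.1, mul_pos hp.1.1 (sub_pos.2 hθ.2)⟩
  · filter_upwards [hnhds] with p hp
    filter_upwards [ae_mem_Ioo_of_mem_uIoc one_pos] with θ hθ hmem
    obtain ⟨h0, h1⟩ := hθ hmem
    have h1' := sub_pos.2 h1
    have hp0 := hp.1.1
    have hb := h (p.1 * θ) ⟨by positivity, by nlinarith [hp.1.2]⟩ (p.1 * (1 - θ))
      ⟨by positivity, by nlinarith [hp.1.2]⟩ p.2
    rw [Real.sqrt_mul hp0.le, Real.sqrt_mul hp0.le] at hb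
    have hs := Real.mul_self_sqrt hp0.le
    rw [norm_mul, Real.norm_of_nonneg hp0.le, Real.norm_eq_abs]
    have he1 : Real.exp (|p.2| / 2) ≤ Real.exp ((|y₀| + 1) / 2) :=
      Real.exp_le_exp.2 (by linarith [hp.2])
    have h5 := Real.sqrt_pos.2 hp0
    have h6 := Real.sqrt_pos.2 h0
    have h7 := Real.sqrt_pos.2 h1'
    calc p.1 * |e (p.1 * θ) (p.1 * (1 - θ)) p.2|
        ≤ p.1 * (A / (√p.1 * √θ * (√p.1 * √(1 - θ))) * Real.exp (|p.2| / 2)) := by gcongr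
      _ = A * Real.exp (|p.2| / 2) * (1 / (√θ * √(1 - θ))) * (p.1 / (√p.1 * √p.1)) := by
          field_simp
      _ = A * Real.exp (|p.2| / 2) * (1 / (√θ * √(1 - θ))) := by
          rw [hs, div_self hp0.ne', mul_one]
      _ ≤ _ := by gcongr
  · filter_upwards [ae_mem_Ioo_of_mem_uIoc one_pos] with θ hθ hmem
    obtain ⟨h0, h1⟩ := hθ hmem
    refine continuousAt_fst.mul ?_
    have hopen : IsOpen {p : ℝ × ℝ × ℝ | 0 < p.1 ∧ 0 < p.2.1} :=
      (isOpen_lt continuous_const continuous_fst).inter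
        (isOpen_lt continuous_const (continuous_fst.comp continuous_snd))
    have hc := he.cont.continuousAt (hopen.mem_nhds
      (show ((τ₀ * θ, τ₀ * (1 - θ), y₀) : ℝ × ℝ × ℝ) ∈ _ from
        ⟨mul_pos hτ₀ h0, mul_pos hτ₀ (sub_pos.2 h1)⟩))
    exact ContinuousAt.comp (f := fun p : ℝ × ℝ => (p.1 * θ, p.1 * (1 - θ), p.2))
      (x := (τ₀, y₀)) hc (by fun_prop)

lemma hasDerivAt_timeConv (he : IsSingularKernel e) (he' : IsSingularKernel e')
    (hd : ∀ s > 0, ∀ r > 0, ∀ y, HasDerivAt (e s r) (e' s r y) y) {τ : ℝ} (hτ : 0 < τ) (y : ℝ) :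
    HasDerivAt (timeConv e τ) (timeConv e' τ y) y := by
  obtain ⟨A, hA, h⟩ := he'.bound_slice hτ
  refine (intervalIntegral.hasDerivAt_integral_of_dominated_loc_of_deriv_le
    (F := fun y s => e s (τ - s) y) (F' := fun y s => e' s (τ - s) y)
    (bound := fun s => A * Real.exp ((|y| + 1) / 2) * (1 / (√s * √(τ - s))))
    (Metric.ball_mem_nhds y one_pos) ?_ (he.intervalIntegrable hτ y)
    ((he'.continuousOn_slice τ y).aestronglyMeasurable_uIoc hτ) ?_
    ((intervalIntegrable_beta hτ).const_mul _) ?_).2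
  · exact Eventually.of_forall fun z =>
      (he.continuousOn_slice τ z).aestronglyMeasurable_uIoc hτ
  · filter_upwards [ae_mem_Ioo_of_mem_uIoc hτ] with s hs hmem z hz
    refine (h τ ⟨hτ, le_rfl⟩ s (hs hmem) z).trans ?_
    have : |z| ≤ |y| + 1 := by
      rw [Metric.mem_ball, Real.dist_eq] at hz
      have := abs_sub_abs_le_abs_sub z y
      linarith
    gcongr
  · filter_upwards [ae_mem_Ioo_of_mem_uIoc hτ] with s hs hmem z hz
    exact hd s (hs hmem).1 _ (sub_pos.2 (hs hmem).2) z

/-- The integrand over the triangle `0 < s < t < τ`, extended by zero. -/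
lemma integrable_triangle (he : IsSingularKernel e) {τ : ℝ} (hτ : 0 < τ) (y : ℝ) :
    Integrable (Function.uncurry fun t s => if s < t then e s (t - s) y else 0)
      ((volume.restrict (Ioc 0 τ)).prod (volume.restrict (Ioc 0 τ))) := by
  obtain ⟨A, hA, h⟩ := he.bound_slice hτ
  have hint : Integrable (fun s => (Ioc 0 τ).indicator (fun s => 1 / √s) s) := by
    rw [integrable_indicator_iff measurableSet_Ioc]
    exact (intervalIntegrable_iff_integrableOn_Ioc_of_le hτ.le).1
      (intervalIntegrable_one_div_sqrt 0 τ)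
  have hconv := (hint.convolution_integrand (ContinuousLinearMap.mul ℝ ℝ) hint).const_mul
    (A * Real.exp (|y| / 2))
  rw [Measure.prod_restrict]
  refine (hconv.mono_measure Measure.restrict_le_self).mono' ?_ ?_
  · set S : Set (ℝ × ℝ) := {p | p.2 < p.1} with hS
    have hSo : IsOpen S := isOpen_lt continuous_snd continuous_fst
    have heq : (Function.uncurry fun t s => if s < t then e s (t - s) y else 0)
        = S.indicator fun p => e p.2 (p.1 - p.2) y := by
      ext p
      simp [Function.uncurry, S, indicator]
    rw [heq, aestronglyMeasurable_indicator_iff hSo.measurableSet, Measure.restrict_restrict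
      hSo.measurableSet]
    refine ContinuousOn.aestronglyMeasurable ?_
      (hSo.measurableSet.inter (measurableSet_Ioc.prod measurableSet_Ioc))
    exact he.cont.comp (f := fun p : ℝ × ℝ => (p.2, p.1 - p.2, y)) (by fun_prop)
      fun p hp => ⟨hp.2.2.1, sub_pos.2 hp.1⟩
  · rw [ae_restrict_iff' (measurableSet_Ioc.prod measurableSet_Ioc)]
    refine Eventually.of_forall ?_
    rintro ⟨t, s⟩ ⟨ht, hs⟩
    simp only [Function.uncurry_apply_pair, ContinuousLinearMap.mul_apply']
    split_ifs with hst
    · have h1 := h t ht s ⟨hs.1, hst⟩ y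
      have h2 : t - s ∈ Ioc 0 τ := ⟨sub_pos.2 hst, by linarith [hs.1, ht.2]⟩
      rw [indicator_of_mem (show s ∈ Ioc 0 τ from hs), indicator_of_mem h2]
      refine h1.trans (le_of_eq ?_)
      rw [div_mul_div_comm, one_mul]
    · rw [norm_zero]
      refine mul_nonneg (by positivity) (mul_nonneg ?_ ?_) <;>
        exact indicator_nonneg (fun _ _ => by positivity) _

/-- Time derivative of a time convolution: if `e` has initial value `g` and derivative `e'` in
elapsed time, Fubini's theorem over the triangle `s < t < τ` writes the convolution as the integral
over `t` of `g t` plus the convolution of `e'`. -/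
lemma hasDerivAt_timeConv_time (he : IsSingularKernel e) (he' : IsSingularKernel e') {g : ℝ → ℝ}
    {y : ℝ} (hd : ∀ s > 0, ∀ r > 0, HasDerivAt (fun r => e s r y) (e' s r y) r)
    (h0 : ∀ s > 0, Tendsto (fun r => e s r y) (𝓝[>] 0) (𝓝 (g s)))
    (hg : ContinuousOn g (Ioi 0)) (hgb : ∀ τ₁ > 0, ∃ B, ∀ s ∈ Ioc 0 τ₁, |g s| ≤ B)
    {τ : ℝ} (hτ : 0 < τ) :
    HasDerivAt (fun τ => timeConv e τ y) (g τ + timeConv e' τ y) τ := by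
  have hJ : ContinuousOn (fun t => timeConv e' t y) (Ioi 0) :=
    he'.continuousOn_timeConv.comp (f := fun t : ℝ => (t, y)) (by fun_prop)
      fun t ht => ⟨ht, trivial⟩
  have hint : ∀ {f : ℝ → ℝ}, ContinuousOn f (Ioi 0) →
      (∀ τ₁ > 0, ∃ B, ∀ s ∈ Ioc 0 τ₁, |f s| ≤ B) → ∀ {τ : ℝ}, 0 < τ →
      IntervalIntegrable f volume 0 τ := by
    intro f hf hb τ hτ
    obtain ⟨B, hB⟩ := hb τ hτ
    refine (intervalIntegrable_const (c := B)).mono_fun'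
      ((hf.mono Ioo_subset_Ioi_self).aestronglyMeasurable_uIoc hτ) ?_
    rw [EventuallyLE, ae_restrict_iff' measurableSet_uIoc]
    refine Eventually.of_forall fun s hs => ?_
    rw [uIoc_of_le hτ.le] at hs
    exact hB s hs
  have hJb : ∀ τ₁ > 0, ∃ B, ∀ t ∈ Ioc 0 τ₁, |timeConv e' t y| ≤ B := fun τ₁ h => by
    obtain ⟨C, -, hC⟩ := he'.abs_timeConv_le h
    exact ⟨_, fun t ht => hC t ht y⟩
  have key : ∀ τ > 0, timeConv e τ y = ∫ t in (0 : ℝ)..τ, (g t + timeConv e' t y) := by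
    intro τ hτ
    rw [intervalIntegral.integral_add (hint hg hgb hτ) (hint hJ hJb hτ)]
    have hsw := integral_integral_swap (he'.integrable_triangle hτ y)
    have hL : ∫ t in (0 : ℝ)..τ, timeConv e' t y
        = ∫ t in Ioc 0 τ, ∫ s in Ioc 0 τ, if s < t then e' s (t - s) y else 0 := by
      rw [intervalIntegral.integral_of_le hτ.le]
      refine setIntegral_congr_fun measurableSet_Ioc fun t ht => ?_
      have : (fun s => if s < t then e' s (t - s) y else 0)
          = (Iio t).indicator fun s => e' s (t - s) y := by
        ext s
        simp [indicator]
      simp only [this]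
      rw [setIntegral_indicator measurableSet_Iio, timeConv,
        intervalIntegral.integral_of_le ht.1.le, integral_Ioc_eq_integral_Ioo]
      congr 2
      ext s
      simp only [mem_Ioc, mem_inter_iff, mem_Iio, mem_Ioo]
      exact ⟨fun h => ⟨⟨h.1, h.2.le.trans ht.2⟩, h.2⟩, fun h => ⟨h.1.1, h.2⟩⟩
    have hR : ∫ s in Ioc 0 τ, ∫ t in Ioc 0 τ, (if s < t then e' s (t - s) y else 0)
        = ∫ s in (0 : ℝ)..τ, (e s (τ - s) y - g s) := by
      rw [intervalIntegral.integral_of_le hτ.le, integral_Ioc_eq_integral_Ioo,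
        integral_Ioc_eq_integral_Ioo]
      refine setIntegral_congr_fun measurableSet_Ioo fun s hs => ?_
      have : (fun t => if s < t then e' s (t - s) y else 0)
          = (Ioi s).indicator fun t => e' s (t - s) y := by
        ext t
        simp [indicator]
      simp only [this]
      have hset : Ioc 0 τ ∩ Ioi s = Ioc s τ := by
        ext t
        simp only [mem_Ioc, mem_inter_iff, mem_Ioi]
        exact ⟨fun h => ⟨h.2, h.1.2⟩, fun h => ⟨⟨hs.1.trans h.1, h.2⟩, h.1⟩⟩
      rw [setIntegral_indicator measurableSet_Ioi, hset, ← intervalIntegral.integral_of_le hs.2.le,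
        intervalIntegral.integral_comp_sub_right (fun r => e' s r y), sub_self]
      have hr : 0 < τ - s := sub_pos.2 hs.2
      refine intervalIntegral.integral_eq_sub_of_hasDerivAt_of_tendsto hr
        (fun r hr => hd s hs.1 r hr.1) ?_ (h0 s hs.1)
        ((hd s hs.1 _ hr).continuousAt.tendsto.mono_left inf_le_left)
      -- for fixed `s > 0` the singularity in the elapsed time alone is integrable
      obtain ⟨A, hA, hb⟩ := he'.bound τ hτ
      refine ((intervalIntegrable_one_div_sqrt 0 (τ - s)).const_mul
        (A / √s * Real.exp (|y| / 2))).mono_fun' ?_ ?_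
      · exact ContinuousOn.aestronglyMeasurable_uIoc hr
          (he'.cont.comp (f := fun r : ℝ => (s, r, y)) (by fun_prop) fun r hr => ⟨hs.1, hr.1⟩)
      · rw [EventuallyLE, ae_restrict_iff' measurableSet_uIoc]
        refine Eventually.of_forall fun r hmem => ?_
        rw [uIoc_of_le hr.le] at hmem
        refine (hb s ⟨hs.1, hs.2.le⟩ r ⟨hmem.1, by linarith [hmem.2, hs.1]⟩ y).trans (le_of_eq ?_)
        rw [← div_div]
        ring
    rw [hL, hsw, hR, intervalIntegral.integral_sub (he.intervalIntegrable hτ y) (hint hg hgb hτ),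
      timeConv]
    ring
  have hcont : ContinuousOn (fun t => g t + timeConv e' t y) (Ioi 0) := hg.add hJ
  have h1 : HasDerivAt (fun u => ∫ t in (0 : ℝ)..u, (g t + timeConv e' t y))
      (g τ + timeConv e' τ y) τ :=
    intervalIntegral.integral_hasDerivAt_right ((hint hg hgb hτ).add (hint hJ hJb hτ))
      (hcont.stronglyMeasurableAtFilter isOpen_Ioi _ hτ) (hcont.continuousAt (Ioi_mem_nhds hτ))
  exact h1.congr_of_eventuallyEq (eventually_of_mem (Ioi_mem_nhds hτ) key)

end IsSingularKernel

/-! ### Gaussian averages -/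

open ProbabilityTheory

/-- The heat semigroup: the mean of `h` over the normal law with mean `y` and variance `2r`. -/
noncomputable def heatAvg (h : ℝ → ℝ) (r y : ℝ) : ℝ :=
  ∫ ξ, h (y + √(2 * r) * ξ) ∂gaussianReal 0 1

/-- The spatial derivative of `heatAvg h` at elapsed time `r > 0`, with the derivative carried by
the Gaussian density, so that `h` need not be differentiable. -/
noncomputable def heatAvgDeriv (h : ℝ → ℝ) (r y : ℝ) : ℝ :=
  (∫ ξ, h (y + √(2 * r) * ξ) * ξ ∂gaussianReal 0 1) / √(2 * r)

lemma integrable_exp_mul_abs_gaussian (c : ℝ) :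
    Integrable (fun ξ => Real.exp (c * |ξ|)) (gaussianReal 0 1) :=
  integrable_exp_mul_abs (X := id) (integrable_exp_mul_gaussianReal c)
    (integrable_exp_mul_gaussianReal (-c))

lemma abs_le_exp_abs (x : ℝ) : |x| ≤ Real.exp |x| :=
  (le_add_of_nonneg_right zero_le_one).trans (Real.add_one_le_exp _)

/-- The basic domination: growth `e^{|z|/2}` at a Gaussian argument, times a factor of at most
`e^{|ξ|}`. -/
lemma exp_half_abs_add_le {y a b Y ξ : ℝ} (hY : |y| ≤ Y) (ha : |a| ≤ b) :
    Real.exp (|y + a * ξ| / 2) * Real.exp |ξ|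
      ≤ Real.exp (Y / 2) * Real.exp ((b / 2 + 1) * |ξ|) := by
  rw [← Real.exp_add, ← Real.exp_add, Real.exp_le_exp]
  have h1 := abs_add_le y (a * ξ)
  rw [abs_mul] at h1
  have h2 := mul_le_mul_of_nonneg_right ha (abs_nonneg ξ)
  nlinarith

section Integrability

variable {h : ℝ → ℝ} {B : ℝ}

lemma norm_weighted_le (hb : ∀ z, |h z| ≤ B * Real.exp (|z| / 2)) (hB : 0 ≤ B)
    {w : ℝ → ℝ} (hw : ∀ ξ, |w ξ| ≤ Real.exp |ξ|) {y a b Y : ℝ} (hY : |y| ≤ Y) (ha : |a| ≤ b)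
    (ξ : ℝ) :
    ‖h (y + a * ξ) * w ξ‖ ≤ B * Real.exp (Y / 2) * Real.exp ((b / 2 + 1) * |ξ|) := by
  rw [norm_mul, Real.norm_eq_abs, Real.norm_eq_abs]
  calc |h (y + a * ξ)| * |w ξ| ≤ B * Real.exp (|y + a * ξ| / 2) * Real.exp |ξ| :=
        mul_le_mul (hb _) (hw ξ) (abs_nonneg _) (by positivity)
    _ = B * (Real.exp (|y + a * ξ| / 2) * Real.exp |ξ|) := by ring
    _ ≤ B * (Real.exp (Y / 2) * Real.exp ((b / 2 + 1) * |ξ|)) := by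
        exact mul_le_mul_of_nonneg_left (exp_half_abs_add_le hY ha) hB
    _ = _ := by ring

lemma integrable_weighted (hm : Measurable h) (hb : ∀ z, |h z| ≤ B * Real.exp (|z| / 2))
    {w : ℝ → ℝ} (hwm : Measurable w) (hw : ∀ ξ, |w ξ| ≤ Real.exp |ξ|) (y a : ℝ) :
    Integrable (fun ξ => h (y + a * ξ) * w ξ) (gaussianReal 0 1) := by
  have hB : 0 ≤ B := by simpa using (abs_nonneg _).trans (hb 0)
  exact ((integrable_exp_mul_abs_gaussian _).const_mul _).mono'
    ((hm.comp (by fun_prop)).mul hwm).aestronglyMeasurable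
    (Eventually.of_forall (norm_weighted_le hb hB hw le_rfl le_rfl))

lemma abs_one_le_exp_abs (ξ : ℝ) : |(1 : ℝ)| ≤ Real.exp |ξ| := by
  rw [abs_one]
  exact Real.one_le_exp (abs_nonneg ξ)

lemma integrable_heatAvg (hm : Measurable h) (hb : ∀ z, |h z| ≤ B * Real.exp (|z| / 2))
    (y a : ℝ) : Integrable (fun ξ => h (y + a * ξ)) (gaussianReal 0 1) := by
  simpa using integrable_weighted hm hb (w := fun _ => 1) measurable_const abs_one_le_exp_abs y a

lemma norm_integral_weighted_le (hb : ∀ z, |h z| ≤ B * Real.exp (|z| / 2))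
    {w : ℝ → ℝ} (hw : ∀ ξ, |w ξ| ≤ Real.exp |ξ|) {y a b : ℝ} (ha : |a| ≤ b) :
    |∫ ξ, h (y + a * ξ) * w ξ ∂gaussianReal 0 1|
      ≤ B * Real.exp (|y| / 2) * ∫ ξ, Real.exp ((b / 2 + 1) * |ξ|) ∂gaussianReal 0 1 := by
  have hB : 0 ≤ B := by simpa using (abs_nonneg _).trans (hb 0)
  rw [← integral_const_mul]
  exact norm_integral_le_of_norm_le ((integrable_exp_mul_abs_gaussian _).const_mul _)
    (Eventually.of_forall (norm_weighted_le hb hB hw le_rfl ha))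

/-- The constant in the bounds for Gaussian averages up to elapsed time `τ₁`. -/
noncomputable def gaussConst (τ₁ : ℝ) : ℝ :=
  ∫ ξ, Real.exp ((√(2 * τ₁) / 2 + 1) * |ξ|) ∂gaussianReal 0 1

lemma gaussConst_nonneg (τ₁ : ℝ) : 0 ≤ gaussConst τ₁ :=
  integral_nonneg fun _ => by positivity

lemma abs_sqrt_le_sqrt {r τ₁ : ℝ} (hr : r ≤ τ₁) : |√(2 * r)| ≤ √(2 * τ₁) := by
  rw [abs_of_nonneg (Real.sqrt_nonneg _)]
  exact Real.sqrt_le_sqrt (by linarith)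

lemma abs_heatAvg_le (hb : ∀ z, |h z| ≤ B * Real.exp (|z| / 2)) {r τ₁ : ℝ} (hr : r ≤ τ₁) (y : ℝ) :
    |heatAvg h r y| ≤ B * gaussConst τ₁ * Real.exp (|y| / 2) := by
  have := norm_integral_weighted_le hb (w := fun _ => 1) abs_one_le_exp_abs (y := y)
    (abs_sqrt_le_sqrt hr)
  simp only [mul_one] at this
  rw [heatAvg, gaussConst]
  linarith

lemma abs_heatAvgDeriv_le (hb : ∀ z, |h z| ≤ B * Real.exp (|z| / 2)) {r τ₁ : ℝ} (hr0 : 0 < r)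
    (hr : r ≤ τ₁) (y : ℝ) :
    |heatAvgDeriv h r y| ≤ B * gaussConst τ₁ * Real.exp (|y| / 2) / √r := by
  have hB : 0 ≤ B := by simpa using (abs_nonneg _).trans (hb 0)
  have := norm_integral_weighted_le hb (w := fun ξ => ξ) abs_le_exp_abs (y := y)
    (abs_sqrt_le_sqrt hr)
  have hJ := gaussConst_nonneg τ₁
  have hs := Real.sqrt_pos.2 hr0
  have hs2 : √r ≤ √(2 * r) := Real.sqrt_le_sqrt (by linarith)
  rw [heatAvgDeriv, abs_div, abs_of_nonneg (Real.sqrt_nonneg (2 * r))]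
  refine div_le_div₀ (by positivity) (this.trans (le_of_eq ?_)) hs hs2
  rw [gaussConst]
  ring

end Integrability

lemma continuousWithinAt_weighted {g : ℝ → ℝ → ℝ} {S : Set (ℝ × ℝ × ℝ)}
    (hc : ContinuousOn (fun p : ℝ × ℝ => g p.1 p.2) (Ioi 0 ×ˢ univ))
    (hb : ∀ τ₁ > 0, ∃ A ≥ 0, ∀ s ∈ Ioc 0 τ₁, ∀ z, |g s z| ≤ A / √s * Real.exp (|z| / 2))
    {w : ℝ → ℝ} (hwm : Measurable w) (hw : ∀ ξ, |w ξ| ≤ Real.exp |ξ|)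
    {p₀ : ℝ × ℝ × ℝ} (hp₀ : 0 < p₀.1) :
    ContinuousWithinAt (fun p : ℝ × ℝ × ℝ =>
      ∫ ξ, g p.1 (p.2.2 + √(2 * p.2.1) * ξ) * w ξ ∂gaussianReal 0 1) S p₀ := by
  refine ContinuousAt.continuousWithinAt ?_
  obtain ⟨A, hA, h⟩ := hb (2 * p₀.1) (by positivity)
  have hcs : ∀ s > 0, Continuous (g s) := fun s hs =>
    continuousOn_univ.1 (hc.comp (f := fun z : ℝ => (s, z)) (by fun_prop) fun z _ => ⟨hs, trivial⟩)
  have hnhds : ∀ᶠ p : ℝ × ℝ × ℝ in 𝓝 p₀, p.1 ∈ Ioo (p₀.1 / 2) (2 * p₀.1) ∧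
      √(2 * p.2.1) < √(2 * p₀.2.1) + 1 ∧ |p.2.2| < |p₀.2.2| + 1 := by
    refine (continuousAt_fst.eventually_mem
      (Ioo_mem_nhds (by linarith) (by linarith))).and (Eventually.and ?_ ?_)
    · refine ContinuousAt.eventually_lt (by fun_prop) continuousAt_const (by simp)
    · refine ContinuousAt.eventually_lt (by fun_prop) continuousAt_const (by simp)
  refine continuousAt_of_dominated (bound := fun ξ => A / √(p₀.1 / 2) *
    Real.exp ((|p₀.2.2| + 1) / 2) * Real.exp (((√(2 * p₀.2.1) + 1) / 2 + 1) * |ξ|)) ?_ ?_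
    ((integrable_exp_mul_abs_gaussian _).const_mul _) ?_
  · filter_upwards [hnhds] with p hp
    have := hcs p.1 (by linarith [hp.1.1])
    exact ((this.measurable.comp (by fun_prop)).mul hwm).aestronglyMeasurable
  · filter_upwards [hnhds] with p hp
    refine Eventually.of_forall ?_
    have hp1 : 0 < p.1 := by linarith [hp.1.1]
    refine norm_weighted_le (fun z => (h p.1 ⟨hp1, hp.1.2.le⟩ z).trans ?_) (by positivity) hw
      hp.2.2.le (by rw [abs_of_nonneg (Real.sqrt_nonneg _)]; exact hp.2.1.le)
    have h1 := Real.sqrt_pos.2 (half_pos hp₀)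
    have h2 : √(p₀.1 / 2) ≤ √p.1 := Real.sqrt_le_sqrt hp.1.1.le
    gcongr
  · refine Eventually.of_forall fun ξ => ContinuousAt.mul ?_ continuousAt_const
    have h1 := hc.continuousAt (x := (p₀.1, p₀.2.2 + √(2 * p₀.2.1) * ξ))
      ((isOpen_Ioi.prod isOpen_univ).mem_nhds ⟨hp₀, trivial⟩)
    exact ContinuousAt.comp
      (f := fun p : ℝ × ℝ × ℝ => (p.1, p.2.2 + √(2 * p.2.1) * ξ)) (x := p₀) h1 (by fun_prop)

/-- A source field: continuous for positive times, of growth `e^{|z|/2}` in space and `s^{-1/2}` as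
`s → 0`. -/
structure IsSourceField (g : ℝ → ℝ → ℝ) : Prop where
  cont : ContinuousOn (fun p : ℝ × ℝ => g p.1 p.2) (Ioi 0 ×ˢ univ)
  bound : ∀ τ₁ > 0, ∃ A ≥ 0, ∀ s ∈ Ioc 0 τ₁, ∀ z, |g s z| ≤ A / √s * Real.exp (|z| / 2)

namespace IsSourceField

variable {g : ℝ → ℝ → ℝ}

lemma continuous_slice (hg : IsSourceField g) {s : ℝ} (hs : 0 < s) : Continuous (g s) :=
  continuousOn_univ.1 (hg.cont.comp (f := fun z : ℝ => (s, z)) (by fun_prop)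
    fun _ _ => ⟨hs, trivial⟩)

lemma bound_slice (hg : IsSourceField g) {s : ℝ} (hs : 0 < s) :
    ∃ B ≥ 0, ∀ z, |g s z| ≤ B * Real.exp (|z| / 2) := by
  obtain ⟨A, hA, h⟩ := hg.bound s hs
  exact ⟨A / √s, by positivity, h s ⟨hs, le_rfl⟩⟩

lemma continuousWithinAt_heatAvg (hg : IsSourceField g) {S : Set (ℝ × ℝ × ℝ)} {p : ℝ × ℝ × ℝ}
    (hp : 0 < p.1) :
    ContinuousWithinAt (fun p : ℝ × ℝ × ℝ => heatAvg (g p.1) p.2.1 p.2.2) S p := by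
  simpa [heatAvg] using continuousWithinAt_weighted hg.cont hg.bound (w := fun _ => 1)
    measurable_const abs_one_le_exp_abs hp

lemma isSingularKernel_heatAvg (hg : IsSourceField g) :
    IsSingularKernel fun s r y => heatAvg (g s) r y where
  cont := fun _ hp => hg.continuousWithinAt_heatAvg hp.1
  bound := fun τ₁ hτ₁ => by
    obtain ⟨A, hA, h⟩ := hg.bound τ₁ hτ₁
    have hJ := gaussConst_nonneg τ₁
    refine ⟨A * gaussConst τ₁ * √τ₁, by positivity, fun s hs r hr y => ?_⟩
    refine (abs_heatAvg_le (h s hs) hr.2 y).trans ?_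
    have h1 := Real.sqrt_pos.2 hs.1
    have h2 := Real.sqrt_pos.2 hr.1
    have h3 : √r ≤ √τ₁ := Real.sqrt_le_sqrt hr.2
    refine mul_le_mul_of_nonneg_right ?_ (by positivity)
    rw [div_mul_eq_mul_div, div_le_div_iff₀ h1 (by positivity)]
    have : 0 ≤ A * gaussConst τ₁ * √s := by positivity
    nlinarith

lemma isSingularKernel_heatAvgDeriv (hg : IsSourceField g) :
    IsSingularKernel fun s r y => heatAvgDeriv (g s) r y where
  cont := fun p hp => by
    refine (continuousWithinAt_weighted hg.cont hg.bound (w := fun ξ => ξ)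
      measurable_id abs_le_exp_abs hp.1).div (by fun_prop) ?_
    exact (Real.sqrt_pos.2 (mul_pos two_pos hp.2)).ne'
  bound := fun τ₁ hτ₁ => by
    obtain ⟨A, hA, h⟩ := hg.bound τ₁ hτ₁
    have hJ := gaussConst_nonneg τ₁
    refine ⟨A * gaussConst τ₁, by positivity, fun s hs r hr y => ?_⟩
    refine (abs_heatAvgDeriv_le (h s hs) hr.1 hr.2 y).trans (le_of_eq ?_)
    have h1 := Real.sqrt_pos.2 hs.1
    have h2 := Real.sqrt_pos.2 hr.1
    field_simp

end IsSourceField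

/-! ### Differentiation of Gaussian averages -/

section Derivatives

variable {h h' : ℝ → ℝ} {B : ℝ}

lemma hasDerivAt_heatAvg (hd : ∀ z, HasDerivAt h (h' z) z) (hc' : Continuous h')
    (hb : ∀ z, |h z| ≤ B * Real.exp (|z| / 2)) (hb' : ∀ z, |h' z| ≤ B * Real.exp (|z| / 2))
    (r y : ℝ) : HasDerivAt (heatAvg h r) (heatAvg h' r y) y := by
  have hB : 0 ≤ B := by simpa using (abs_nonneg _).trans (hb 0)
  have hc : Continuous h := continuous_iff_continuousAt.2 fun z => (hd z).continuousAt
  refine (hasDerivAt_integral_of_dominated_loc_of_deriv_le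
    (F := fun y ξ => h (y + √(2 * r) * ξ)) (F' := fun y ξ => h' (y + √(2 * r) * ξ))
    (bound := fun ξ => B * Real.exp ((|y| + 1) / 2) * Real.exp ((|√(2 * r)| / 2 + 1) * |ξ|))
    (Metric.ball_mem_nhds y one_pos) (Eventually.of_forall fun z => ?_)
    (integrable_heatAvg hc.measurable hb y _) ?_ (Eventually.of_forall fun ξ z hz => ?_)
    ((integrable_exp_mul_abs_gaussian _).const_mul _) (Eventually.of_forall fun ξ z hz => ?_)).2
  · exact (hc.measurable.comp (by fun_prop)).aestronglyMeasurable
  · exact (hc'.measurable.comp (by fun_prop)).aestronglyMeasurable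
  · have hz' : |z| ≤ |y| + 1 := by
      rw [Metric.mem_ball, Real.dist_eq] at hz
      have := abs_sub_abs_le_abs_sub z y
      linarith
    have := norm_weighted_le hb' hB (w := fun _ => 1) abs_one_le_exp_abs hz'
      (le_refl |√(2 * r)|) ξ
    simpa only [mul_one] using this
  · exact (hd _).comp_add_const z _

lemma hasDerivAt_heatAvg_time (hd : ∀ z, HasDerivAt h (h' z) z) (hc' : Continuous h')
    (hb : ∀ z, |h z| ≤ B * Real.exp (|z| / 2)) (hb' : ∀ z, |h' z| ≤ B * Real.exp (|z| / 2))
    {r : ℝ} (hr : 0 < r) (y : ℝ) :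
    HasDerivAt (fun r => heatAvg h r y) (heatAvgDeriv h' r y) r := by
  have hB : 0 ≤ B := by simpa using (abs_nonneg _).trans (hb 0)
  have hc : Continuous h := continuous_iff_continuousAt.2 fun z => (hd z).continuousAt
  have hdiv : heatAvgDeriv h' r y
      = ∫ ξ, h' (y + √(2 * r) * ξ) * ξ / √(2 * r) ∂gaussianReal 0 1 := by
    rw [heatAvgDeriv, integral_div]
  rw [hdiv]
  refine (hasDerivAt_integral_of_dominated_loc_of_deriv_le
    (F := fun r ξ => h (y + √(2 * r) * ξ)) (F' := fun r ξ => h' (y + √(2 * r) * ξ) * ξ / √(2 * r))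
    (bound := fun ξ => B * Real.exp (|y| / 2) * Real.exp ((√(2 * (2 * r)) / 2 + 1) * |ξ|) / √r)
    (Ioo_mem_nhds (half_lt_self hr) (show r < 2 * r by linarith))
    (Eventually.of_forall fun z => ?_)
    (integrable_heatAvg hc.measurable hb y _) ?_ (Eventually.of_forall fun ξ z hz => ?_)
    (((integrable_exp_mul_abs_gaussian _).const_mul _).div_const _)
    (Eventually.of_forall fun ξ z hz => ?_)).2
  · exact (hc.measurable.comp (by fun_prop)).aestronglyMeasurable
  · exact (((hc'.measurable.comp (by fun_prop)).mul measurable_id).div_const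
      _).aestronglyMeasurable
  · have h1 := norm_weighted_le hb' hB (w := fun ξ => ξ) abs_le_exp_abs (y := y) le_rfl
      (abs_sqrt_le_sqrt hz.2.le) ξ
    have h2 := Real.sqrt_pos.2 hr
    rw [norm_div, Real.norm_of_nonneg (Real.sqrt_nonneg _)]
    exact div_le_div₀ (by positivity) h1 h2 (Real.sqrt_le_sqrt (by linarith [hz.1]))
  · have hz0 : 0 < z := by linarith [hz.1]
    have h1 : HasDerivAt (fun z : ℝ => √(2 * z)) (2 / (2 * √(2 * z))) z := by
      simpa using ((hasDerivAt_id z).const_mul 2).sqrt (by simpa using hz0.ne')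
    have h2 := (hd (y + √(2 * z) * ξ)).comp z ((h1.mul_const ξ).const_add y)
    refine h2.congr_deriv ?_
    have := Real.sqrt_pos.2 (show 0 < 2 * z by linarith)
    field_simp

lemma heatG_eq_gaussianPDFReal {τ s : ℝ} (hs : s < τ) (y z : ℝ) :
    heatG τ y s z = gaussianPDFReal y (2 * (τ - s)).toNNReal z := by
  have h : 0 < τ - s := sub_pos.2 hs
  rw [heatG, gaussianPDFReal, Real.coe_toNNReal _ (by positivity),
    show 2 * Real.pi * (2 * (τ - s)) = 2 ^ 2 * (Real.pi * (τ - s)) by ring,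
    Real.sqrt_mul (show (0 : ℝ) ≤ 2 ^ 2 by norm_num), Real.sqrt_sq two_pos.le, one_div]
  congr 2
  rw [show 2 * (2 * (τ - s)) = 4 * (τ - s) by ring]
  congr 2
  ring

lemma map_gaussianReal_affine (y : ℝ) {r : ℝ} (hr : 0 ≤ r) :
    (gaussianReal 0 1).map (fun ξ => y + √(2 * r) * ξ) = gaussianReal y (2 * r).toNNReal := by
  have h1 : (fun ξ => y + √(2 * r) * ξ) = (fun x => y + x) ∘ fun ξ => √(2 * r) * ξ := rfl
  rw [h1, ← Measure.map_map (by fun_prop) (by fun_prop), gaussianReal_map_const_mul,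
    gaussianReal_map_const_add]
  congr 1
  · simp
  · ext
    rw [mul_one, Real.coe_toNNReal _ (by positivity), NNReal.coe_mk, Real.sq_sqrt (by positivity)]

lemma measurableEmbedding_affine (y : ℝ) {r : ℝ} (hr : 0 < r) :
    MeasurableEmbedding fun ξ : ℝ => y + √(2 * r) * ξ := by
  have h0 : √(2 * r) ≠ 0 := (Real.sqrt_pos.2 (by positivity)).ne'
  exact (measurableEmbedding_addLeft y).comp (measurableEmbedding_mulLeft₀ h0)

lemma heatAvg_eq_integral_gaussianReal (F : ℝ → ℝ) {r : ℝ} (hr : 0 < r) (y : ℝ) :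
    heatAvg F r y = ∫ z, F z ∂gaussianReal y (2 * r).toNNReal := by
  rw [← map_gaussianReal_affine y hr.le, (measurableEmbedding_affine y hr).integral_map]
  rfl

lemma toNNReal_ne_zero {r : ℝ} (hr : 0 < r) : (2 * r).toNNReal ≠ 0 := by
  simpa using hr

lemma integral_heatG_mul {τ s : ℝ} (hs : s < τ) (F : ℝ → ℝ) (y : ℝ) :
    ∫ z, heatG τ y s z * F z = heatAvg F (τ - s) y := by
  have h : 0 < τ - s := sub_pos.2 hs
  rw [heatAvg_eq_integral_gaussianReal F h,
    integral_gaussianReal_eq_integral_smul (toNNReal_ne_zero h)]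
  simp only [heatG_eq_gaussianPDFReal hs, smul_eq_mul]

lemma integrable_heatG_mul {τ s : ℝ} (hs : s < τ) (F : ℝ → ℝ) (y : ℝ) :
    Integrable (fun z => heatG τ y s z * F z)
      ↔ Integrable (fun ξ => F (y + √(2 * (τ - s)) * ξ)) (gaussianReal 0 1) := by
  have h : 0 < τ - s := sub_pos.2 hs
  have h1 := (measurableEmbedding_affine y h).integrable_map_iff (μ := gaussianReal 0 1) (g := F)
  rw [map_gaussianReal_affine y h.le] at h1
  rw [show (fun ξ => F (y + √(2 * (τ - s)) * ξ)) = F ∘ fun ξ => y + √(2 * (τ - s)) * ξ from rfl,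
    ← h1, gaussianReal_of_var_ne_zero _ (toNNReal_ne_zero h),
    integrable_withDensity_iff_integrable_smul₀' (measurable_gaussianPDF _ _).aemeasurable
      (Eventually.of_forall fun _ => ENNReal.ofReal_lt_top)]
  simp only [heatG_eq_gaussianPDFReal hs, toReal_gaussianPDF, smul_eq_mul]

/-- Translating the argument of a Gaussian average amounts to an exponential density. -/
lemma heatAvg_translate (h : ℝ → ℝ) {r : ℝ} (hr : 0 < r) (y x : ℝ) :
    heatAvg h r x = ∫ ξ, Real.exp ((2 * (x - y) * (√(2 * r) * ξ) - (x - y) ^ 2) / (4 * r))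
      * h (y + √(2 * r) * ξ) ∂gaussianReal 0 1 := by
  have h1 := integral_heatG_mul (τ := r) (s := 0) hr h x
  have h2 := integral_heatG_mul (τ := r) (s := 0) hr
    (fun z => Real.exp ((2 * (x - y) * (z - y) - (x - y) ^ 2) / (4 * r)) * h z) y
  rw [sub_zero] at h1 h2
  rw [← h1]
  rw [heatAvg] at h2
  simp only [add_sub_cancel_left] at h2
  rw [← h2]
  congr 1
  ext z
  have hexp : Real.exp (-(x - z) ^ 2 / (4 * (r - 0))) = Real.exp (-(y - z) ^ 2 / (4 * (r - 0)))
      * Real.exp ((2 * (x - y) * (z - y) - (x - y) ^ 2) / (4 * r)) := by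
    rw [← Real.exp_add, sub_zero, ← add_div]
    congr 2
    ring
  rw [heatG, heatG, hexp]
  ring

/-- Smoothing: for `r > 0` the Gaussian average of a merely continuous `h` is differentiable. -/
lemma hasDerivAt_heatAvg_of_continuous (hc : Continuous h)
    (hb : ∀ z, |h z| ≤ B * Real.exp (|z| / 2)) {r : ℝ} (hr : 0 < r) (y : ℝ) :
    HasDerivAt (heatAvg h r) (heatAvgDeriv h r y) y := by
  have hB : 0 ≤ B := by simpa using (abs_nonneg _).trans (hb 0)
  rw [show heatAvg h r = _ from funext (heatAvg_translate h hr y)]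
  set a := √(2 * r) with ha
  have ha0 : 0 < a := Real.sqrt_pos.2 (by positivity)
  have ha2 : a ^ 2 = 2 * r := Real.sq_sqrt (by positivity)
  have hmain := (hasDerivAt_integral_of_dominated_loc_of_deriv_le (μ := gaussianReal 0 1)
    (F := fun x ξ => Real.exp ((2 * (x - y) * (a * ξ) - (x - y) ^ 2) / (4 * r)) * h (y + a * ξ))
    (F' := fun x ξ => Real.exp ((2 * (x - y) * (a * ξ) - (x - y) ^ 2) / (4 * r))
      * ((2 * (a * ξ) - 2 * (x - y)) / (4 * r)) * h (y + a * ξ))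
    (bound := fun ξ => (2 * a + 2) / (4 * r) * B * Real.exp (|y| / 2)
      * Real.exp ((2 * a / (4 * r) + (a / 2 + 1)) * |ξ|))
    (Metric.ball_mem_nhds y one_pos) (Eventually.of_forall fun z => ?_) ?_ ?_
    (Eventually.of_forall fun ξ x hx => ?_)
    ((integrable_exp_mul_abs_gaussian _).const_mul _) (Eventually.of_forall fun ξ x hx => ?_)).2
  · refine hmain.congr_deriv ?_
    rw [heatAvgDeriv, ← ha, ← integral_div]
    congr 1
    ext ξ
    rw [sub_self]
    simp only [mul_zero, zero_mul, sub_zero, ne_eq, OfNat.ofNat_ne_zero, not_false_eq_true,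
      zero_pow, zero_div, Real.exp_zero, one_mul]
    rw [show 4 * r = 2 * a ^ 2 by rw [ha2]; ring]
    field_simp
  · exact (by fun_prop : Continuous _).aestronglyMeasurable
  · simpa using integrable_heatAvg hc.measurable hb y a
  · exact (by fun_prop : Continuous _).aestronglyMeasurable
  · rw [Metric.mem_ball, Real.dist_eq] at hx
    have h1 : |Real.exp ((2 * (x - y) * (a * ξ) - (x - y) ^ 2) / (4 * r))|
        ≤ Real.exp (2 * a / (4 * r) * |ξ|) := by
      rw [Real.abs_exp, Real.exp_le_exp, div_mul_eq_mul_div]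
      gcongr
      have h2 : (x - y) * ξ ≤ |ξ| := by
        refine (le_abs_self _).trans ?_
        rw [abs_mul]
        nlinarith [abs_nonneg ξ]
      nlinarith [sq_nonneg (x - y)]
    have h2 : |(2 * (a * ξ) - 2 * (x - y)) / (4 * r)| ≤ (2 * a + 2) / (4 * r) * Real.exp |ξ| := by
      rw [abs_div, abs_of_pos (show 0 < 4 * r by positivity), div_mul_eq_mul_div]
      gcongr
      have h3 := abs_sub (2 * (a * ξ)) (2 * (x - y))
      rw [abs_mul, abs_mul, abs_mul, abs_two, abs_of_pos ha0] at h3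
      have h4 := abs_le_exp_abs ξ
      have h5 := Real.one_le_exp (abs_nonneg ξ)
      nlinarith
    have h3 := norm_weighted_le hb hB (w := fun ξ => Real.exp |ξ|)
      (fun ξ => (Real.abs_exp _).le) (le_refl |y|) (abs_of_pos ha0).le ξ
    rw [norm_mul, Real.norm_eq_abs, Real.norm_of_nonneg (Real.exp_pos _).le] at h3
    rw [norm_mul, norm_mul, Real.norm_eq_abs, Real.norm_eq_abs, Real.norm_eq_abs]
    calc _ ≤ Real.exp (2 * a / (4 * r) * |ξ|) * ((2 * a + 2) / (4 * r) * Real.exp |ξ|)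
          * |h (y + a * ξ)| := by gcongr
      _ = Real.exp (2 * a / (4 * r) * |ξ|) * ((2 * a + 2) / (4 * r))
          * (|h (y + a * ξ)| * Real.exp |ξ|) := by ring
      _ ≤ Real.exp (2 * a / (4 * r) * |ξ|) * ((2 * a + 2) / (4 * r))
          * (B * Real.exp (|y| / 2) * Real.exp ((a / 2 + 1) * |ξ|)) := by gcongr
      _ = (2 * a + 2) / (4 * r) * B * Real.exp (|y| / 2)
          * (Real.exp (2 * a / (4 * r) * |ξ|) * Real.exp ((a / 2 + 1) * |ξ|)) := by ring
      _ = _ := by rw [← Real.exp_add, ← add_mul]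
  · refine (HasDerivAt.exp ?_).mul_const _
    refine HasDerivAt.div_const ?_ _
    have h1 : HasDerivAt (fun x : ℝ => x - y) 1 x := (hasDerivAt_id x).sub_const y
    refine (((h1.const_mul 2).mul_const (a * ξ)).sub (h1.pow 2)).congr_deriv ?_
    norm_num

end Derivatives

/-! ### The semigroup property -/

lemma heatAvg_eq_integral_gaussianReal' (F : ℝ → ℝ) {r : ℝ} (hr : 0 < r) (y : ℝ) :
    heatAvg F r y = ∫ z, F (y + z) ∂gaussianReal 0 (2 * r).toNNReal := by
  rw [← map_gaussianReal_affine 0 hr.le, (measurableEmbedding_affine 0 hr).integral_map]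
  simp [heatAvg]

lemma heatAvg_heatAvg {h : ℝ → ℝ} {B : ℝ} (hm : Measurable h)
    (hb : ∀ z, |h z| ≤ B * Real.exp (|z| / 2)) {r s : ℝ} (hr : 0 < r) (hs : 0 < s) (y : ℝ) :
    heatAvg (heatAvg h s) r y = heatAvg h (r + s) y := by
  have hrs : 0 < r + s := add_pos hr hs
  have hv : (2 * (r + s)).toNNReal = (2 * r).toNNReal + (2 * s).toNNReal := by
    rw [← Real.toNNReal_add (by positivity) (by positivity)]
    ring_nf
  have hint : Integrable (fun z => h (y + z)) (gaussianReal 0 (2 * (r + s)).toNNReal) := by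
    rw [← map_gaussianReal_affine 0 hrs.le, (measurableEmbedding_affine 0 hrs).integrable_map_iff]
    simpa [Function.comp_def] using integrable_heatAvg hm hb y (√(2 * (r + s)))
  rw [heatAvg_eq_integral_gaussianReal' h hrs]
  have hc := gaussianReal_conv_gaussianReal (m₁ := 0) (m₂ := 0) (v₁ := (2 * r).toNNReal)
    (v₂ := (2 * s).toNNReal)
  rw [add_zero, ← hv] at hc
  rw [← hc] at hint ⊢
  rw [integral_conv hint, heatAvg_eq_integral_gaussianReal' _ hr]
  congr 1
  ext z
  rw [heatAvg_eq_integral_gaussianReal' h hs]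
  simp only [add_assoc]

/-! ### Duhamel potentials -/

/-- `w` has the time derivative `wt` and the space derivatives `wy`, `wyy` for positive times, all
of them jointly continuous. -/
structure HasParabolicJet (w wt wy wyy : ℝ → ℝ → ℝ) : Prop where
  dt : ∀ τ > 0, ∀ y, HasDerivAt (fun s => w s y) (wt τ y) τ
  dy : ∀ τ > 0, ∀ y, HasDerivAt (w τ) (wy τ y) y
  dyy : ∀ τ > 0, ∀ y, HasDerivAt (wy τ) (wyy τ y) y
  cont : ContinuousOn (fun p : ℝ × ℝ => w p.1 p.2) (Ioi 0 ×ˢ univ)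
  cont_t : ContinuousOn (fun p : ℝ × ℝ => wt p.1 p.2) (Ioi 0 ×ˢ univ)
  cont_y : ContinuousOn (fun p : ℝ × ℝ => wy p.1 p.2) (Ioi 0 ×ˢ univ)
  cont_yy : ContinuousOn (fun p : ℝ × ℝ => wyy p.1 p.2) (Ioi 0 ×ˢ univ)

lemma HasParabolicJet.add {w wt wy wyy v vt vy vyy : ℝ → ℝ → ℝ} (hw : HasParabolicJet w wt wy wyy)
    (hv : HasParabolicJet v vt vy vyy) :
    HasParabolicJet (fun τ y => w τ y + v τ y) (fun τ y => wt τ y + vt τ y)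
      (fun τ y => wy τ y + vy τ y) (fun τ y => wyy τ y + vyy τ y) where
  dt := fun τ hτ y => (hw.dt τ hτ y).add (hv.dt τ hτ y)
  dy := fun τ hτ y => (hw.dy τ hτ y).add (hv.dy τ hτ y)
  dyy := fun τ hτ y => (hw.dyy τ hτ y).add (hv.dyy τ hτ y)
  cont := hw.cont.add hv.cont
  cont_t := hw.cont_t.add hv.cont_t
  cont_y := hw.cont_y.add hv.cont_y
  cont_yy := hw.cont_yy.add hv.cont_yy

lemma HasParabolicJet.const_mul {w wt wy wyy : ℝ → ℝ → ℝ} (hw : HasParabolicJet w wt wy wyy)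
    (c : ℝ) :
    HasParabolicJet (fun τ y => c * w τ y) (fun τ y => c * wt τ y)
      (fun τ y => c * wy τ y) (fun τ y => c * wyy τ y) where
  dt := fun τ hτ y => (hw.dt τ hτ y).const_mul c
  dy := fun τ hτ y => (hw.dy τ hτ y).const_mul c
  dyy := fun τ hτ y => (hw.dyy τ hτ y).const_mul c
  cont := continuousOn_const.mul hw.cont
  cont_t := continuousOn_const.mul hw.cont_t
  cont_y := continuousOn_const.mul hw.cont_y
  cont_yy := continuousOn_const.mul hw.cont_yy

/-- The solution of `∂V/∂τ = ∂²V/∂y² + g` with zero initial value, as an integral against the heat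
kernel. -/
noncomputable def duhamel (g : ℝ → ℝ → ℝ) (τ y : ℝ) : ℝ :=
  ∫ s in (0 : ℝ)..τ, ∫ z, heatG τ y s z * g s z

/-- The time convolution of the heat semigroup with `g`. -/
noncomputable def avgConv (g : ℝ → ℝ → ℝ) : ℝ → ℝ → ℝ := timeConv fun s r y => heatAvg (g s) r y

/-- The spatial derivative of `avgConv g`. -/
noncomputable def avgDerivConv (g : ℝ → ℝ → ℝ) : ℝ → ℝ → ℝ :=
  timeConv fun s r y => heatAvgDeriv (g s) r y

lemma duhamel_eq (g : ℝ → ℝ → ℝ) {τ : ℝ} (hτ : 0 < τ) (y : ℝ) : duhamel g τ y = avgConv g τ y := by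
  refine intervalIntegral.integral_congr_ae ?_
  filter_upwards [ae_mem_Ioo_of_mem_uIoc hτ] with s hs hmem
  exact integral_heatG_mul (hs hmem).2 _ _

lemma heatAvg_abs_le {h H : ℝ → ℝ} {r y : ℝ} (hle : ∀ z, |h z| ≤ H z)
    (hH : Integrable (fun ξ => H (y + √(2 * r) * ξ)) (gaussianReal 0 1)) :
    |heatAvg h r y| ≤ heatAvg H r y :=
  norm_integral_le_of_norm_le (f := fun ξ => h (y + √(2 * r) * ξ)) hH
    (Eventually.of_forall fun _ => hle _)

lemma abs_timeConv_le_of_le {e : ℝ → ℝ → ℝ → ℝ} {τ y C : ℝ} (hτ : 0 < τ)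
    (h : ∀ s ∈ Ioo 0 τ, |e s (τ - s) y| ≤ C) : |timeConv e τ y| ≤ C * τ := by
  have := intervalIntegral.norm_integral_le_of_norm_le_const_ae (a := 0) (b := τ)
    (f := fun s => e s (τ - s) y) (C := C) (by
      filter_upwards [ae_mem_Ioo_of_mem_uIoc hτ] with s hs hmem
      exact h s (hs hmem))
  rwa [sub_zero, abs_of_pos hτ] at this

lemma IsSourceField.integrableOn_heatG_mul {g : ℝ → ℝ → ℝ} (hg : IsSourceField g) {τ : ℝ}
    (hτ : 0 < τ) (y : ℝ) :
    IntegrableOn (fun p : ℝ × ℝ => heatG τ y p.1 p.2 * g p.1 p.2) (Ioo 0 τ ×ˢ univ) := by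
  obtain ⟨A, hA, hb⟩ := hg.bound τ hτ
  have hcont : ContinuousOn (fun p : ℝ × ℝ => heatG τ y p.1 p.2 * g p.1 p.2)
      (Ioo 0 τ ×ˢ univ) := by
    refine ContinuousOn.mul ?_ (hg.cont.mono (prod_mono Ioo_subset_Ioi_self le_rfl))
    unfold heatG
    have hpos : ∀ p ∈ Ioo 0 τ ×ˢ (univ : Set ℝ), 0 < τ - p.1 := fun p hp => sub_pos.2 hp.1.2
    refine ContinuousOn.mul (continuousOn_const.div (by fun_prop) fun p hp => ?_)
      (ContinuousOn.rexp (ContinuousOn.div (by fun_prop) (by fun_prop) fun p hp => ?_))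
    · have := hpos p hp
      positivity
    · have := hpos p hp
      positivity
  have hmeas := hcont.aestronglyMeasurable (μ := volume) (measurableSet_Ioo.prod .univ)
  rw [IntegrableOn]
  rw [Measure.volume_eq_prod, ← Measure.prod_restrict, Measure.restrict_univ] at hmeas ⊢
  rw [integrable_prod_iff hmeas]
  constructor
  · rw [ae_restrict_iff' measurableSet_Ioo]
    refine Eventually.of_forall fun s hs => ?_
    rw [integrable_heatG_mul hs.2]
    obtain ⟨B, -, hB⟩ := hg.bound_slice hs.1
    exact integrable_heatAvg (hg.continuous_slice hs.1).measurable hB _ _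
  · have hdom : IntegrableOn (fun s => A * gaussConst τ * Real.exp (|y| / 2) * (1 / √s))
        (Ioo 0 τ) :=
      (((intervalIntegrable_iff_integrableOn_Ioo_of_le hτ.le).1
        (intervalIntegrable_one_div_sqrt 0 τ)).const_mul _)
    refine Integrable.mono' hdom hmeas.norm.integral_prod_right' ?_
    rw [ae_restrict_iff' measurableSet_Ioo]
    refine Eventually.of_forall fun s hs => ?_
    have h1 : ∫ z, ‖heatG τ y s z * g s z‖ = heatAvg (fun z => |g s z|) (τ - s) y := by
      rw [← integral_heatG_mul hs.2]
      congr 1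
      ext z
      rw [norm_mul, Real.norm_eq_abs, Real.norm_eq_abs, abs_of_nonneg]
      unfold heatG
      positivity
    simp only [h1]
    refine (abs_heatAvg_le (B := A / √s) (h := fun z => |g s z|) (τ₁ := τ) (fun z => ?_)
      (by linarith [hs.1]) y).trans (le_of_eq (by ring))
    rw [abs_abs]
    exact hb s ⟨hs.1, hs.2.le⟩ z

/-- A source that is bounded up to time zero with a spatial derivative that may blow up like
`s^{-1/2}`, both of growth `e^{|z|/2}`. -/
structure IsSmoothSource (g gz : ℝ → ℝ → ℝ) : Prop where
  deriv : ∀ s > 0, ∀ z, HasDerivAt (g s) (gz s z) z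
  cont : ContinuousOn (fun p : ℝ × ℝ => g p.1 p.2) (Ioi 0 ×ˢ univ)
  cont_deriv : ContinuousOn (fun p : ℝ × ℝ => gz p.1 p.2) (Ioi 0 ×ˢ univ)
  bound : ∀ τ₁ > 0, ∃ A ≥ 0, ∀ s ∈ Ioc 0 τ₁, ∀ z, |g s z| ≤ A * Real.exp (|z| / 2)
  bound_deriv : ∀ τ₁ > 0, ∃ A ≥ 0, ∀ s ∈ Ioc 0 τ₁, ∀ z,
    |gz s z| ≤ A / √s * Real.exp (|z| / 2)

namespace IsSmoothSource

variable {g gz : ℝ → ℝ → ℝ}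

lemma isSourceField (h : IsSmoothSource g gz) : IsSourceField g where
  cont := h.cont
  bound := fun τ₁ hτ₁ => by
    obtain ⟨A, hA, hb⟩ := h.bound τ₁ hτ₁
    refine ⟨A * √τ₁, by positivity, fun s hs z => (hb s hs z).trans ?_⟩
    have h1 := Real.sqrt_pos.2 hs.1
    have h2 : √s ≤ √τ₁ := Real.sqrt_le_sqrt hs.2
    gcongr
    rw [le_div_iff₀ h1]
    gcongr

lemma isSourceField_deriv (h : IsSmoothSource g gz) : IsSourceField gz :=
  ⟨h.cont_deriv, h.bound_deriv⟩

lemma bound_both (h : IsSmoothSource g gz) {s : ℝ} (hs : 0 < s) :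
    ∃ B, (∀ z, |g s z| ≤ B * Real.exp (|z| / 2)) ∧ ∀ z, |gz s z| ≤ B * Real.exp (|z| / 2) := by
  obtain ⟨B₁, h₁, hB₁⟩ := h.isSourceField.bound_slice hs
  obtain ⟨B₂, h₂, hB₂⟩ := h.isSourceField_deriv.bound_slice hs
  refine ⟨B₁ + B₂, fun z => (hB₁ z).trans ?_, fun z => (hB₂ z).trans ?_⟩ <;> gcongr <;> linarith

/-- The Duhamel potential of a smooth source is a classical solution of the inhomogeneous heat
equation. -/
lemma hasParabolicJet (h : IsSmoothSource g gz) :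
    HasParabolicJet (duhamel g) (fun τ y => g τ y + avgDerivConv gz τ y) (avgConv gz)
      (avgDerivConv gz) where
  dt := fun τ hτ y => by
    have h1 : HasDerivAt (fun τ => avgConv g τ y) (g τ y + avgDerivConv gz τ y) τ := by
      refine h.isSourceField.isSingularKernel_heatAvg.hasDerivAt_timeConv_time
        h.isSourceField_deriv.isSingularKernel_heatAvgDeriv (g := fun s => g s y)
        (fun s hs r hr => ?_) (fun s hs => ?_) ?_ (fun τ₁ hτ₁ => ?_) hτ
      · obtain ⟨B, hB, hB'⟩ := h.bound_both hs
        exact hasDerivAt_heatAvg_time (h.deriv s hs)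
          (h.isSourceField_deriv.continuous_slice hs) hB hB' hr y
      · have hc := h.isSourceField.continuousWithinAt_heatAvg (S := univ) (p := (s, 0, y)) hs
        rw [continuousWithinAt_univ] at hc
        have h2 := (hc.comp (f := fun r : ℝ => (s, r, y)) (x := (0 : ℝ))
          (by fun_prop)).tendsto.mono_left (nhdsWithin_le_nhds (s := Ioi 0))
        have h3 : heatAvg (g s) 0 y = g s y := by simp [heatAvg]
        simpa only [Function.comp_def, h3] using h2
      · exact h.cont.comp (f := fun s : ℝ => (s, y)) (by fun_prop) fun s hs => ⟨hs, trivial⟩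
      · obtain ⟨A, -, hA⟩ := h.bound τ₁ hτ₁
        exact ⟨_, fun s hs => hA s hs y⟩
    exact h1.congr_of_eventuallyEq
      (eventually_of_mem (Ioi_mem_nhds hτ) fun t ht => duhamel_eq g ht y)
  dy := fun τ hτ y => by
    have h1 : HasDerivAt (avgConv g τ) (avgConv gz τ y) y := by
      refine h.isSourceField.isSingularKernel_heatAvg.hasDerivAt_timeConv
        h.isSourceField_deriv.isSingularKernel_heatAvg (fun s hs r hr y => ?_) hτ y
      obtain ⟨B, hB, hB'⟩ := h.bound_both hs
      exact hasDerivAt_heatAvg (h.deriv s hs) (h.isSourceField_deriv.continuous_slice hs) hB hB' r y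
    rwa [show duhamel g τ = avgConv g τ from funext (duhamel_eq g hτ)]
  dyy := fun τ hτ y => by
    refine h.isSourceField_deriv.isSingularKernel_heatAvg.hasDerivAt_timeConv
      h.isSourceField_deriv.isSingularKernel_heatAvgDeriv (fun s hs r hr y => ?_) hτ y
    obtain ⟨B, -, hB⟩ := h.isSourceField_deriv.bound_slice hs
    exact hasDerivAt_heatAvg_of_continuous (h.isSourceField_deriv.continuous_slice hs) hB hr y
  cont := h.isSourceField.isSingularKernel_heatAvg.continuousOn_timeConv.congr
    fun p hp => duhamel_eq g hp.1 p.2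
  cont_t := h.cont.add
    h.isSourceField_deriv.isSingularKernel_heatAvgDeriv.continuousOn_timeConv
  cont_y := h.isSourceField_deriv.isSingularKernel_heatAvg.continuousOn_timeConv
  cont_yy := h.isSourceField_deriv.isSingularKernel_heatAvgDeriv.continuousOn_timeConv

lemma abs_duhamel_le (h : IsSmoothSource g gz) {τ₁ : ℝ} (hτ₁ : 0 < τ₁) :
    ∃ C ≥ 0, ∀ τ ∈ Ioc 0 τ₁, ∀ y, |duhamel g τ y| ≤ C * τ * Real.exp (|y| / 2) := by
  obtain ⟨A, hA, hb⟩ := h.bound τ₁ hτ₁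
  have hJ := gaussConst_nonneg τ₁
  refine ⟨A * gaussConst τ₁, by positivity, fun τ hτ y => ?_⟩
  rw [duhamel_eq g hτ.1]
  refine (abs_timeConv_le_of_le hτ.1 (C := A * gaussConst τ₁ * Real.exp (|y| / 2))
    fun s hs => ?_).trans (le_of_eq (by ring))
  exact abs_heatAvg_le (hb s ⟨hs.1, hs.2.le.trans hτ.2⟩) (by linarith [hs.1, hτ.2]) y

end IsSmoothSource

/-! ### The normal distribution function -/

/-- The standard normal distribution function. -/
noncomputable def normCdf (x : ℝ) : ℝ := ∫ t in Iic x, gaussianPDFReal 0 1 t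

lemma gaussianPDFReal_std (x : ℝ) :
    gaussianPDFReal 0 1 x = (√(2 * Real.pi))⁻¹ * Real.exp (-x ^ 2 / 2) := by
  simp [gaussianPDFReal]

lemma continuous_gaussianPDFReal_std : Continuous (gaussianPDFReal 0 1) := by
  rw [show gaussianPDFReal 0 1 = _ from funext gaussianPDFReal_std]
  fun_prop

lemma hasDerivAt_normCdf (x : ℝ) : HasDerivAt normCdf (gaussianPDFReal 0 1 x) x := by
  have hi := integrable_gaussianPDFReal 0 1
  have h : normCdf = fun x => normCdf 0 + ∫ t in (0 : ℝ)..x, gaussianPDFReal 0 1 t := by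
    ext x
    rw [normCdf, normCdf, ← intervalIntegral.integral_Iic_sub_Iic hi.integrableOn hi.integrableOn]
    ring
  rw [h]
  exact (intervalIntegral.integral_hasDerivAt_right hi.intervalIntegrable
    continuous_gaussianPDFReal_std.stronglyMeasurable.stronglyMeasurableAtFilter
    continuous_gaussianPDFReal_std.continuousAt).const_add _

lemma normCdf_nonneg (x : ℝ) : 0 ≤ normCdf x :=
  integral_nonneg fun _ => gaussianPDFReal_nonneg _ _ _

lemma normCdf_le_one (x : ℝ) : normCdf x ≤ 1 := by
  rw [← integral_gaussianPDFReal_eq_one 0 one_ne_zero]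
  exact setIntegral_le_integral (integrable_gaussianPDFReal 0 1)
    (Eventually.of_forall fun _ => gaussianPDFReal_nonneg _ _ _)

lemma continuous_normCdf : Continuous normCdf :=
  continuous_iff_continuousAt.2 fun x => (hasDerivAt_normCdf x).continuousAt

lemma monotone_normCdf : Monotone normCdf :=
  monotone_of_deriv_nonneg (fun x => (hasDerivAt_normCdf x).differentiableAt) fun x => by
    rw [(hasDerivAt_normCdf x).deriv]
    exact gaussianPDFReal_nonneg _ _ _

/-- A Gaussian tail bound, from the mass of an interval of length one; the exponent is twice the
sharp one, which is what `exists_mul_gaussKer_sq_le` allows. -/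
lemma le_normCdf (x : ℝ) :
    (√(2 * Real.pi))⁻¹ * Real.exp (-1) * Real.exp (-(min x 0) ^ 2) ≤ normCdf x := by
  refine le_trans ?_ (monotone_normCdf (min_le_left x 0))
  set m := min x 0
  have hm : m ≤ 0 := min_le_right x 0
  obtain ⟨c, hc, h⟩ := exists_hasDerivAt_eq_slope normCdf (gaussianPDFReal 0 1)
    (show m - 1 < m by linarith) continuous_normCdf.continuousOn fun z _ => hasDerivAt_normCdf z
  rw [sub_sub_cancel, div_one] at h
  have h0 := normCdf_nonneg (m - 1)
  have h1 : gaussianPDFReal 0 1 c ≤ normCdf m := by linarith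
  refine le_trans ?_ h1
  rw [gaussianPDFReal_std, mul_assoc, ← Real.exp_add]
  gcongr
  nlinarith [hc.1, hc.2, sq_nonneg (m + 1)]

lemma normCdf_pos (x : ℝ) : 0 < normCdf x := lt_of_lt_of_le (by positivity) (le_normCdf x)

/-! ### The call payoff under the heat flow -/

/-- `e^{az}` on the positive half-line, zero elsewhere. -/
noncomputable def halfExp (a z : ℝ) : ℝ := (Ioi 0).indicator (fun z => Real.exp (a * z)) z

/-- The heat flow of `halfExp a`. -/
noncomputable def halfHeat (a τ y : ℝ) : ℝ := heatAvg (halfExp a) τ y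

/-- The Gauss kernel of the heat equation. -/
noncomputable def gaussKer (τ y : ℝ) : ℝ := Real.exp (-y ^ 2 / (4 * τ)) / (2 * √(Real.pi * τ))

lemma measurable_halfExp (a : ℝ) : Measurable (halfExp a) :=
  (by fun_prop : Measurable fun z : ℝ => Real.exp (a * z)).indicator measurableSet_Ioi

lemma halfExp_nonneg (a z : ℝ) : 0 ≤ halfExp a z :=
  indicator_nonneg (fun _ _ => (Real.exp_pos _).le) z

lemma abs_halfExp_le {a : ℝ} (ha : a ≤ 1 / 2) (z : ℝ) :
    |halfExp a z| ≤ 1 * Real.exp (|z| / 2) := by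
  rw [abs_of_nonneg (halfExp_nonneg a z), one_mul]
  unfold halfExp
  by_cases hz : z ∈ Ioi (0 : ℝ)
  · rw [indicator_of_mem hz, Real.exp_le_exp]
    have := le_abs_self z
    have hz : 0 < z := hz
    nlinarith
  · rw [indicator_of_notMem hz]
    positivity

lemma halfHeat_eq (a : ℝ) {τ : ℝ} (hτ : 0 < τ) (y : ℝ) :
    halfHeat a τ y
      = Real.exp (a * y + a ^ 2 * τ) * normCdf ((y + 2 * a * τ) / √(2 * τ)) := by
  rw [halfHeat, heatAvg, integral_gaussianReal_eq_integral_smul one_ne_zero]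
  set b := √(2 * τ) with hb
  have hb0 : 0 < b := Real.sqrt_pos.2 (by positivity)
  have hb2 : b ^ 2 = 2 * τ := Real.sq_sqrt (by positivity)
  have h1 : ∀ ξ, gaussianPDFReal 0 1 ξ • halfExp a (y + b * ξ)
      = Real.exp (a * y + a ^ 2 * τ)
        * (Iio ((y + 2 * a * τ) / b)).indicator (gaussianPDFReal 0 1) (a * b - ξ) := by
    intro ξ
    have hiff : y + b * ξ ∈ Ioi (0 : ℝ) ↔ a * b - ξ ∈ Iio ((y + 2 * a * τ) / b) := by
      have he : (a * b - ξ) * b = 2 * a * τ - b * ξ := by linear_combination a * hb2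
      rw [mem_Ioi, mem_Iio, lt_div_iff₀ hb0, he]
      constructor <;> intro h <;> linarith
    unfold halfExp
    by_cases hm : y + b * ξ ∈ Ioi (0 : ℝ)
    · rw [indicator_of_mem hm, indicator_of_mem (hiff.1 hm), gaussianPDFReal_std,
        gaussianPDFReal_std, smul_eq_mul, mul_assoc, mul_left_comm (Real.exp _), ← Real.exp_add,
        ← Real.exp_add]
      congr 2
      have : a ^ 2 * τ = a ^ 2 * b ^ 2 / 2 := by rw [hb2]; ring
      rw [this]
      ring
    · rw [indicator_of_notMem hm, indicator_of_notMem (fun h => hm (hiff.2 h))]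
      simp
  simp only [h1]
  rw [integral_const_mul, integral_sub_left_eq_self
    (fun t => (Iio ((y + 2 * a * τ) / b)).indicator (gaussianPDFReal 0 1) t) volume (a * b),
    integral_indicator measurableSet_Iio, ← integral_Iic_eq_integral_Iio, normCdf]

lemma gaussKer_pos {τ : ℝ} (hτ : 0 < τ) (y : ℝ) : 0 < gaussKer τ y := by
  unfold gaussKer
  positivity

lemma halfHeat_pos (a : ℝ) {τ : ℝ} (hτ : 0 < τ) (y : ℝ) : 0 < halfHeat a τ y := by
  rw [halfHeat_eq a hτ]
  exact mul_pos (Real.exp_pos _) (normCdf_pos _)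

/-- Completing the square. -/
lemma exp_mul_gaussianPDFReal (a : ℝ) {τ : ℝ} (hτ : 0 < τ) (y : ℝ) :
    Real.exp (a * y + a ^ 2 * τ) * gaussianPDFReal 0 1 ((y + 2 * a * τ) / √(2 * τ))
      = √(2 * τ) * gaussKer τ y := by
  have h1 := Real.sqrt_pos.2 Real.pi_pos
  have h2 := Real.sqrt_pos.2 hτ
  have h3 : √2 * √2 = 2 := Real.mul_self_sqrt zero_le_two
  rw [gaussianPDFReal_std, gaussKer, mul_left_comm, ← Real.exp_add, div_pow,
    Real.sq_sqrt (by positivity)]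
  have h4 : a * y + a ^ 2 * τ + -((y + 2 * a * τ) ^ 2 / (2 * τ)) / 2 = -y ^ 2 / (4 * τ) := by
    field_simp
    ring
  rw [neg_div] at h4 ⊢
  rw [h4, Real.sqrt_mul zero_le_two, Real.sqrt_mul zero_le_two, Real.sqrt_mul Real.pi_pos.le]
  field_simp
  nlinarith

lemma hasDerivAt_gaussKer {τ : ℝ} (y : ℝ) :
    HasDerivAt (gaussKer τ) (-(y / (2 * τ)) * gaussKer τ y) y := by
  unfold gaussKer
  have h1 : HasDerivAt (fun y : ℝ => -y ^ 2 / (4 * τ)) (-(y / (2 * τ))) y := by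
    refine (((hasDerivAt_id y).pow 2).neg.div_const (4 * τ)).congr_deriv ?_
    simp only [id]
    rcases eq_or_ne τ 0 with rfl | h0
    · simp
    · field_simp
      norm_num
      ring
  refine (h1.exp.div_const (2 * √(Real.pi * τ))).congr_deriv ?_
  ring

lemma continuousOn_gaussKer :
    ContinuousOn (fun p : ℝ × ℝ => gaussKer p.1 p.2) (Ioi 0 ×ˢ univ) := by
  unfold gaussKer
  have hpos : ∀ p ∈ Ioi (0 : ℝ) ×ˢ (univ : Set ℝ), 0 < p.1 := fun p hp => hp.1
  refine ContinuousOn.div (ContinuousOn.rexp (ContinuousOn.div (by fun_prop) (by fun_prop) ?_))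
    (by fun_prop) ?_ <;> intro p hp <;> have := hpos p hp <;> positivity

lemma hasParabolicJet_halfHeat (a : ℝ) :
    HasParabolicJet (halfHeat a)
      (fun τ y => a ^ 2 * halfHeat a τ y + (a - y / (2 * τ)) * gaussKer τ y)
      (fun τ y => a * halfHeat a τ y + gaussKer τ y)
      (fun τ y => a ^ 2 * halfHeat a τ y + (a - y / (2 * τ)) * gaussKer τ y) := by
  have hcont : ContinuousOn (fun p : ℝ × ℝ => halfHeat a p.1 p.2) (Ioi 0 ×ˢ univ) := by
    have : ContinuousOn (fun p : ℝ × ℝ => Real.exp (a * p.2 + a ^ 2 * p.1)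
        * normCdf ((p.2 + 2 * a * p.1) / √(2 * p.1))) (Ioi 0 ×ˢ univ) := by
      refine ContinuousOn.mul (by fun_prop) (continuous_normCdf.comp_continuousOn ?_)
      refine ContinuousOn.div (by fun_prop) (by fun_prop) fun p hp => ?_
      have : 0 < p.1 := hp.1
      positivity
    exact this.congr fun p hp => halfHeat_eq a hp.1 p.2
  have hdy : ∀ τ > 0, ∀ y, HasDerivAt (halfHeat a τ) (a * halfHeat a τ y + gaussKer τ y) y := by
    intro τ hτ y
    have hs : 0 < √(2 * τ) := Real.sqrt_pos.2 (by positivity)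
    rw [show halfHeat a τ = _ from funext (halfHeat_eq a hτ)]
    have h1 : HasDerivAt (fun y : ℝ => a * y + a ^ 2 * τ) a y := by
      simpa using ((hasDerivAt_id y).const_mul a).add_const (a ^ 2 * τ)
    have h2 : HasDerivAt (fun y : ℝ => (y + 2 * a * τ) / √(2 * τ)) (1 / √(2 * τ)) y :=
      ((hasDerivAt_id y).add_const (2 * a * τ)).div_const _
    refine (h1.exp.mul ((hasDerivAt_normCdf _).comp y h2)).congr_deriv ?_
    have h3 := exp_mul_gaussianPDFReal a hτ y
    rw [← mul_assoc, h3]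
    simp only [Function.comp_def]
    field_simp
  have hK := continuousOn_gaussKer
  have hyy : ContinuousOn (fun p : ℝ × ℝ =>
      a ^ 2 * halfHeat a p.1 p.2 + (a - p.2 / (2 * p.1)) * gaussKer p.1 p.2) (Ioi 0 ×ˢ univ) := by
    refine (continuousOn_const.mul hcont).add (ContinuousOn.mul ?_ hK)
    refine continuousOn_const.sub (ContinuousOn.div (by fun_prop) (by fun_prop) fun p hp => ?_)
    have : 0 < p.1 := hp.1
    positivity
  refine ⟨fun τ hτ y => ?_, hdy, fun τ hτ y => ?_, hcont, hyy,
    (continuousOn_const.mul hcont).add hK, hyy⟩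
  · have hs : 0 < √(2 * τ) := Real.sqrt_pos.2 (by positivity)
    have hsq : √(2 * τ) ^ 2 = 2 * τ := Real.sq_sqrt (by positivity)
    have h0 : HasDerivAt (fun τ => Real.exp (a * y + a ^ 2 * τ)
        * normCdf ((y + 2 * a * τ) / √(2 * τ)))
        (a ^ 2 * halfHeat a τ y + (a - y / (2 * τ)) * gaussKer τ y) τ := by
      have h1 : HasDerivAt (fun τ : ℝ => a * y + a ^ 2 * τ) (a ^ 2) τ := by
        simpa using ((hasDerivAt_id τ).const_mul (a ^ 2)).const_add (a * y)
      have h2 : HasDerivAt (fun τ : ℝ => y + 2 * a * τ) (2 * a) τ := by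
        simpa using ((hasDerivAt_id τ).const_mul (2 * a)).const_add y
      have h3 : HasDerivAt (fun τ : ℝ => √(2 * τ)) (2 / (2 * √(2 * τ))) τ := by
        simpa using ((hasDerivAt_id τ).const_mul 2).sqrt (by simpa using hτ.ne')
      refine (h1.exp.mul ((hasDerivAt_normCdf _).comp τ (h2.div h3 hs.ne'))).congr_deriv ?_
      simp only [Function.comp_def, Pi.div_apply]
      have h4 := exp_mul_gaussianPDFReal a hτ y
      rw [← mul_assoc, h4, halfHeat_eq a hτ]
      rw [hsq]
      field_simp
      rw [mul_comm τ 2, hsq]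
      ring
    exact h0.congr_of_eventuallyEq
      (eventually_of_mem (Ioi_mem_nhds hτ) fun t ht => halfHeat_eq a ht y)
  · refine (((hdy τ hτ y).const_mul a).add (hasDerivAt_gaussKer y)).congr_deriv ?_
    ring

lemma heatAvg_halfHeat {a : ℝ} (ha : a ≤ 1 / 2) {r s : ℝ} (hr : 0 < r) (hs : 0 < s) (y : ℝ) :
    heatAvg (halfHeat a s) r y = halfHeat a (r + s) y :=
  heatAvg_heatAvg (measurable_halfExp a) (abs_halfExp_le ha) hr hs y

/-- The transformed call payoff. -/
noncomputable def payoff (z : ℝ) : ℝ := max (Real.exp (z / 2) - Real.exp (-(z / 2))) 0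

/-- The heat flow of the transformed call payoff. -/
noncomputable def callHeat (τ y : ℝ) : ℝ := heatAvg payoff τ y

lemma continuous_payoff : Continuous payoff := by
  unfold payoff
  fun_prop

lemma payoff_nonneg (z : ℝ) : 0 ≤ payoff z := le_max_right _ _

lemma payoff_eq (z : ℝ) : payoff z = halfExp (1 / 2) z - halfExp (-(1 / 2)) z := by
  unfold payoff halfExp
  by_cases hz : z ∈ Ioi (0 : ℝ)
  · rw [indicator_of_mem hz, indicator_of_mem hz, max_eq_left, show 1 / 2 * z = z / 2 by ring,
      show -(1 / 2) * z = -(z / 2) by ring]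
    have : 0 < z := hz
    rw [sub_nonneg, Real.exp_le_exp]
    linarith
  · rw [indicator_of_notMem hz, indicator_of_notMem hz, max_eq_right, sub_zero]
    have : z ≤ 0 := not_lt.1 hz
    rw [sub_nonpos, Real.exp_le_exp]
    linarith

lemma abs_payoff_le (z : ℝ) : |payoff z| ≤ 1 * Real.exp (|z| / 2) := by
  rw [abs_of_nonneg (payoff_nonneg z), payoff_eq]
  have h1 := (abs_le.1 (abs_halfExp_le (le_refl (1 / 2)) z)).2
  have h2 := halfExp_nonneg (-(1 / 2)) z
  linarith

lemma callHeat_eq (τ y : ℝ) :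
    callHeat τ y = halfHeat (1 / 2) τ y - halfHeat (-(1 / 2)) τ y := by
  unfold callHeat halfHeat heatAvg
  rw [← integral_sub
    (integrable_heatAvg (measurable_halfExp _) (abs_halfExp_le le_rfl) _ _)
    (integrable_heatAvg (measurable_halfExp _) (abs_halfExp_le (by norm_num)) _ _)]
  simp only [payoff_eq]

lemma callHeat_zero (y : ℝ) : callHeat 0 y = payoff y := by
  simp [callHeat, heatAvg]

lemma continuous_callHeat : Continuous fun p : ℝ × ℝ => callHeat p.1 p.2 := by
  rw [continuous_iff_continuousAt]
  intro p
  have h := continuousWithinAt_weighted (g := fun _ => payoff) (S := univ)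
    (continuous_payoff.comp continuous_snd).continuousOn (fun τ₁ hτ₁ => ?_) (w := fun _ => 1)
    measurable_const abs_one_le_exp_abs (p₀ := (1, p.1, p.2)) one_pos
  · rw [continuousWithinAt_univ] at h
    have h2 := h.comp (f := fun p : ℝ × ℝ => ((1 : ℝ), p.1, p.2)) (x := p) (by fun_prop)
    simpa [Function.comp_def, callHeat, heatAvg] using h2
  · refine ⟨√τ₁, by positivity, fun s hs z => (abs_payoff_le z).trans ?_⟩
    gcongr
    rw [le_div_iff₀ (Real.sqrt_pos.2 hs.1), one_mul]
    exact Real.sqrt_le_sqrt hs.2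

lemma callHeat_pos {τ : ℝ} (hτ : 0 < τ) (y : ℝ) : 0 < callHeat τ y := by
  have hb0 : 0 < √(2 * τ) := Real.sqrt_pos.2 (by positivity)
  rw [callHeat, heatAvg, integral_pos_iff_support_of_nonneg (fun ξ => payoff_nonneg _)
    (integrable_heatAvg continuous_payoff.measurable abs_payoff_le _ _)]
  have hsub : Ioi (-y / √(2 * τ)) ⊆ Function.support fun ξ => payoff (y + √(2 * τ) * ξ) := by
    intro ξ hξ
    rw [mem_Ioi, div_lt_iff₀ hb0] at hξ
    have hz : 0 < y + √(2 * τ) * ξ := by linarith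
    rw [Function.mem_support, payoff, max_eq_left_of_lt]
    · rw [sub_ne_zero]
      exact (Real.exp_lt_exp.2 (by linarith)).ne'
    · rw [sub_pos, Real.exp_lt_exp]
      linarith
  refine lt_of_lt_of_le (pos_iff_ne_zero.2 fun h0 => ?_) (measure_mono hsub)
  have := gaussianReal_absolutelyContinuous' 0 one_ne_zero h0
  simp at this

lemma callHeat_le (τ y : ℝ) : callHeat τ y ≤ halfHeat (1 / 2) τ y := by
  rw [callHeat_eq]
  have : 0 ≤ halfHeat (-(1 / 2)) τ y := integral_nonneg fun _ => halfExp_nonneg _ _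
  linarith

lemma hasParabolicJet_callHeat :
    HasParabolicJet callHeat (fun τ y => callHeat τ y / 4 + gaussKer τ y)
      (fun τ y => halfHeat (1 / 2) τ y - callHeat τ y / 2)
      (fun τ y => callHeat τ y / 4 + gaussKer τ y) := by
  have h := (hasParabolicJet_halfHeat (1 / 2)).add
    ((hasParabolicJet_halfHeat (-(1 / 2))).const_mul (-1))
  have e0 : callHeat = fun τ y => halfHeat (1 / 2) τ y + -1 * halfHeat (-(1 / 2)) τ y := by
    ext τ y
    rw [callHeat_eq]
    ring
  convert h using 1
  all_goals
    ext τ y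
    rw [callHeat_eq]
    ring

lemma isCallHeatSolution_callHeat : IsCallHeatSolution callHeat := by
  have h := hasParabolicJet_callHeat
  have e1 : ∀ p ∈ Ioi (0 : ℝ) ×ˢ (univ : Set ℝ), deriv (callHeat p.1) =
      fun y => halfHeat (1 / 2) p.1 y - callHeat p.1 y / 2 := fun p hp =>
    funext fun y => (h.dy p.1 hp.1 y).deriv
  refine ⟨continuous_callHeat.continuousOn, ⟨fun p hp => (h.dt p.1 hp.1 p.2).differentiableAt,
    fun p hp => (h.dy p.1 hp.1 p.2).differentiableAt, fun p hp => ?_,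
    h.cont_t.congr fun p hp => (h.dt p.1 hp.1 p.2).deriv,
    h.cont_y.congr fun p hp => (h.dy p.1 hp.1 p.2).deriv,
    h.cont_yy.congr fun p hp => ?_⟩, fun τ hτ y => ?_, callHeat_zero, fun τ₁ hτ₁ => ?_⟩
  · rw [e1 p hp]
    exact (h.dyy p.1 hp.1 p.2).differentiableAt
  · simp only [e1 p hp]
    exact (h.dyy p.1 hp.1 p.2).deriv
  · rw [(h.dt τ hτ y).deriv, e1 (τ, y) ⟨hτ, trivial⟩, (h.dyy τ hτ y).deriv, sub_self]
  · refine ⟨1 * gaussConst τ₁, 1 / 2, fun τ hτ y => ?_⟩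
    rw [show 1 / 2 * |y| = |y| / 2 by ring]
    exact abs_heatAvg_le abs_payoff_le hτ.2 y

/-! ### Bounds for the call payoff under the heat flow -/

lemma halfHeat_le {τ τ₁ : ℝ} (hτ : 0 < τ) (hτ₁ : τ ≤ τ₁) (y : ℝ) :
    halfHeat (1 / 2) τ y ≤ Real.exp (τ₁ / 4) * Real.exp (|y| / 2) := by
  rw [halfHeat_eq _ hτ, ← Real.exp_add]
  refine (mul_le_of_le_one_right (Real.exp_pos _).le (normCdf_le_one _)).trans ?_
  rw [Real.exp_le_exp]
  nlinarith [le_abs_self y]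

lemma gaussKer_le {τ : ℝ} (hτ : 0 < τ) (y : ℝ) : gaussKer τ y ≤ 1 / √τ := by
  unfold gaussKer
  have h1 : Real.exp (-y ^ 2 / (4 * τ)) ≤ 1 := by
    rw [Real.exp_le_one_iff, neg_div]
    have : 0 ≤ y ^ 2 / (4 * τ) := by positivity
    linarith
  have h2 := Real.sqrt_pos.2 hτ
  have h3 : √τ ≤ √(Real.pi * τ) := Real.sqrt_le_sqrt (by nlinarith [Real.pi_gt_three])
  exact div_le_div₀ zero_le_one h1 h2 (by linarith)

/-- The Gauss kernel is controlled by `P = halfHeat (1/2)` in the region where `P` decays; this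
keeps the second-order Taylor remainder of the nonlinearity bounded. -/
lemma exists_mul_gaussKer_sq_le :
    ∃ C > 0, ∀ τ > 0, ∀ y, τ * gaussKer τ y ^ 2 ≤ C * halfHeat (1 / 2) τ y := by
  set c := (√(2 * Real.pi))⁻¹ * Real.exp (-1) with hc
  have hc0 : 0 < c := by positivity
  refine ⟨1 / c, by positivity, fun τ hτ y => ?_⟩
  have h1 : τ * gaussKer τ y ^ 2 ≤ Real.exp (-y ^ 2 / (2 * τ)) := by
    rw [gaussKer, div_pow, ← Real.exp_nat_mul, mul_pow, Real.sq_sqrt (by positivity),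
      ← mul_div_assoc, div_le_iff₀ (by positivity)]
    rw [show ((2 : ℕ) : ℝ) * (-y ^ 2 / (4 * τ)) = -y ^ 2 / (2 * τ) by push_cast; ring]
    have h0 := Real.exp_pos (-y ^ 2 / (2 * τ))
    have := mul_pos h0 hτ
    nlinarith [Real.pi_gt_three]
  refine h1.trans ?_
  rw [halfHeat_eq _ hτ, one_div_mul_eq_div, le_div_iff₀ hc0]
  set d := (y + 2 * (1 / 2) * τ) / √(2 * τ) with hd
  have hs : 0 < √(2 * τ) := Real.sqrt_pos.2 (by positivity)
  have hd2 : d ^ 2 = y ^ 2 / (2 * τ) + y + τ / 2 := by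
    rw [hd, div_pow, Real.sq_sqrt (by positivity)]
    field_simp
    ring
  have h2 : -y ^ 2 / (2 * τ) ≤ 1 / 2 * y + (1 / 2) ^ 2 * τ - (min d 0) ^ 2 := by
    rw [neg_div]
    rcases le_total 0 d with h | h
    · rw [min_eq_right h]
      have : y ^ 2 / (2 * τ) + 1 / 2 * y + (1 / 2) ^ 2 * τ
          = ((y + τ / 2) ^ 2 + τ ^ 2 / 4) / (2 * τ) := by
        field_simp
        ring
      have h3 : 0 ≤ ((y + τ / 2) ^ 2 + τ ^ 2 / 4) / (2 * τ) := by positivity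
      linarith
    · rw [min_eq_left h, hd2]
      have : y + 2 * (1 / 2) * τ ≤ 0 := by
        by_contra hcon
        exact absurd h (not_le.2 (div_pos (not_le.1 hcon) hs))
      linarith
  calc Real.exp (-y ^ 2 / (2 * τ)) * c
      ≤ Real.exp (1 / 2 * y + (1 / 2) ^ 2 * τ - (min d 0) ^ 2) * c := by gcongr
    _ = Real.exp (1 / 2 * y + (1 / 2) ^ 2 * τ) * (c * Real.exp (-(min d 0) ^ 2)) := by
        rw [sub_eq_add_neg, Real.exp_add]
        ring
    _ ≤ _ := by
        gcongr
        exact le_normCdf d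

/-- The spatial derivative of `halfHeat (1/2)`. -/
noncomputable def halfHeatY (τ y : ℝ) : ℝ := 1 / 2 * halfHeat (1 / 2) τ y + gaussKer τ y

lemma continuous_halfHeatY {s : ℝ} (hs : 0 < s) : Continuous (halfHeatY s) := by
  have h := (hasParabolicJet_halfHeat (1 / 2)).cont_y
  exact continuousOn_univ.1 (h.comp (f := fun z : ℝ => (s, z)) (by fun_prop)
    fun z _ => ⟨hs, trivial⟩)

lemma halfHeatY_pos {τ : ℝ} (hτ : 0 < τ) (y : ℝ) : 0 < halfHeatY τ y := by
  have h1 := halfHeat_pos (1 / 2) hτ y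
  have h2 := gaussKer_pos hτ y
  unfold halfHeatY
  positivity

lemma halfHeatY_le {τ₁ : ℝ} (hτ₁ : 0 < τ₁) :
    ∃ A ≥ 0, ∀ τ ∈ Ioc 0 τ₁, ∀ y, halfHeatY τ y ≤ A / √τ * Real.exp (|y| / 2) := by
  refine ⟨Real.exp (τ₁ / 4) * √τ₁ + 1, by positivity, fun τ hτ y => ?_⟩
  have h1 := halfHeat_le hτ.1 hτ.2 y
  have h2 := gaussKer_le hτ.1 y
  have h3 := Real.sqrt_pos.2 hτ.1
  have h4 : √τ ≤ √τ₁ := Real.sqrt_le_sqrt hτ.2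
  have h5 : 1 ≤ √τ₁ / √τ := (one_le_div h3).2 h4
  have h6 : 1 ≤ Real.exp (|y| / 2) := Real.one_le_exp (by positivity)
  have h7 := halfHeat_pos (1 / 2) hτ.1 y
  have h8 : 0 < Real.exp (τ₁ / 4) * Real.exp (|y| / 2) := by positivity
  rw [add_div, add_mul, halfHeatY]
  refine add_le_add ?_ (h2.trans ?_)
  · rw [mul_div_assoc, mul_right_comm]
    nlinarith
  · have : 0 < 1 / √τ := by positivity
    nlinarith

lemma heatAvg_halfHeatY {r s : ℝ} (hr : 0 < r) (hs : 0 < s) (y : ℝ) :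
    heatAvg (halfHeatY s) r y = halfHeatY (r + s) y := by
  obtain ⟨A, hA, hb⟩ := halfHeatY_le hs
  have h1 := hasDerivAt_heatAvg (h := halfHeat (1 / 2) s) (h' := halfHeatY s)
    (B := A / √s + Real.exp (s / 4))
    ((hasParabolicJet_halfHeat (1 / 2)).dy s hs) (continuous_halfHeatY hs) (fun z => ?_)
    (fun z => ?_) r y
  · rw [show heatAvg (halfHeat (1 / 2) s) r = halfHeat (1 / 2) (r + s) from
      funext (heatAvg_halfHeat le_rfl hr hs)] at h1
    exact h1.unique ((hasParabolicJet_halfHeat (1 / 2)).dy (r + s) (add_pos hr hs) y)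
  · rw [abs_of_pos (halfHeat_pos _ hs z)]
    refine (halfHeat_le hs le_rfl z).trans ?_
    gcongr
    exact le_add_of_nonneg_left (by positivity)
  · rw [abs_of_pos (halfHeatY_pos hs z)]
    refine (hb s ⟨hs, le_rfl⟩ z).trans ?_
    gcongr
    exact le_add_of_nonneg_right (by positivity)

/-! ### Comparison principle -/

lemma nonpos_of_hasDerivAt_of_le_right {f : ℝ → ℝ} {f' a b : ℝ} (hf : HasDerivAt f f' a)
    (hab : a < b) (h : ∀ t ∈ Ioo a b, f t ≤ f a) : f' ≤ 0 := by
  have h1 := (hasDerivWithinAt_iff_tendsto_slope' (s := Ioi a) (by simp)).1 hf.hasDerivWithinAt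
  refine le_of_tendsto h1 ?_
  filter_upwards [Ioo_mem_nhdsGT hab] with t ht
  rw [slope_def_field]
  exact div_nonpos_of_nonpos_of_nonneg (sub_nonpos.2 (h t ht)) (sub_nonneg.2 ht.1.le)

lemma IsLocalMax.second_deriv_nonpos {f f' : ℝ → ℝ} {f'' x : ℝ} (hmax : IsLocalMax f x)
    (h1 : ∀ᶠ z in 𝓝 x, HasDerivAt f (f' z) z) (h2 : HasDerivAt f' f'' x) : f'' ≤ 0 := by
  by_contra! hpos
  have hd : deriv f =ᶠ[𝓝 x] f' := h1.mono fun z hz => hz.deriv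
  have hdd : deriv (deriv f) x = f'' := hd.deriv_eq.trans h2.deriv
  have hmin : IsLocalMin f x := isLocalMin_of_deriv_deriv_pos (hdd ▸ hpos) hmax.deriv_eq_zero
    h1.self_of_nhds.continuousAt
  have hconst : f =ᶠ[𝓝 x] fun _ => f x := by
    filter_upwards [hmax, hmin] with z hz1 hz2 using le_antisymm hz1 hz2
  have h0 : deriv (deriv f) x = 0 := by
    rw [(hconst.deriv).deriv_eq]
    simp
  linarith

/-- The growth barrier `xⁿ + x⁻ⁿ`. -/
noncomputable def powBarrier (n : ℕ) (x : ℝ) : ℝ := x ^ (n : ℤ) + x ^ (-(n : ℤ))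

lemma powBarrier_pos (n : ℕ) {x : ℝ} (hx : 0 < x) : 0 < powBarrier n x := by
  unfold powBarrier
  positivity

lemma hasDerivAt_powBarrier (n : ℕ) {x : ℝ} (hx : 0 < x) :
    HasDerivAt (powBarrier n) (n * x ^ ((n : ℤ) - 1) - n * x ^ (-(n : ℤ) - 1)) x := by
  have h1 := hasDerivAt_zpow (n : ℤ) x (Or.inl hx.ne')
  have h2 := hasDerivAt_zpow (-(n : ℤ)) x (Or.inl hx.ne')
  refine (h1.add h2).congr_deriv ?_
  push_cast
  ring

lemma hasDerivAt_powBarrier_deriv (n : ℕ) {x : ℝ} (hx : 0 < x) :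
    HasDerivAt (fun x : ℝ => n * x ^ ((n : ℤ) - 1) - n * x ^ (-(n : ℤ) - 1))
      ((n * (n - 1)) * x ^ ((n : ℤ) - 1 - 1) + n * (n + 1) * x ^ (-(n : ℤ) - 1 - 1)) x := by
  have h1 := (hasDerivAt_zpow ((n : ℤ) - 1) x (Or.inl hx.ne')).const_mul (n : ℝ)
  have h2 := (hasDerivAt_zpow (-(n : ℤ) - 1) x (Or.inl hx.ne')).const_mul (n : ℝ)
  refine (h1.sub h2).congr_deriv ?_
  push_cast
  ring

lemma abs_mul_powBarrier_deriv_le (n : ℕ) {x : ℝ} (hx : 0 < x) :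
    |x * (n * x ^ ((n : ℤ) - 1) - n * x ^ (-(n : ℤ) - 1))| ≤ n * powBarrier n x := by
  rw [zpow_sub_one₀ hx.ne', zpow_sub_one₀ hx.ne', powBarrier]
  have h1 : 0 < x ^ (n : ℤ) := by positivity
  have h2 : 0 < x ^ (-(n : ℤ)) := by positivity
  have e : x * (n * (x ^ (n : ℤ) * x⁻¹) - n * (x ^ (-(n : ℤ)) * x⁻¹))
      = n * (x ^ (n : ℤ) - x ^ (-(n : ℤ))) := by
    field_simp
  rw [e, abs_mul, abs_of_nonneg (Nat.cast_nonneg n)]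
  refine mul_le_mul_of_nonneg_left ?_ (Nat.cast_nonneg n)
  rw [abs_le]
  constructor <;> linarith

lemma sq_mul_powBarrier_deriv_deriv_le (n : ℕ) {x : ℝ} (hx : 0 < x) :
    x ^ 2 * ((n * (n - 1)) * x ^ ((n : ℤ) - 1 - 1) + n * (n + 1) * x ^ (-(n : ℤ) - 1 - 1))
      ≤ n * (n + 1) * powBarrier n x := by
  rw [zpow_sub_one₀ hx.ne', zpow_sub_one₀ hx.ne', zpow_sub_one₀ hx.ne', zpow_sub_one₀ hx.ne',
    powBarrier]
  have h1 : 0 < x ^ (n : ℤ) := by positivity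
  have e : x ^ 2 * ((n * (n - 1)) * (x ^ (n : ℤ) * x⁻¹ * x⁻¹)
      + n * (n + 1) * (x ^ (-(n : ℤ)) * x⁻¹ * x⁻¹))
      = n * (n - 1) * x ^ (n : ℤ) + n * (n + 1) * x ^ (-(n : ℤ)) := by
    field_simp
  rw [e, mul_add]
  have : (0 : ℝ) ≤ n := Nat.cast_nonneg n
  have := mul_nonneg this h1.le
  nlinarith

/-- Far out and near zero, `xᵐ⁺¹ + x⁻ᵐ⁻¹` dominates `xᵐ + x⁻ᵐ`. -/
lemma mul_lt_mul_powBarrier {A ε : ℝ} (hA : 0 ≤ A) (hε : 0 < ε) (m : ℕ) {x : ℝ} (hx : 0 < x)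
    (h : 2 * A / ε + 1 ≤ x ∨ x ≤ (2 * A / ε + 1)⁻¹) :
    A * (x ^ m + (x ^ m)⁻¹) < ε * powBarrier (m + 1) x := by
  have key : ∀ x : ℝ, 2 * A / ε + 1 ≤ x →
      A * (x ^ m + (x ^ m)⁻¹) < ε * (x ^ (m + 1) + (x ^ (m + 1))⁻¹) := by
    intro x hx
    have h0 : 0 ≤ 2 * A / ε := by positivity
    have h1 : 1 ≤ x := by linarith
    have h2 : 1 ≤ x ^ m := one_le_pow₀ h1
    have h3 : (x ^ m)⁻¹ ≤ 1 := inv_le_one_of_one_le₀ h2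
    have h4 : 2 * A < ε * x := by
      have : 2 * A / ε < x := by linarith
      rw [div_lt_iff₀ hε] at this
      linarith
    have h5 : 0 < (x ^ (m + 1))⁻¹ := by positivity
    calc A * (x ^ m + (x ^ m)⁻¹) ≤ A * (x ^ m + x ^ m) := by gcongr; linarith
      _ = 2 * A * x ^ m := by ring
      _ < ε * x * x ^ m := by gcongr
      _ = ε * x ^ (m + 1) := by ring
      _ ≤ _ := by
        gcongr
        linarith
  have e : powBarrier (m + 1) x = x ^ (m + 1) + (x ^ (m + 1))⁻¹ := by
    rw [powBarrier, zpow_neg, zpow_natCast]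
  rw [e]
  rcases h with h | h
  · exact key x h
  · have := key x⁻¹ ((le_inv_comm₀ (by positivity) hx).2 h)
    rw [inv_pow, inv_pow, inv_inv, inv_inv, add_comm, add_comm (x ^ (m + 1))⁻¹] at this
    exact this

/-- One-sided comparison with a supersolution: `M e^{(2L+1)(T-t)} (1 + x)` dominates, and a multiple
`ε e^{μ(T-t)}` of the growth barrier excludes a maximum at infinity; `μ` may depend on the growth
rate since `ε → 0`. -/
lemma le_of_parabolic_inequality {κ L M T A : ℝ} {m : ℕ} (hκ : 0 ≤ κ) (hL : 0 ≤ L) (hM : 0 ≤ M)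
    {D Dt Dx Dxx : ℝ → ℝ → ℝ}
    (hc : ContinuousOn (fun p : ℝ × ℝ => D p.1 p.2) (Icc 0 T ×ˢ Ioi 0))
    (hdt : ∀ t ∈ Ioo 0 T, ∀ x > 0, HasDerivAt (fun t => D t x) (Dt t x) t)
    (hdx : ∀ t ∈ Ioo 0 T, ∀ x > 0, HasDerivAt (D t) (Dx t x) x)
    (hdxx : ∀ t ∈ Ioo 0 T, ∀ x > 0, HasDerivAt (Dx t) (Dxx t x) x)
    (hineq : ∀ t ∈ Ioo 0 T, ∀ x > 0, |Dt t x + κ * x ^ 2 * Dxx t x|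
      ≤ L * (|D t x| + |x * Dx t x|) + M * (1 + x))
    (hterm : ∀ x > 0, D T x = 0)
    (hgrowth : ∀ t ∈ Icc 0 T, ∀ x > 0, |D t x| ≤ A * (x ^ m + (x ^ m)⁻¹))
    {t₀ x₀ : ℝ} (ht₀ : t₀ ∈ Ioo 0 T) (hx₀ : 0 < x₀) :
    D t₀ x₀ ≤ M * Real.exp ((2 * L + 1) * (T - t₀)) * (1 + x₀) := by
  have hT : 0 < T := ht₀.1.trans ht₀.2
  have hA : 0 ≤ A := by
    have := (abs_nonneg _).trans (hgrowth T ⟨hT.le, le_rfl⟩ 1 one_pos)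
    norm_num at this
    linarith
  set l := 2 * L + 1 with hl
  set n := m + 1 with hn
  set μ := κ * (n * (n + 1)) + L * n with hμ
  have hμ0 : 0 ≤ μ := by positivity
  -- it suffices to show that the penalised function is nonpositive
  suffices hE : ∀ ε > 0, Real.exp (-l * (T - t₀)) * D t₀ x₀ - M * (1 + x₀)
      - ε * (Real.exp (μ * (T - t₀)) * powBarrier n x₀) ≤ 0 by
    have h1 : Real.exp (-l * (T - t₀)) * D t₀ x₀ - M * (1 + x₀) ≤ 0 := by
      have hlim : Tendsto (fun ε : ℝ => Real.exp (-l * (T - t₀)) * D t₀ x₀ - M * (1 + x₀)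
          - ε * (Real.exp (μ * (T - t₀)) * powBarrier n x₀)) (𝓝[>] 0)
          (𝓝 (Real.exp (-l * (T - t₀)) * D t₀ x₀ - M * (1 + x₀))) := by
        refine Tendsto.mono_left ?_ nhdsWithin_le_nhds
        refine Continuous.tendsto' (by fun_prop) _ _ (by ring)
      exact le_of_tendsto hlim (eventually_mem_nhdsWithin.mono fun ε hε => hE ε hε)
    have h2 : Real.exp (l * (T - t₀)) * Real.exp (-l * (T - t₀)) = 1 := by
      rw [← Real.exp_add]
      simp
    have h3 := mul_le_mul_of_nonneg_left (sub_nonpos.1 h1) (Real.exp_pos (l * (T - t₀))).le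
    rw [← mul_assoc, h2, one_mul] at h3
    linarith
  intro ε hε
  by_contra! hpos
  set E : ℝ → ℝ → ℝ := fun t x => Real.exp (-l * (T - t)) * D t x - M * (1 + x)
      - ε * (Real.exp (μ * (T - t)) * powBarrier n x) with hEdef
  change 0 < E t₀ x₀ at hpos
  set R := 2 * A / ε + 1 with hR
  have hR1 : 1 ≤ R := by
    have : 0 ≤ 2 * A / ε := by positivity
    linarith
  have hR0 : 0 < R := by linarith
  have hneg : ∀ t ∈ Icc 0 T, ∀ x > 0, (R ≤ x ∨ x ≤ R⁻¹) → E t x < 0 := by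
    intro t ht x hx h
    have h1 := mul_lt_mul_powBarrier hA hε m hx h
    have h2 := hgrowth t ht x hx
    have h3 : Real.exp (-l * (T - t)) ≤ 1 := Real.exp_le_one_iff.2 (by nlinarith [ht.2])
    have h4 : 1 ≤ Real.exp (μ * (T - t)) := Real.one_le_exp (mul_nonneg hμ0 (sub_nonneg.2 ht.2))
    have h5 := powBarrier_pos n hx
    have h6 : Real.exp (-l * (T - t)) * D t x ≤ |D t x| := by
      calc _ ≤ Real.exp (-l * (T - t)) * |D t x| := by gcongr; exact le_abs_self _
        _ ≤ 1 * |D t x| := by gcongr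
        _ = _ := one_mul _
    have h7 : ε * powBarrier n x ≤ ε * (Real.exp (μ * (T - t)) * powBarrier n x) := by
      gcongr
      exact le_mul_of_one_le_left h5.le h4
    have h8 : 0 ≤ M * (1 + x) := by positivity
    simp only [hEdef]
    linarith
  have hRx : ∀ t ∈ Icc 0 T, ∀ x > 0, 0 < E t x → x ∈ Ioo R⁻¹ R := by
    intro t ht x hx h
    by_contra hcon
    rw [mem_Ioo, not_and_or, not_lt, not_lt] at hcon
    exact absurd (hneg t ht x hx hcon.symm) (not_lt.2 h.le)
  have hx₀R := hRx t₀ ⟨ht₀.1.le, ht₀.2.le⟩ x₀ hx₀ hpos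
  have hRi : 0 < R⁻¹ := inv_pos.2 hR0
  have hEc : ContinuousOn (fun p : ℝ × ℝ => E p.1 p.2) (Icc t₀ T ×ˢ Icc R⁻¹ R) := by
    have hsub : Icc t₀ T ×ˢ Icc R⁻¹ R ⊆ Icc 0 T ×ˢ Ioi 0 :=
      prod_mono (Icc_subset_Icc_left ht₀.1.le) fun x hx => hRi.trans_le hx.1
    have hB : ContinuousOn (fun p : ℝ × ℝ => powBarrier n p.2) (Icc t₀ T ×ˢ Icc R⁻¹ R) := by
      refine ContinuousOn.comp (t := Ioi 0) (g := powBarrier n) (fun x hx =>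
        (hasDerivAt_powBarrier n hx).continuousAt.continuousWithinAt) continuous_snd.continuousOn
        fun p hp => hRi.trans_le hp.2.1
    have hD := hc.mono hsub
    simp only [hEdef]
    fun_prop
  obtain ⟨⟨t, x⟩, ⟨ht, hx⟩, hmax⟩ := (isCompact_Icc.prod isCompact_Icc).exists_isMaxOn
    ⟨(t₀, x₀), ⟨le_rfl, ht₀.2.le⟩, hx₀R.1.le, hx₀R.2.le⟩ hEc
  have hmax' : ∀ t' ∈ Icc t₀ T, ∀ x' ∈ Icc R⁻¹ R, E t' x' ≤ E t x := fun t' ht' x' hx' =>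
    hmax (show (t', x') ∈ _ from ⟨ht', hx'⟩)
  simp only at ht hx
  have hEpos : 0 < E t x := hpos.trans_le
    (hmax' t₀ ⟨le_rfl, ht₀.2.le⟩ x₀ ⟨hx₀R.1.le, hx₀R.2.le⟩)
  have hx0 : 0 < x := hRi.trans_le hx.1
  have ht0 : 0 < t := ht₀.1.trans_le ht.1
  have hxR := hRx t ⟨ht0.le, ht.2⟩ x hx0 hEpos
  have htT : t < T := by
    refine lt_of_le_of_ne ht.2 fun h => ?_
    have h1 := powBarrier_pos n hx0
    have h2 : 0 ≤ M * (1 + x) := by positivity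
    have h3 : 0 < ε * (Real.exp (μ * (T - T)) * powBarrier n x) := by positivity
    simp only [hEdef, h, hterm x hx0] at hEpos
    linarith
  have htm : t ∈ Ioo 0 T := ⟨ht0, htT⟩
  set q := Real.exp (-l * (T - t)) with hq
  set k := ε * Real.exp (μ * (T - t)) with hk
  set b := k * powBarrier n x with hb
  have hb0 : 0 < b := mul_pos (by positivity) (powBarrier_pos n hx0)
  have hk0 : 0 < k := by positivity
  have hq0 : 0 < q := Real.exp_pos _
  have hq1 : q ≤ 1 := Real.exp_le_one_iff.2 (by nlinarith)
  have hEt : q * (l * D t x + Dt t x) + μ * b ≤ 0 := by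
    have h1 : ∀ c : ℝ, HasDerivAt (fun t => Real.exp (c * (T - t)))
        (Real.exp (c * (T - t)) * -c) t := fun c => by
      have := ((hasDerivAt_id t).const_sub T).const_mul c
      simpa using this.exp
    have h2 : HasDerivAt (fun t => E t x) (q * (l * D t x + Dt t x) + μ * b) t := by
      refine ((((h1 (-l)).mul (hdt t htm x hx0)).sub_const (M * (1 + x))).sub
        (((h1 μ).mul_const (powBarrier n x)).const_mul ε)).congr_deriv ?_
      rw [hb, hk]
      ring
    exact nonpos_of_hasDerivAt_of_le_right h2 htT fun t' ht' =>
      hmax' t' ⟨ht.1.trans ht'.1.le, ht'.2.le⟩ x hx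
  have hloc : IsLocalMax (E t) x := by
    filter_upwards [Ioo_mem_nhds hxR.1 hxR.2] with x' hx'
    exact hmax' t ht x' ⟨hx'.1.le, hx'.2.le⟩
  have hEx : ∀ z > 0, HasDerivAt (E t) (q * Dx t z - M
      - k * (n * z ^ ((n : ℤ) - 1) - n * z ^ (-(n : ℤ) - 1))) z := by
    intro z hz
    have h1 : HasDerivAt (fun z : ℝ => M * (1 + z)) M z := by
      simpa using ((hasDerivAt_id z).const_add 1).const_mul M
    refine ((((hdx t htm z hz).const_mul q).sub h1).sub
      (((hasDerivAt_powBarrier n hz).const_mul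
        (Real.exp (μ * (T - t)))).const_mul ε)).congr_deriv ?_
    rw [hk]
    ring
  have hEx0 := hloc.hasDerivAt_eq_zero (hEx x hx0)
  have hExx := hloc.second_deriv_nonpos
    (eventually_of_mem (Ioi_mem_nhds hx0) fun z hz => hEx z hz)
    ((((hdxx t htm x hx0).const_mul q).sub_const M).sub
      ((hasDerivAt_powBarrier_deriv n hx0).const_mul k))
  have hB1 := abs_mul_powBarrier_deriv_le n hx0
  have hB2 := sq_mul_powBarrier_deriv_deriv_le n hx0
  set B1 := n * x ^ ((n : ℤ) - 1) - n * x ^ (-(n : ℤ) - 1)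
  set B2 := (n * (n - 1)) * x ^ ((n : ℤ) - 1 - 1) + n * (n + 1) * x ^ (-(n : ℤ) - 1 - 1)
  have hE0 : M * (1 + x) + b < q * D t x := by
    have : E t x = q * D t x - M * (1 + x) - b := by
      simp only [hEdef, hb, hk]
      ring
    linarith
  have hqD : |D t x| * q = q * D t x := by
    have : 0 ≤ M * (1 + x) := by positivity
    have h1 : 0 < q * D t x := by linarith
    rw [abs_of_pos ((mul_pos_iff_of_pos_left hq0).1 h1), mul_comm]
  have hxDx : |x * Dx t x| * q ≤ M * x + n * b := by
    have h1 : x * Dx t x * q = M * x + k * (x * B1) := by linear_combination x * hEx0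
    rw [show |x * Dx t x| * q = |x * Dx t x * q| by rw [abs_mul _ q, abs_of_pos hq0], h1]
    refine (abs_add_le _ _).trans ?_
    rw [abs_of_nonneg (by positivity : 0 ≤ M * x), abs_mul, abs_of_pos hk0]
    have := mul_le_mul_of_nonneg_left hB1 hk0.le
    rw [hb]
    linarith
  have hxx : κ * x ^ 2 * (q * Dxx t x) ≤ κ * (n * (n + 1)) * b := by
    have h1 : q * Dxx t x ≤ k * B2 := by linarith
    calc κ * x ^ 2 * (q * Dxx t x) ≤ κ * x ^ 2 * (k * B2) := by gcongr
      _ = κ * k * (x ^ 2 * B2) := by ring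
      _ ≤ κ * k * (n * (n + 1) * powBarrier n x) := by gcongr
      _ = _ := by rw [hb]; ring
  have hI := (abs_le.1 (hineq t htm x hx0)).1
  have hI2 := mul_le_mul_of_nonneg_left hI hq0.le
  have hI3 : q * (M * (1 + x)) ≤ M * (1 + x) := mul_le_of_le_one_left (by positivity) hq1
  have hI4 : L * (|x * Dx t x| * q) ≤ L * (M * x + n * b) := mul_le_mul_of_nonneg_left hxDx hL
  have hI5 : L * (|D t x| * q) = L * (q * D t x) := by rw [hqD]
  have hI6 : (L + 1) * (M * (1 + x) + b) < (L + 1) * (q * D t x) :=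
    mul_lt_mul_of_pos_left hE0 (by linarith)
  have hI7 : 0 ≤ L * M := mul_nonneg hL hM
  have hI8 : 0 ≤ L * b := mul_nonneg hL hb0.le
  rw [hμ, hl] at hEt
  linarith

/-- Comparison principle on `[0, T] × (0, ∞)`; the constant does not depend on the growth rate. -/
lemma abs_le_of_parabolic_inequality {κ L M T A : ℝ} {m : ℕ} (hκ : 0 ≤ κ) (hL : 0 ≤ L)
    (hM : 0 ≤ M) (hT : 0 < T) {D Dt Dx Dxx : ℝ → ℝ → ℝ}
    (hc : ContinuousOn (fun p : ℝ × ℝ => D p.1 p.2) (Icc 0 T ×ˢ Ioi 0))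
    (hdt : ∀ t ∈ Ioo 0 T, ∀ x > 0, HasDerivAt (fun t => D t x) (Dt t x) t)
    (hdx : ∀ t ∈ Ioo 0 T, ∀ x > 0, HasDerivAt (D t) (Dx t x) x)
    (hdxx : ∀ t ∈ Ioo 0 T, ∀ x > 0, HasDerivAt (Dx t) (Dxx t x) x)
    (hineq : ∀ t ∈ Ioo 0 T, ∀ x > 0, |Dt t x + κ * x ^ 2 * Dxx t x|
      ≤ L * (|D t x| + |x * Dx t x|) + M * (1 + x))
    (hterm : ∀ x > 0, D T x = 0)
    (hgrowth : ∀ t ∈ Icc 0 T, ∀ x > 0, |D t x| ≤ A * (x ^ m + (x ^ m)⁻¹))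
    {t x : ℝ} (ht : t ∈ Icc 0 T) (hx : 0 < x) :
    |D t x| ≤ M * Real.exp ((2 * L + 1) * T) * (1 + x) := by
  have hin : ∀ t ∈ Ioo 0 T, |D t x| ≤ M * Real.exp ((2 * L + 1) * T) * (1 + x) := by
    intro t ht
    have hle : M * Real.exp ((2 * L + 1) * (T - t)) * (1 + x)
        ≤ M * Real.exp ((2 * L + 1) * T) * (1 + x) := by
      have := ht.1
      gcongr
      linarith
    rw [abs_le']
    constructor
    · exact (le_of_parabolic_inequality hκ hL hM hc hdt hdx hdxx hineq hterm hgrowth ht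
        hx).trans hle
    · refine (le_of_parabolic_inequality (D := fun t x => -D t x) (Dt := fun t x => -Dt t x)
        (Dx := fun t x => -Dx t x) (Dxx := fun t x => -Dxx t x) (A := A) (m := m) hκ hL hM hc.neg
        (fun t ht x hx => (hdt t ht x hx).neg) (fun t ht x hx => (hdx t ht x hx).neg)
        (fun t ht x hx => (hdxx t ht x hx).neg) (fun t ht x hx => ?_)
        (fun x hx => by rw [hterm x hx, neg_zero])
        (fun t ht x hx => by rw [abs_neg]; exact hgrowth t ht x hx) ht hx).trans hle
      rw [mul_neg, ← neg_add, mul_neg, abs_neg, abs_neg, abs_neg]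
      exact hineq t ht x hx
  have hcl : Icc 0 T = closure (Ioo 0 T) := (closure_Ioo hT.ne).symm
  have hcx : ContinuousOn (fun t => |D t x|) (closure (Ioo 0 T)) := by
    rw [← hcl]
    exact (hc.comp (f := fun t : ℝ => (t, x)) (by fun_prop) fun t ht => ⟨ht, hx⟩).abs
  exact le_on_closure (s := Ioo 0 T) (g := fun _ => M * Real.exp ((2 * L + 1) * T) * (1 + x))
    hin hcx continuousOn_const (hcl ▸ ht)

/-! ### Uniqueness for the heat equation -/

lemma exp_mul_abs_log_le (m : ℕ) {x : ℝ} (hx : 0 < x) :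
    Real.exp (m * |Real.log x|) ≤ x ^ m + (x ^ m)⁻¹ := by
  have h1 : 0 < x ^ m := by positivity
  have h2 : 0 < (x ^ m)⁻¹ := by positivity
  have h3 : Real.exp (m * Real.log x) = x ^ m := by
    rw [Real.exp_nat_mul, Real.exp_log hx]
  rcases abs_choice (Real.log x) with h | h
  · rw [h, h3]
    linarith
  · rw [h, mul_neg, Real.exp_neg, h3]
    linarith

lemma IsCallHeatSolution.eq_callHeat {u₀ : ℝ → ℝ → ℝ} (h : IsCallHeatSolution u₀) {τ : ℝ}
    (hτ : 0 ≤ τ) (y : ℝ) : u₀ τ y = callHeat τ y := by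
  have h' := isCallHeatSolution_callHeat
  rcases hτ.eq_or_lt with rfl | hτ
  · rw [h.initial, h'.initial]
  set w : ℝ → ℝ → ℝ := fun s z => u₀ s z - callHeat s z with hw
  have hwt : ∀ s > 0, ∀ z, HasDerivAt (fun s => w s z)
      (deriv (fun s => u₀ s z) s - deriv (fun s => callHeat s z) s) s := fun s hs z =>
    (h.c12.diff_fst (s, z) ⟨hs, trivial⟩).hasDerivAt.sub
      (h'.c12.diff_fst (s, z) ⟨hs, trivial⟩).hasDerivAt
  have hwy : ∀ s > 0, ∀ z, HasDerivAt (w s) (deriv (u₀ s) z - deriv (callHeat s) z) z :=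
    fun s hs z => (h.c12.diff_snd (s, z) ⟨hs, trivial⟩).hasDerivAt.sub
      (h'.c12.diff_snd (s, z) ⟨hs, trivial⟩).hasDerivAt
  have hwyy : ∀ s > 0, ∀ z, HasDerivAt (fun z => deriv (u₀ s) z - deriv (callHeat s) z)
      (deriv (deriv (u₀ s)) z - deriv (deriv (callHeat s)) z) z :=
    fun s hs z => (h.c12.diff_snd_snd (s, z) ⟨hs, trivial⟩).hasDerivAt.sub
      (h'.c12.diff_snd_snd (s, z) ⟨hs, trivial⟩).hasDerivAt
  obtain ⟨A₁, a₁, hg₁⟩ := h.growth τ hτ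
  obtain ⟨A₂, a₂, hg₂⟩ := h'.growth τ hτ
  obtain ⟨m, hm⟩ := exists_nat_ge (max a₁ a₂)
  -- in the variables `t = τ - s`, `x = e^z` the comparison principle applies with `κ = L = 1`
  have key := abs_le_of_parabolic_inequality (κ := 1) (L := 1) (M := 0) (T := τ)
    (A := |A₁| + |A₂|) (m := m)
    (D := fun t x => w (τ - t) (Real.log x))
    (Dt := fun t x => -(deriv (fun s => u₀ s (Real.log x)) (τ - t)
      - deriv (fun s => callHeat s (Real.log x)) (τ - t)))
    (Dx := fun t x => (deriv (u₀ (τ - t)) (Real.log x)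
      - deriv (callHeat (τ - t)) (Real.log x)) * x⁻¹)
    (Dxx := fun t x => (deriv (deriv (u₀ (τ - t))) (Real.log x)
      - deriv (deriv (callHeat (τ - t))) (Real.log x)) * x⁻¹ * x⁻¹
      + (deriv (u₀ (τ - t)) (Real.log x) - deriv (callHeat (τ - t)) (Real.log x)) * -(x ^ 2)⁻¹)
    zero_le_one zero_le_one le_rfl hτ ?_ ?_ ?_ ?_ ?_ ?_ ?_ (t := 0) (x := Real.exp y)
    ⟨le_rfl, hτ.le⟩ (Real.exp_pos y)
  · simp only [sub_zero, Real.log_exp, zero_mul] at key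
    exact sub_eq_zero.1 (abs_nonpos_iff.1 key)
  · have hcw : ContinuousOn (fun p : ℝ × ℝ => w p.1 p.2) (Ici 0 ×ˢ univ) := h.cont.sub h'.cont
    refine hcw.comp (f := fun p : ℝ × ℝ => (τ - p.1, Real.log p.2)) ?_
      fun p hp => ⟨sub_nonneg.2 hp.1.2, trivial⟩
    exact (by fun_prop : Continuous fun p : ℝ × ℝ => τ - p.1).continuousOn.prodMk
      (continuousOn_snd.log fun p hp => (ne_of_gt hp.2))
  · intro t ht x hx
    have := (hwt (τ - t) (sub_pos.2 ht.2) (Real.log x)).comp t ((hasDerivAt_id t).const_sub τ)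
    simpa [Function.comp_def] using this
  · intro t ht x hx
    exact (hwy (τ - t) (sub_pos.2 ht.2) (Real.log x)).comp x (Real.hasDerivAt_log hx.ne')
  · intro t ht x hx
    exact ((hwyy (τ - t) (sub_pos.2 ht.2) (Real.log x)).comp x (Real.hasDerivAt_log hx.ne')).mul
      (hasDerivAt_inv hx.ne')
  · intro t ht x hx
    have e1 := h.heat (τ - t) (sub_pos.2 ht.2) (Real.log x)
    have e2 := h'.heat (τ - t) (sub_pos.2 ht.2) (Real.log x)
    rw [sub_eq_zero] at e1 e2
    simp only [e1, e2, zero_mul, add_zero, one_mul]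
    refine le_trans (le_of_eq ?_) (le_add_of_nonneg_left (abs_nonneg _))
    rw [← abs_neg]
    congr 1
    field_simp
    ring
  · intro x hx
    simp only [hw, sub_self]
    rw [h.initial, h'.initial, sub_self]
  · intro t ht x hx
    have hmem : τ - t ∈ Icc 0 τ := ⟨sub_nonneg.2 ht.2, by linarith [ht.1]⟩
    have hexp : ∀ A a : ℝ, a ≤ max a₁ a₂ → A * Real.exp (a * |Real.log x|)
        ≤ |A| * (x ^ m + (x ^ m)⁻¹) := by
      intro A a ha
      refine mul_le_mul (le_abs_self A) ((Real.exp_le_exp.2 ?_).trans (exp_mul_abs_log_le m hx))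
        (Real.exp_pos _).le (abs_nonneg A)
      exact mul_le_mul_of_nonneg_right (ha.trans hm) (abs_nonneg _)
    have b1 := (hg₁ _ hmem (Real.log x)).trans (hexp A₁ a₁ (le_max_left _ _))
    have b2 := (hg₂ _ hmem (Real.log x)).trans (hexp A₂ a₂ (le_max_right _ _))
    refine (abs_sub _ _).trans ?_
    linarith

/-! ### Taylor expansion of the Euclidean norm -/

lemma abs_le_sqrt_add_sq (a b : ℝ) : |a| ≤ √(a ^ 2 + b ^ 2) :=
  Real.abs_le_sqrt (by nlinarith [sq_nonneg b])

lemma abs_sqrt_sub_sqrt_le (a₁ a₂ b₁ b₂ : ℝ) :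
    |√(a₁ ^ 2 + a₂ ^ 2) - √(b₁ ^ 2 + b₂ ^ 2)| ≤ |a₁ - b₁| + |a₂ - b₂| := by
  have key : ∀ a₁ a₂ b₁ b₂ : ℝ,
      √(a₁ ^ 2 + a₂ ^ 2) ≤ √(b₁ ^ 2 + b₂ ^ 2) + (|a₁ - b₁| + |a₂ - b₂|) := by
    intro a₁ a₂ b₁ b₂
    rw [Real.sqrt_le_iff]
    refine ⟨by positivity, ?_⟩
    have h1 := Real.sq_sqrt (show 0 ≤ b₁ ^ 2 + b₂ ^ 2 by positivity)
    have h2 := abs_le_sqrt_add_sq b₁ b₂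
    have h3 := abs_le_sqrt_add_sq b₂ b₁
    rw [add_comm (b₂ ^ 2)] at h3
    set q := √(b₁ ^ 2 + b₂ ^ 2)
    have h4 : b₁ * (a₁ - b₁) ≤ q * |a₁ - b₁| := by
      refine (le_abs_self _).trans ?_
      rw [abs_mul]
      gcongr
    have h5 : b₂ * (a₂ - b₂) ≤ q * |a₂ - b₂| := by
      refine (le_abs_self _).trans ?_
      rw [abs_mul]
      gcongr
    have h6 := sq_abs (a₁ - b₁)
    have h7 := sq_abs (a₂ - b₂)
    have h8 := mul_nonneg (abs_nonneg (a₁ - b₁)) (abs_nonneg (a₂ - b₂))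
    nlinarith
  rw [abs_le]
  have h1 := key a₁ a₂ b₁ b₂
  have h2 := key b₁ b₂ a₁ a₂
  rw [abs_sub_comm b₁, abs_sub_comm b₂] at h2
  constructor <;> linarith

/-- The second-order Taylor remainder of the Euclidean norm, without restriction on the
increment. -/
lemma abs_sqrt_taylor_le {a₁ a₂ q : ℝ} (hq : 0 < q) (hq2 : q ^ 2 = a₁ ^ 2 + a₂ ^ 2) (h₁ h₂ : ℝ) :
    |√((a₁ + h₁) ^ 2 + (a₂ + h₂) ^ 2) - q - (a₁ * h₁ + a₂ * h₂) / q|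
      ≤ (h₁ ^ 2 + h₂ ^ 2) / (2 * q) := by
  set r := √((a₁ + h₁) ^ 2 + (a₂ + h₂) ^ 2) with hr
  have hr2 : r ^ 2 = (a₁ + h₁) ^ 2 + (a₂ + h₂) ^ 2 := Real.sq_sqrt (by positivity)
  have hr0 : 0 ≤ r := Real.sqrt_nonneg _
  have e : r - q - (a₁ * h₁ + a₂ * h₂) / q = (q * r - q ^ 2 - (a₁ * h₁ + a₂ * h₂)) / q := by
    field_simp
  -- Cauchy-Schwarz
  have h1 : a₁ * (a₁ + h₁) + a₂ * (a₂ + h₂) ≤ q * r := by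
    refine abs_le_of_sq_le_sq' ?_ (by positivity) |>.2
    rw [mul_pow, hq2, hr2]
    nlinarith [sq_nonneg (a₁ * (a₂ + h₂) - a₂ * (a₁ + h₁))]
  rw [e, abs_of_nonneg (div_nonneg (by nlinarith) hq.le), div_le_div_iff₀ hq (by positivity)]
  have h2 : q * r ≤ (q ^ 2 + r ^ 2) / 2 := by nlinarith [sq_nonneg (q - r)]
  have h3 : q * r - q ^ 2 - (a₁ * h₁ + a₂ * h₂) ≤ (h₁ ^ 2 + h₂ ^ 2) / 2 := by nlinarith
  nlinarith

lemma abs_sqrt_expansion_le {a₁ a₂ q : ℝ} (hq : 0 < q) (hq2 : q ^ 2 = a₁ ^ 2 + a₂ ^ 2)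
    (h₁ h₂ k₁ k₂ ρ : ℝ) :
    |√((a₁ + ρ * h₁ + ρ ^ 2 * k₁) ^ 2 + (a₂ + ρ * h₂ + ρ ^ 2 * k₂) ^ 2) - q
        - ρ * ((a₁ * h₁ + a₂ * h₂) / q)|
      ≤ ρ ^ 2 * (|k₁| + |k₂| + (h₁ ^ 2 + h₂ ^ 2) / (2 * q)) := by
  have h1 := abs_sqrt_taylor_le hq hq2 (ρ * h₁) (ρ * h₂)
  have h2 := abs_sqrt_sub_sqrt_le (a₁ + ρ * h₁ + ρ ^ 2 * k₁) (a₂ + ρ * h₂ + ρ ^ 2 * k₂)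
    (a₁ + ρ * h₁) (a₂ + ρ * h₂)
  rw [add_sub_cancel_left, add_sub_cancel_left, abs_mul, abs_mul,
    abs_of_nonneg (sq_nonneg ρ)] at h2
  have e1 : (a₁ * (ρ * h₁) + a₂ * (ρ * h₂)) / q = ρ * ((a₁ * h₁ + a₂ * h₂) / q) := by ring
  have e2 : ((ρ * h₁) ^ 2 + (ρ * h₂) ^ 2) / (2 * q) = ρ ^ 2 * ((h₁ ^ 2 + h₂ ^ 2) / (2 * q)) := by
    ring
  rw [e1, e2] at h1
  have h3 := abs_add_le
    (√((a₁ + ρ * h₁ + ρ ^ 2 * k₁) ^ 2 + (a₂ + ρ * h₂ + ρ ^ 2 * k₂) ^ 2)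
      - √((a₁ + ρ * h₁) ^ 2 + (a₂ + ρ * h₂) ^ 2))
    (√((a₁ + ρ * h₁) ^ 2 + (a₂ + ρ * h₂) ^ 2) - q - ρ * ((a₁ * h₁ + a₂ * h₂) / q))
  refine le_trans (le_of_eq ?_) (h3.trans (add_le_add h2 h1) |>.trans (le_of_eq ?_))
  · congr 1
    ring
  · ring

/-! ### The source of the first correction -/

/-- The norm of `(u₀, u₀/2 + u₀')`; the first source is a multiple of it. -/
noncomputable def callNorm (τ y : ℝ) : ℝ := √(callHeat τ y ^ 2 + halfHeat (1 / 2) τ y ^ 2)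

lemma callNorm_sq (τ y : ℝ) :
    callNorm τ y ^ 2 = callHeat τ y ^ 2 + halfHeat (1 / 2) τ y ^ 2 :=
  Real.sq_sqrt (by positivity)

lemma callHeat_le_callNorm (τ y : ℝ) : callHeat τ y ≤ callNorm τ y :=
  (le_abs_self _).trans (abs_le_sqrt_add_sq _ _)

lemma halfHeat_le_callNorm (τ y : ℝ) : halfHeat (1 / 2) τ y ≤ callNorm τ y := by
  rw [callNorm, add_comm]
  exact (le_abs_self _).trans (abs_le_sqrt_add_sq _ _)

lemma callNorm_pos {τ : ℝ} (hτ : 0 < τ) (y : ℝ) : 0 < callNorm τ y :=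
  (halfHeat_pos _ hτ y).trans_le (halfHeat_le_callNorm τ y)

lemma callNorm_le {τ : ℝ} (hτ : 0 < τ) (y : ℝ) : callNorm τ y ≤ 2 * halfHeat (1 / 2) τ y := by
  have h1 := callHeat_le τ y
  have h2 := (callHeat_pos hτ y).le
  rw [callNorm, Real.sqrt_le_iff]
  constructor <;> nlinarith

lemma continuousOn_callNorm :
    ContinuousOn (fun p : ℝ × ℝ => callNorm p.1 p.2) (Ioi 0 ×ˢ univ) :=
  ((continuous_callHeat.continuousOn.pow 2).add
    ((hasParabolicJet_halfHeat (1 / 2)).cont.pow 2)).sqrt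

/-- The spatial derivative of `callNorm`. -/
noncomputable def callNormY (τ y : ℝ) : ℝ :=
  (callHeat τ y * (halfHeat (1 / 2) τ y - callHeat τ y / 2)
    + halfHeat (1 / 2) τ y * halfHeatY τ y) / callNorm τ y

lemma hasDerivAt_callNorm {τ : ℝ} (hτ : 0 < τ) (y : ℝ) :
    HasDerivAt (callNorm τ) (callNormY τ y) y := by
  have h1 := hasParabolicJet_callHeat.dy τ hτ y
  have h2 := (hasParabolicJet_halfHeat (1 / 2)).dy τ hτ y
  have h3 := callNorm_pos hτ y
  have h4 : callHeat τ y ^ 2 + halfHeat (1 / 2) τ y ^ 2 ≠ 0 := by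
    rw [← callNorm_sq]
    positivity
  refine (((h1.pow 2).add (h2.pow 2)).sqrt h4).congr_deriv ?_
  change _ / (2 * callNorm τ y) = _
  rw [callNormY, halfHeatY]
  field_simp
  norm_num

lemma continuousOn_callNormY :
    ContinuousOn (fun p : ℝ × ℝ => callNormY p.1 p.2) (Ioi 0 ×ˢ univ) := by
  have h1 := hasParabolicJet_callHeat.cont
  have h2 := (hasParabolicJet_halfHeat (1 / 2)).cont
  have h3 : ContinuousOn (fun p : ℝ × ℝ => halfHeatY p.1 p.2) (Ioi 0 ×ˢ univ) :=
    (hasParabolicJet_halfHeat (1 / 2)).cont_y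
  exact ((h1.mul (h2.sub (h1.div_const 2))).add (h2.mul h3)).div continuousOn_callNorm
    fun p hp => (callNorm_pos hp.1 p.2).ne'

lemma halfHeat_le_halfHeatY {τ : ℝ} (hτ : 0 < τ) (y : ℝ) :
    halfHeat (1 / 2) τ y ≤ 2 * halfHeatY τ y := by
  have := gaussKer_pos hτ y
  rw [halfHeatY]
  linarith

lemma abs_callHeatY_le {τ : ℝ} (hτ : 0 < τ) (y : ℝ) :
    |halfHeat (1 / 2) τ y - callHeat τ y / 2| ≤ halfHeat (1 / 2) τ y := by
  have h1 := callHeat_le τ y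
  have h2 := callHeat_pos hτ y
  rw [abs_le]
  constructor <;> linarith

lemma abs_callNormY_le {τ : ℝ} (hτ : 0 < τ) (y : ℝ) : |callNormY τ y| ≤ 3 * halfHeatY τ y := by
  have h1 := callHeat_le_callNorm τ y
  have h2 := callHeat_pos hτ y
  have h3 := halfHeat_le_callNorm τ y
  have h4 := halfHeat_pos (1 / 2) hτ y
  have h5 := callNorm_pos hτ y
  have h6 := halfHeat_le_halfHeatY hτ y
  have h7 := abs_callHeatY_le hτ y
  have h8 := halfHeatY_pos hτ y
  rw [callNormY, abs_div, abs_of_pos h5, div_le_iff₀ h5]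
  refine (abs_add_le _ _).trans ?_
  rw [abs_mul, abs_mul, abs_of_pos h2, abs_of_pos h4, abs_of_pos h8]
  have h9 : callHeat τ y * |halfHeat (1 / 2) τ y - callHeat τ y / 2|
      ≤ callNorm τ y * (2 * halfHeatY τ y) :=
    mul_le_mul h1 (h7.trans h6) (abs_nonneg _) h5.le
  have h10 : halfHeat (1 / 2) τ y * halfHeatY τ y ≤ callNorm τ y * halfHeatY τ y := by gcongr
  linarith

section Source

variable {σ : ℝ} {u₀ : ℝ → ℝ → ℝ}

lemma IsCallHeatSolution.slice_eq (h : IsCallHeatSolution u₀) {τ : ℝ} (hτ : 0 < τ) :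
    u₀ τ = callHeat τ := funext (h.eq_callHeat hτ.le)

lemma IsCallHeatSolution.deriv_eq (h : IsCallHeatSolution u₀) {τ : ℝ} (hτ : 0 < τ) (y : ℝ) :
    deriv (u₀ τ) y = halfHeat (1 / 2) τ y - callHeat τ y / 2 := by
  rw [h.slice_eq hτ]
  exact (hasParabolicJet_callHeat.dy τ hτ y).deriv

lemma bsNonlin_eq (σ v₁ v₂ : ℝ) :
    bsNonlin σ v₁ v₂ = -(2 / σ ^ 2) * √(v₁ ^ 2 + (v₁ / 2 + v₂) ^ 2) := by
  rw [bsNonlin]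
  congr 2
  ring

lemma IsCallHeatSolution.source₁_eq (h : IsCallHeatSolution u₀) {s : ℝ} (hs : 0 < s) (z : ℝ) :
    source₁ σ u₀ s z = -(2 / σ ^ 2) * callNorm s z := by
  rw [source₁, bsNonlin_eq, h.deriv_eq hs, h.slice_eq hs, callNorm]
  congr 4
  ring

/-- The spatial derivative of the first source. -/
noncomputable def source₁Y (σ s z : ℝ) : ℝ := -(2 / σ ^ 2) * callNormY s z

lemma IsCallHeatSolution.abs_source₁_le (h : IsCallHeatSolution u₀) {s : ℝ} (hs : 0 < s) (z : ℝ) :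
    |source₁ σ u₀ s z| ≤ 2 * (2 / σ ^ 2) * halfHeat (1 / 2) s z := by
  have hc : 0 ≤ 2 / σ ^ 2 := by positivity
  rw [h.source₁_eq hs, abs_mul, abs_neg, abs_of_nonneg hc, abs_of_pos (callNorm_pos hs z)]
  have := mul_le_mul_of_nonneg_left (callNorm_le hs z) hc
  linarith

lemma abs_source₁Y_le {s : ℝ} (hs : 0 < s) (z : ℝ) :
    |source₁Y σ s z| ≤ 3 * (2 / σ ^ 2) * halfHeatY s z := by
  have hc : 0 ≤ 2 / σ ^ 2 := by positivity
  rw [source₁Y, abs_mul, abs_neg, abs_of_nonneg hc]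
  have := mul_le_mul_of_nonneg_left (abs_callNormY_le hs z) hc
  linarith

lemma IsCallHeatSolution.isSmoothSource₁ (h : IsCallHeatSolution u₀) :
    IsSmoothSource (source₁ σ u₀) (source₁Y σ) where
  deriv := fun s hs z => by
    rw [show source₁ σ u₀ s = fun z => -(2 / σ ^ 2) * callNorm s z from
      funext (h.source₁_eq hs)]
    exact (hasDerivAt_callNorm hs z).const_mul _
  cont := (continuousOn_const.mul continuousOn_callNorm).congr fun p hp => h.source₁_eq hp.1 p.2
  cont_deriv := continuousOn_const.mul continuousOn_callNormY
  bound := fun τ₁ hτ₁ => by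
    refine ⟨2 * (2 / σ ^ 2) * Real.exp (τ₁ / 4), by positivity, fun s hs z => ?_⟩
    refine (h.abs_source₁_le hs.1 z).trans ?_
    rw [mul_assoc (2 * (2 / σ ^ 2))]
    exact mul_le_mul_of_nonneg_left (halfHeat_le hs.1 hs.2 z) (by positivity)
  bound_deriv := fun τ₁ hτ₁ => by
    obtain ⟨A, hA, hb⟩ := halfHeatY_le hτ₁
    refine ⟨3 * (2 / σ ^ 2) * A, by positivity, fun s hs z => ?_⟩
    refine (abs_source₁Y_le hs.1 z).trans ?_
    rw [mul_div_assoc, mul_assoc (3 * (2 / σ ^ 2))]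
    exact mul_le_mul_of_nonneg_left (hb s hs z) (by positivity)

/-! ### The first correction -/

/-- The spatial derivative of `U₁`. -/
noncomputable def U₁Y (σ : ℝ) : ℝ → ℝ → ℝ := avgConv (source₁Y σ)

/-- The second spatial derivative of `U₁`. -/
noncomputable def U₁YY (σ : ℝ) : ℝ → ℝ → ℝ := avgDerivConv (source₁Y σ)

lemma IsCallHeatSolution.hasParabolicJet_U₁ (h : IsCallHeatSolution u₀) :
    HasParabolicJet (U₁ σ u₀) (fun τ y => source₁ σ u₀ τ y + U₁YY σ τ y) (U₁Y σ) (U₁YY σ) :=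
  h.isSmoothSource₁.hasParabolicJet

/-- By the semigroup property the source bound is inherited with a factor `τ`. -/
lemma IsCallHeatSolution.abs_U₁_le (h : IsCallHeatSolution u₀) {τ : ℝ} (hτ : 0 < τ) (y : ℝ) :
    |U₁ σ u₀ τ y| ≤ 4 * (2 / σ ^ 2) * τ * halfHeatY τ y := by
  have hc : 0 ≤ 2 / σ ^ 2 := by positivity
  have h1 : |avgConv (source₁ σ u₀) τ y| ≤ 2 * (2 / σ ^ 2) * halfHeat (1 / 2) τ y * τ := by
    refine abs_timeConv_le_of_le hτ fun s hs => ?_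
    have hr := sub_pos.2 hs.2
    refine (heatAvg_abs_le (H := fun z => 2 * (2 / σ ^ 2) * halfHeat (1 / 2) s z)
      (h.abs_source₁_le hs.1) ?_).trans (le_of_eq ?_)
    · have hcont : Continuous (halfHeat (1 / 2) s) := continuous_iff_continuousAt.2 fun z =>
        ((hasParabolicJet_halfHeat (1 / 2)).dy s hs.1 z).continuousAt
      refine (integrable_heatAvg (h := halfHeat (1 / 2) s) (B := Real.exp (s / 4))
        hcont.measurable (fun z => ?_) _ _).const_mul _
      rw [abs_of_pos (halfHeat_pos _ hs.1 z)]
      exact halfHeat_le hs.1 le_rfl z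
    · have h2 := heatAvg_halfHeat (le_refl (1 / 2)) hr hs.1 y
      rw [sub_add_cancel] at h2
      rw [← h2, heatAvg, heatAvg, integral_const_mul]
  rw [show U₁ σ u₀ τ y = duhamel (source₁ σ u₀) τ y from rfl, duhamel_eq _ hτ]
  refine h1.trans ?_
  have h3 : 0 ≤ 2 * (2 / σ ^ 2) * τ := by positivity
  have := mul_le_mul_of_nonneg_left (halfHeat_le_halfHeatY hτ y) h3
  linarith

lemma abs_U₁Y_le {τ : ℝ} (hτ : 0 < τ) (y : ℝ) :
    |U₁Y σ τ y| ≤ 4 * (2 / σ ^ 2) * τ * halfHeatY τ y := by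
  have hc : 0 ≤ 2 / σ ^ 2 := by positivity
  have h1 : |avgConv (source₁Y σ) τ y| ≤ 3 * (2 / σ ^ 2) * halfHeatY τ y * τ := by
    refine abs_timeConv_le_of_le hτ fun s hs => ?_
    have hr := sub_pos.2 hs.2
    refine (heatAvg_abs_le (H := fun z => 3 * (2 / σ ^ 2) * halfHeatY s z)
      (abs_source₁Y_le hs.1) ?_).trans (le_of_eq ?_)
    · obtain ⟨A, hA, hb⟩ := halfHeatY_le hs.1
      refine (integrable_heatAvg (h := halfHeatY s) (B := A / √s)
        (continuous_halfHeatY hs.1).measurable (fun z => ?_) _ _).const_mul _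
      rw [abs_of_pos (halfHeatY_pos hs.1 z)]
      exact hb s ⟨hs.1, le_rfl⟩ z
    · have h2 := heatAvg_halfHeatY hr hs.1 y
      rw [sub_add_cancel] at h2
      rw [← h2, heatAvg, heatAvg, integral_const_mul]
  refine h1.trans ?_
  have h3 : 0 ≤ (2 / σ ^ 2) * τ * halfHeatY τ y :=
    mul_nonneg (by positivity) (halfHeatY_pos hτ y).le
  linarith

/-! ### The second correction -/

lemma exists_mul_halfHeatY_sq_le {τ₁ : ℝ} :
    ∃ C ≥ 0, ∀ τ ∈ Ioc 0 τ₁, ∀ y,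
      τ * halfHeatY τ y * (halfHeatY τ y / halfHeat (1 / 2) τ y) ≤ C * Real.exp (|y| / 2) := by
  obtain ⟨C, hC, hb⟩ := exists_mul_gaussKer_sq_le
  refine ⟨|τ₁| * Real.exp (τ₁ / 4) + 2 * C, by positivity, fun τ hτ y => ?_⟩
  have hP := halfHeat_pos (1 / 2) hτ.1 y
  have h1 := hb τ hτ.1 y
  have h2 := halfHeat_le hτ.1 hτ.2 y
  have h3 : 1 ≤ Real.exp (|y| / 2) := Real.one_le_exp (by positivity)
  have h4 : τ * halfHeatY τ y * (halfHeatY τ y / halfHeat (1 / 2) τ y)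
      ≤ τ * halfHeat (1 / 2) τ y + 2 * C := by
    rw [← mul_div_assoc, div_le_iff₀ hP, halfHeatY]
    have h5 : (1 / 2 * halfHeat (1 / 2) τ y + gaussKer τ y) ^ 2
        ≤ halfHeat (1 / 2) τ y ^ 2 + 2 * gaussKer τ y ^ 2 := by
      nlinarith [sq_nonneg (1 / 2 * halfHeat (1 / 2) τ y - gaussKer τ y),
        sq_nonneg (halfHeat (1 / 2) τ y)]
    have h6 := mul_le_mul_of_nonneg_left h5 hτ.1.le
    linarith
  have h7 : τ * halfHeat (1 / 2) τ y ≤ |τ₁| * (Real.exp (τ₁ / 4) * Real.exp (|y| / 2)) :=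
    mul_le_mul (hτ.2.trans (le_abs_self _)) h2 hP.le (abs_nonneg _)
  nlinarith

lemma hasDerivAt_bsNonlin_fst {v₁ v₂ : ℝ} (h : 0 < √(v₁ ^ 2 + (v₁ / 2 + v₂) ^ 2)) :
    HasDerivAt (fun v => bsNonlin σ v v₂)
      (-(2 / σ ^ 2) * ((v₁ + (v₁ / 2 + v₂) / 2) / √(v₁ ^ 2 + (v₁ / 2 + v₂) ^ 2))) v₁ := by
  simp only [bsNonlin_eq]
  have h1 : HasDerivAt (fun v : ℝ => v ^ 2 + (v / 2 + v₂) ^ 2)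
      (2 * v₁ + (v₁ / 2 + v₂)) v₁ := by
    have h2 : HasDerivAt (fun v : ℝ => v / 2 + v₂) (1 / 2) v₁ :=
      ((hasDerivAt_id v₁).div_const 2).add_const v₂
    refine (((hasDerivAt_id v₁).pow 2).add (h2.pow 2)).congr_deriv ?_
    simp only [id]
    norm_num
    ring
  refine ((h1.sqrt (Real.sqrt_pos.1 h).ne').const_mul _).congr_deriv ?_
  field_simp

lemma hasDerivAt_bsNonlin_snd {v₁ v₂ : ℝ} (h : 0 < √(v₁ ^ 2 + (v₁ / 2 + v₂) ^ 2)) :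
    HasDerivAt (fun v => bsNonlin σ v₁ v)
      (-(2 / σ ^ 2) * ((v₁ / 2 + v₂) / √(v₁ ^ 2 + (v₁ / 2 + v₂) ^ 2))) v₂ := by
  simp only [bsNonlin_eq]
  have h1 : HasDerivAt (fun v : ℝ => v₁ ^ 2 + (v₁ / 2 + v) ^ 2) (2 * (v₁ / 2 + v₂)) v₂ := by
    have h2 : HasDerivAt (fun v : ℝ => v₁ / 2 + v) 1 v₂ := (hasDerivAt_id v₂).const_add _
    refine ((h2.pow 2).const_add _).congr_deriv ?_
    norm_num
  refine ((h1.sqrt (Real.sqrt_pos.1 h).ne').const_mul _).congr_deriv ?_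
  field_simp

/-- The inner product of `(u₀, u₀/2 + u₀')` and `(U₁, U₁/2 + U₁')`. -/
noncomputable def callInner (σ : ℝ) (u₀ : ℝ → ℝ → ℝ) (s z : ℝ) : ℝ :=
  callHeat s z * U₁ σ u₀ s z + halfHeat (1 / 2) s z * (U₁ σ u₀ s z / 2 + U₁Y σ s z)

/-- The spatial derivative of `callInner`. -/
noncomputable def callInnerY (σ : ℝ) (u₀ : ℝ → ℝ → ℝ) (s z : ℝ) : ℝ :=
  (halfHeat (1 / 2) s z - callHeat s z / 2) * U₁ σ u₀ s z + callHeat s z * U₁Y σ s z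
    + (halfHeatY s z * (U₁ σ u₀ s z / 2 + U₁Y σ s z)
      + halfHeat (1 / 2) s z * (U₁Y σ s z / 2 + U₁YY σ s z))

/-- The spatial derivative of the second source. -/
noncomputable def source₂Y (σ : ℝ) (u₀ : ℝ → ℝ → ℝ) (s z : ℝ) : ℝ :=
  -(2 / σ ^ 2) * ((callInnerY σ u₀ s z * callNorm s z - callInner σ u₀ s z * callNormY s z)
    / callNorm s z ^ 2)

lemma IsCallHeatSolution.source₂_eq (h : IsCallHeatSolution u₀) {s : ℝ} (hs : 0 < s) (z : ℝ) :
    source₂ σ u₀ s z = -(2 / σ ^ 2) * (callInner σ u₀ s z / callNorm s z) := by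
  have h1 : u₀ s z / 2 + deriv (u₀ s) z = halfHeat (1 / 2) s z := by
    rw [h.deriv_eq hs, h.slice_eq hs]
    ring
  have h2 : √(u₀ s z ^ 2 + (u₀ s z / 2 + deriv (u₀ s) z) ^ 2) = callNorm s z := by
    rw [h1, h.slice_eq hs, callNorm]
  have hq := callNorm_pos hs z
  have hq' := hq
  rw [← h2] at hq'
  rw [source₂, (hasDerivAt_bsNonlin_fst hq').deriv, (hasDerivAt_bsNonlin_snd hq').deriv, h2, h1,
    (h.hasParabolicJet_U₁.dy s hs z).deriv, h.slice_eq hs, callInner]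
  field_simp
  ring

lemma IsCallHeatSolution.hasDerivAt_callInner (h : IsCallHeatSolution u₀) {s : ℝ} (hs : 0 < s)
    (z : ℝ) : HasDerivAt (callInner σ u₀ s) (callInnerY σ u₀ s z) z := by
  have h1 := hasParabolicJet_callHeat.dy s hs z
  have h2 := (hasParabolicJet_halfHeat (1 / 2)).dy s hs z
  have hj := h.hasParabolicJet_U₁ (σ := σ)
  exact (h1.mul (hj.dy s hs z)).add
    (h2.mul (((hj.dy s hs z).div_const 2).add (hj.dyy s hs z)))

lemma IsCallHeatSolution.abs_callInner_div_le (h : IsCallHeatSolution u₀) {s : ℝ} (hs : 0 < s)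
    (z : ℝ) :
    |callInner σ u₀ s z| / callNorm s z ≤ 10 * (2 / σ ^ 2) * (s * halfHeatY s z) := by
  have hV := h.abs_U₁_le (σ := σ) hs z
  have hV1 := abs_U₁Y_le (σ := σ) hs z
  have hq := callNorm_pos hs z
  have hu := callHeat_pos hs z
  have hP := halfHeat_pos (1 / 2) hs z
  rw [div_le_iff₀ hq, callInner]
  refine (abs_add_le _ _).trans ?_
  rw [abs_mul, abs_mul, abs_of_pos hu, abs_of_pos hP]
  have h1 := mul_le_mul (callHeat_le_callNorm s z) hV (abs_nonneg _) hq.le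
  have h2 : |U₁ σ u₀ s z / 2 + U₁Y σ s z| ≤ 6 * (2 / σ ^ 2) * s * halfHeatY s z := by
    refine (abs_add_le _ _).trans ?_
    rw [abs_div, abs_two]
    linarith
  have h3 := mul_le_mul (halfHeat_le_callNorm s z) h2 (abs_nonneg _) hq.le
  linarith

lemma IsCallHeatSolution.abs_callInnerY_div_le (h : IsCallHeatSolution u₀) {s : ℝ} (hs : 0 < s)
    (z : ℝ) :
    |callInnerY σ u₀ s z| / callNorm s z ≤ 10 * (2 / σ ^ 2) * (s * halfHeatY s z) + |U₁YY σ s z|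
      + 6 * (2 / σ ^ 2) * (s * halfHeatY s z * (halfHeatY s z / halfHeat (1 / 2) s z)) := by
  have hV := h.abs_U₁_le (σ := σ) hs z
  have hV1 := abs_U₁Y_le (σ := σ) hs z
  have hq := callNorm_pos hs z
  have hu := callHeat_pos hs z
  have hP := halfHeat_pos (1 / 2) hs z
  have hY := halfHeatY_pos hs z
  have hPq := halfHeat_le_callNorm s z
  have h1 := mul_le_mul ((abs_callHeatY_le hs z).trans hPq) hV (abs_nonneg _) hq.le
  have h2 := mul_le_mul (callHeat_le_callNorm s z) hV1 (abs_nonneg _) hq.le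
  have h3 : |U₁ σ u₀ s z / 2 + U₁Y σ s z| ≤ 6 * (2 / σ ^ 2) * s * halfHeatY s z := by
    refine (abs_add_le _ _).trans ?_
    rw [abs_div, abs_two]
    linarith
  have h4 : halfHeatY s z * |U₁ σ u₀ s z / 2 + U₁Y σ s z|
      ≤ callNorm s z * (6 * (2 / σ ^ 2) * (s * halfHeatY s z
        * (halfHeatY s z / halfHeat (1 / 2) s z))) := by
    calc _ ≤ halfHeatY s z * (6 * (2 / σ ^ 2) * s * halfHeatY s z) := by gcongr
      _ = halfHeat (1 / 2) s z * (6 * (2 / σ ^ 2) * (s * halfHeatY s z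
        * (halfHeatY s z / halfHeat (1 / 2) s z))) := by field_simp
      _ ≤ _ := by gcongr
  have h5 : |U₁Y σ s z / 2 + U₁YY σ s z| ≤ 2 * (2 / σ ^ 2) * s * halfHeatY s z + |U₁YY σ s z| := by
    refine (abs_add_le _ _).trans ?_
    rw [abs_div, abs_two]
    linarith
  have h6 := mul_le_mul hPq h5 (abs_nonneg _) hq.le
  rw [div_le_iff₀ hq, callInnerY]
  refine (abs_add_le _ _).trans ?_
  refine (add_le_add (abs_add_le _ _) (abs_add_le _ _)).trans ?_
  rw [abs_mul, abs_mul, abs_mul, abs_mul, abs_of_pos hu, abs_of_pos hP, abs_of_pos hY]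
  linarith

lemma exists_mul_halfHeatY_le {τ₁ : ℝ} (hτ₁ : 0 < τ₁) :
    ∃ C ≥ 0, ∀ τ ∈ Ioc 0 τ₁, ∀ y, τ * halfHeatY τ y ≤ C * Real.exp (|y| / 2) := by
  obtain ⟨A, hA, hb⟩ := halfHeatY_le hτ₁
  refine ⟨A * √τ₁, by positivity, fun τ hτ y => ?_⟩
  have h1 := Real.sqrt_pos.2 hτ.1
  have h2 : √τ ≤ √τ₁ := Real.sqrt_le_sqrt hτ.2
  calc τ * halfHeatY τ y ≤ τ * (A / √τ * Real.exp (|y| / 2)) :=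
        mul_le_mul_of_nonneg_left (hb τ hτ y) hτ.1.le
    _ = A * (τ / √τ) * Real.exp (|y| / 2) := by ring
    _ = A * √τ * Real.exp (|y| / 2) := by rw [Real.div_sqrt]
    _ ≤ _ := by gcongr

lemma IsCallHeatSolution.isSmoothSource₂ (h : IsCallHeatSolution u₀) :
    IsSmoothSource (source₂ σ u₀) (source₂Y σ u₀) where
  deriv := fun s hs z => by
    rw [show source₂ σ u₀ s = fun z => -(2 / σ ^ 2) * (callInner σ u₀ s z / callNorm s z) from
      funext (h.source₂_eq hs)]
    exact ((h.hasDerivAt_callInner hs z).div (hasDerivAt_callNorm hs z)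
      (callNorm_pos hs z).ne').const_mul _
  cont := by
    have hu := hasParabolicJet_callHeat.cont
    have hP := (hasParabolicJet_halfHeat (1 / 2)).cont
    have hj := h.hasParabolicJet_U₁ (σ := σ)
    have hI : ContinuousOn (fun p : ℝ × ℝ => callInner σ u₀ p.1 p.2) (Ioi 0 ×ˢ univ) :=
      (hu.mul hj.cont).add (hP.mul ((hj.cont.div_const 2).add hj.cont_y))
    exact (continuousOn_const.mul (hI.div continuousOn_callNorm
      fun p hp => (callNorm_pos hp.1 p.2).ne')).congr fun p hp => h.source₂_eq hp.1 p.2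
  cont_deriv := by
    have hu := hasParabolicJet_callHeat.cont
    have hP := (hasParabolicJet_halfHeat (1 / 2)).cont
    have hY : ContinuousOn (fun p : ℝ × ℝ => halfHeatY p.1 p.2) (Ioi 0 ×ˢ univ) :=
      (hasParabolicJet_halfHeat (1 / 2)).cont_y
    have hj := h.hasParabolicJet_U₁ (σ := σ)
    have hW := (hj.cont.div_const 2).add hj.cont_y
    have hI : ContinuousOn (fun p : ℝ × ℝ => callInner σ u₀ p.1 p.2) (Ioi 0 ×ˢ univ) :=
      (hu.mul hj.cont).add (hP.mul hW)
    have hIY : ContinuousOn (fun p : ℝ × ℝ => callInnerY σ u₀ p.1 p.2) (Ioi 0 ×ˢ univ) :=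
      (((hP.sub (hu.div_const 2)).mul hj.cont).add (hu.mul hj.cont_y)).add
        ((hY.mul hW).add (hP.mul ((hj.cont_y.div_const 2).add hj.cont_yy)))
    refine continuousOn_const.mul (((hIY.mul continuousOn_callNorm).sub
      (hI.mul continuousOn_callNormY)).div (continuousOn_callNorm.pow 2) fun p hp => ?_)
    have := callNorm_pos hp.1 p.2
    positivity
  bound := fun τ₁ hτ₁ => by
    obtain ⟨C, hC, hb⟩ := exists_mul_halfHeatY_le hτ₁
    refine ⟨(2 / σ ^ 2) * (10 * (2 / σ ^ 2) * C), by positivity, fun s hs z => ?_⟩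
    rw [h.source₂_eq hs.1, abs_mul, abs_neg, abs_of_nonneg (by positivity : 0 ≤ 2 / σ ^ 2), abs_div,
      abs_of_pos (callNorm_pos hs.1 z), mul_assoc (2 / σ ^ 2), mul_assoc (10 * (2 / σ ^ 2))]
    refine mul_le_mul_of_nonneg_left ((h.abs_callInner_div_le hs.1 z).trans ?_) (by positivity)
    exact mul_le_mul_of_nonneg_left (hb s hs z) (by positivity)
  bound_deriv := fun τ₁ hτ₁ => by
    obtain ⟨C₁, hC₁, hb₁⟩ := exists_mul_halfHeatY_le hτ₁
    obtain ⟨C₂, hC₂, hb₂⟩ := exists_mul_halfHeatY_sq_le (τ₁ := τ₁)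
    obtain ⟨C₃, hC₃, hb₃⟩ :=
      (h.isSmoothSource₁ (σ := σ)).isSourceField_deriv.isSingularKernel_heatAvgDeriv.abs_timeConv_le
        hτ₁
    set c := 2 / σ ^ 2 with hc
    have hc0 : 0 ≤ c := by positivity
    refine ⟨c * (10 * c * C₁ + C₃ + 36 * c * C₂) * √τ₁, by positivity, fun s hs z => ?_⟩
    have hq := callNorm_pos hs.1 z
    have hP := halfHeat_pos (1 / 2) hs.1 z
    have hY := halfHeatY_pos hs.1 z
    have h1 := hb₁ s hs z
    have h2 := hb₂ s hs z
    have h3 : |U₁YY σ s z| ≤ C₃ * Real.exp (|z| / 2) := hb₃ s hs z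
    have h4 := h.abs_callInnerY_div_le (σ := σ) hs.1 z
    have h5 := h.abs_callInner_div_le (σ := σ) hs.1 z
    have h6 : |callNormY s z| / callNorm s z ≤ 3 * (halfHeatY s z / halfHeat (1 / 2) s z) := by
      rw [← mul_div_assoc]
      exact div_le_div₀ (by positivity) (abs_callNormY_le hs.1 z) hP (halfHeat_le_callNorm s z)
    rw [← hc] at h4 h5
    have h7 : |callInner σ u₀ s z| / callNorm s z * (|callNormY s z| / callNorm s z)
        ≤ 10 * c * (s * halfHeatY s z) * (3 * (halfHeatY s z / halfHeat (1 / 2) s z)) :=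
      mul_le_mul h5 h6 (by positivity) ((by positivity : (0 : ℝ) ≤ _).trans h5)
    have e : (callInnerY σ u₀ s z * callNorm s z - callInner σ u₀ s z * callNormY s z)
        / callNorm s z ^ 2 = callInnerY σ u₀ s z / callNorm s z
          - callInner σ u₀ s z / callNorm s z * (callNormY s z / callNorm s z) := by
      field_simp
    have h8 : |source₂Y σ u₀ s z| ≤ c * (10 * c * C₁ + C₃ + 36 * c * C₂) * Real.exp (|z| / 2) := by
      rw [source₂Y, e, abs_mul, abs_neg, abs_of_nonneg hc0, mul_assoc c]
      refine mul_le_mul_of_nonneg_left ((abs_sub _ _).trans ?_) hc0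
      rw [abs_mul, abs_div, abs_div, abs_div, abs_of_pos hq]
      have h9 := mul_le_mul_of_nonneg_left h1 (by positivity : 0 ≤ 10 * c)
      have h10 := mul_le_mul_of_nonneg_left h2 (by positivity : 0 ≤ 36 * c)
      linarith
    refine h8.trans ?_
    have h11 := Real.sqrt_pos.2 hs.1
    have h12 : √s ≤ √τ₁ := Real.sqrt_le_sqrt hs.2
    refine mul_le_mul_of_nonneg_right ?_ (Real.exp_pos _).le
    rw [le_div_iff₀ h11]
    gcongr

/-- The spatial derivative of `U₂`. -/
noncomputable def U₂Y (σ : ℝ) (u₀ : ℝ → ℝ → ℝ) : ℝ → ℝ → ℝ := avgConv (source₂Y σ u₀)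

/-- The second spatial derivative of `U₂`. -/
noncomputable def U₂YY (σ : ℝ) (u₀ : ℝ → ℝ → ℝ) : ℝ → ℝ → ℝ := avgDerivConv (source₂Y σ u₀)

lemma IsCallHeatSolution.hasParabolicJet_U₂ (h : IsCallHeatSolution u₀) :
    HasParabolicJet (U₂ σ u₀) (fun τ y => source₂ σ u₀ τ y + U₂YY σ u₀ τ y) (U₂Y σ u₀)
      (U₂YY σ u₀) :=
  h.isSmoothSource₂.hasParabolicJet

end Source

/-! ### The approximate solution in the heat variables -/

lemma HasParabolicJet.congr {w v wt wy wyy : ℝ → ℝ → ℝ} (hw : HasParabolicJet w wt wy wyy)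
    (h : ∀ τ > 0, ∀ y, v τ y = w τ y) : HasParabolicJet v wt wy wyy where
  dt := fun τ hτ y => (hw.dt τ hτ y).congr_of_eventuallyEq
    (eventually_of_mem (Ioi_mem_nhds hτ) fun s hs => h s hs y)
  dy := fun τ hτ y => by
    rw [show v τ = w τ from funext (h τ hτ)]
    exact hw.dy τ hτ y
  dyy := hw.dyy
  cont := hw.cont.congr fun p hp => h p.1 hp.1 p.2
  cont_t := hw.cont_t
  cont_y := hw.cont_y
  cont_yy := hw.cont_yy

section Approx

variable {σ ρ : ℝ} {u₀ : ℝ → ℝ → ℝ}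

/-- The time derivative of `uApprox`. -/
noncomputable def uApproxT (σ ρ : ℝ) (u₀ : ℝ → ℝ → ℝ) (τ y : ℝ) : ℝ :=
  callHeat τ y / 4 + gaussKer τ y + ρ * (source₁ σ u₀ τ y + U₁YY σ τ y)
    + ρ ^ 2 * (source₂ σ u₀ τ y + U₂YY σ u₀ τ y)

/-- The spatial derivative of `uApprox`. -/
noncomputable def uApproxY (σ ρ : ℝ) (u₀ : ℝ → ℝ → ℝ) (τ y : ℝ) : ℝ :=
  halfHeat (1 / 2) τ y - callHeat τ y / 2 + ρ * U₁Y σ τ y + ρ ^ 2 * U₂Y σ u₀ τ y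

/-- The second spatial derivative of `uApprox`. -/
noncomputable def uApproxYY (σ ρ : ℝ) (u₀ : ℝ → ℝ → ℝ) (τ y : ℝ) : ℝ :=
  callHeat τ y / 4 + gaussKer τ y + ρ * U₁YY σ τ y + ρ ^ 2 * U₂YY σ u₀ τ y

lemma IsCallHeatSolution.hasParabolicJet_uApprox (h : IsCallHeatSolution u₀) (σ ρ : ℝ) :
    HasParabolicJet (uApprox σ ρ u₀) (uApproxT σ ρ u₀) (uApproxY σ ρ u₀) (uApproxYY σ ρ u₀) :=
  ((hasParabolicJet_callHeat.add (h.hasParabolicJet_U₁.const_mul ρ)).add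
    (h.hasParabolicJet_U₂.const_mul (ρ ^ 2))).congr fun τ hτ y => by
      rw [uApprox, h.slice_eq hτ]

/-- Up to `O(ρ³)` the approximation solves the transformed equation: the first two orders cancel,
and the remainder is the second-order Taylor remainder of the Euclidean norm, whose denominator is
absorbed by `exists_mul_halfHeatY_sq_le`. -/
lemma IsCallHeatSolution.exists_residual_le (h : IsCallHeatSolution u₀) (σ : ℝ) {τ₁ : ℝ}
    (hτ₁ : 0 < τ₁) :
    ∃ C ≥ 0, ∀ ρ ≥ 0, ∀ τ ∈ Ioc 0 τ₁, ∀ y,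
      |uApproxT σ ρ u₀ τ y - uApproxYY σ ρ u₀ τ y + 2 / σ ^ 2 * ρ *
        √(uApprox σ ρ u₀ τ y ^ 2 + (uApprox σ ρ u₀ τ y / 2 + uApproxY σ ρ u₀ τ y) ^ 2)|
        ≤ C * ρ ^ 3 * Real.exp (|y| / 2) := by
  obtain ⟨C₁, hC₁, hb₁⟩ := (h.isSmoothSource₂ (σ := σ)).abs_duhamel_le hτ₁
  obtain ⟨C₂, hC₂, hb₂⟩ :=
    (h.isSmoothSource₂ (σ := σ)).isSourceField_deriv.isSingularKernel_heatAvg.abs_timeConv_le hτ₁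
  obtain ⟨C₃, hC₃, hb₃⟩ := exists_mul_halfHeatY_sq_le (τ₁ := τ₁)
  set c := 2 / σ ^ 2 with hc
  have hc0 : 0 ≤ c := by positivity
  refine ⟨c * (2 * (C₁ * τ₁) + C₂ + 26 * c ^ 2 * τ₁ * C₃), by positivity,
    fun ρ hρ τ hτ y => ?_⟩
  have hq := callNorm_pos hτ.1 y
  have hP := halfHeat_pos (1 / 2) hτ.1 y
  have hY := halfHeatY_pos hτ.1 y
  have hV := h.abs_U₁_le (σ := σ) hτ.1 y
  have hV1 := abs_U₁Y_le (σ := σ) hτ.1 y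
  rw [← hc] at hV hV1
  have hW : |U₂ σ u₀ τ y| ≤ C₁ * τ₁ * Real.exp (|y| / 2) := by
    refine (hb₁ τ hτ y).trans ?_
    have := hτ.2
    gcongr
  have hW1 : |U₂Y σ u₀ τ y| ≤ C₂ * Real.exp (|y| / 2) := hb₂ τ hτ y
  have hW2 : |U₂ σ u₀ τ y / 2 + U₂Y σ u₀ τ y|
      ≤ (C₁ * τ₁ + C₂) * Real.exp (|y| / 2) := by
    refine (abs_add_le _ _).trans ?_
    rw [abs_div, abs_two]
    have := abs_nonneg (U₂ σ u₀ τ y)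
    linarith
  have hV2 : |U₁ σ u₀ τ y / 2 + U₁Y σ τ y| ≤ 6 * c * τ * halfHeatY τ y := by
    refine (abs_add_le _ _).trans ?_
    rw [abs_div, abs_two]
    linarith
  have hquad : (U₁ σ u₀ τ y ^ 2 + (U₁ σ u₀ τ y / 2 + U₁Y σ τ y) ^ 2) / (2 * callNorm τ y)
      ≤ 26 * c ^ 2 * τ₁ * C₃ * Real.exp (|y| / 2) := by
    have h1 : U₁ σ u₀ τ y ^ 2 ≤ (4 * c * τ * halfHeatY τ y) ^ 2 := sq_le_sq' (by
      linarith [(abs_le.1 hV).1]) (abs_le.1 hV).2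
    have h2 : (U₁ σ u₀ τ y / 2 + U₁Y σ τ y) ^ 2 ≤ (6 * c * τ * halfHeatY τ y) ^ 2 := sq_le_sq' (by
      linarith [(abs_le.1 hV2).1]) (abs_le.1 hV2).2
    have hqP := halfHeat_le_callNorm τ y
    have h3 := hb₃ τ hτ y
    have hτ2 := hτ.2
    have hτ0 := hτ.1
    calc _ ≤ ((4 * c * τ * halfHeatY τ y) ^ 2 + (6 * c * τ * halfHeatY τ y) ^ 2)
          / (2 * halfHeat (1 / 2) τ y) := by gcongr
      _ = 26 * c ^ 2 * τ * (τ * halfHeatY τ y * (halfHeatY τ y / halfHeat (1 / 2) τ y)) := by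
          field_simp
          ring
      _ ≤ 26 * c ^ 2 * τ₁ * (C₃ * Real.exp (|y| / 2)) := by gcongr
      _ = _ := by ring
  have hexp := abs_sqrt_expansion_le hq (callNorm_sq τ y) (U₁ σ u₀ τ y)
    (U₁ σ u₀ τ y / 2 + U₁Y σ τ y) (U₂ σ u₀ τ y) (U₂ σ u₀ τ y / 2 + U₂Y σ u₀ τ y) ρ
  have e1 : uApprox σ ρ u₀ τ y
      = callHeat τ y + ρ * U₁ σ u₀ τ y + ρ ^ 2 * U₂ σ u₀ τ y := by
    rw [uApprox, h.slice_eq hτ.1]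
  have e2 : uApprox σ ρ u₀ τ y / 2 + uApproxY σ ρ u₀ τ y
      = halfHeat (1 / 2) τ y + ρ * (U₁ σ u₀ τ y / 2 + U₁Y σ τ y)
        + ρ ^ 2 * (U₂ σ u₀ τ y / 2 + U₂Y σ u₀ τ y) := by
    rw [e1, uApproxY]
    ring
  rw [← e1, ← e2] at hexp
  set r := √(uApprox σ ρ u₀ τ y ^ 2 + (uApprox σ ρ u₀ τ y / 2 + uApproxY σ ρ u₀ τ y) ^ 2)
  have e3 : uApproxT σ ρ u₀ τ y - uApproxYY σ ρ u₀ τ y + c * ρ * r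
      = c * ρ * (r - callNorm τ y - ρ * ((callHeat τ y * U₁ σ u₀ τ y
        + halfHeat (1 / 2) τ y * (U₁ σ u₀ τ y / 2 + U₁Y σ τ y)) / callNorm τ y)) := by
    rw [uApproxT, uApproxYY, h.source₁_eq hτ.1, h.source₂_eq hτ.1, callInner]
    ring
  rw [e3, abs_mul, abs_of_nonneg (by positivity : 0 ≤ c * ρ)]
  calc _ ≤ c * ρ * (ρ ^ 2 * (|U₂ σ u₀ τ y| + |U₂ σ u₀ τ y / 2 + U₂Y σ u₀ τ y|
        + (U₁ σ u₀ τ y ^ 2 + (U₁ σ u₀ τ y / 2 + U₁Y σ τ y) ^ 2) / (2 * callNorm τ y))) := by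
        gcongr
    _ ≤ c * ρ * (ρ ^ 2 * (C₁ * τ₁ * Real.exp (|y| / 2) + (C₁ * τ₁ + C₂) * Real.exp (|y| / 2)
        + 26 * c ^ 2 * τ₁ * C₃ * Real.exp (|y| / 2))) := by gcongr
    _ = _ := by ring

lemma duhamel_zero (g : ℝ → ℝ → ℝ) (y : ℝ) : duhamel g 0 y = 0 :=
  intervalIntegral.integral_same

lemma IsSmoothSource.continuousOn_duhamel {g gz : ℝ → ℝ → ℝ} (h : IsSmoothSource g gz) :
    ContinuousOn (fun p : ℝ × ℝ => duhamel g p.1 p.2) (Ici 0 ×ˢ univ) := by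
  rintro ⟨τ, y⟩ ⟨hτ : 0 ≤ τ, -⟩
  rcases hτ.eq_or_lt with rfl | hτ
  · obtain ⟨C, hC, hb⟩ := h.abs_duhamel_le one_pos
    rw [ContinuousWithinAt, duhamel_zero]
    have hlim : Tendsto (fun p : ℝ × ℝ => C * p.1 * Real.exp (|p.2| / 2))
        (𝓝[Ici 0 ×ˢ univ] ((0 : ℝ), y)) (𝓝 0) := by
      refine Tendsto.mono_left ?_ nhdsWithin_le_nhds
      exact Continuous.tendsto' (by fun_prop) _ _ (by simp)
    refine squeeze_zero_norm' ?_ hlim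
    have h1 : ∀ᶠ p : ℝ × ℝ in 𝓝[Ici 0 ×ˢ univ] ((0 : ℝ), y), p.1 < 1 :=
      nhdsWithin_le_nhds (continuousAt_fst.eventually_lt continuousAt_const one_pos)
    filter_upwards [h1, self_mem_nhdsWithin] with p hp1 hp
    rcases (show 0 ≤ p.1 from hp.1).eq_or_lt with h0 | h0
    · rw [← h0, duhamel_zero]
      simp
    · exact hb p.1 ⟨h0, hp1.le⟩ p.2
  · exact (h.hasParabolicJet.cont.continuousAt ((isOpen_Ioi.prod isOpen_univ).mem_nhds
      (show (τ, y) ∈ Ioi (0 : ℝ) ×ˢ univ from ⟨hτ, trivial⟩))).continuousWithinAt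

lemma IsSmoothSource.exists_abs_duhamel_le {g gz : ℝ → ℝ → ℝ} (h : IsSmoothSource g gz) {τ₁ : ℝ}
    (hτ₁ : 0 < τ₁) : ∃ C ≥ 0, ∀ τ ∈ Icc 0 τ₁, ∀ y, |duhamel g τ y| ≤ C * Real.exp (|y| / 2) := by
  obtain ⟨C, hC, hb⟩ := h.abs_duhamel_le hτ₁
  refine ⟨C * τ₁, by positivity, fun τ hτ y => ?_⟩
  rcases hτ.1.eq_or_lt with rfl | h0
  · rw [duhamel_zero, abs_zero]
    positivity
  · refine (hb τ ⟨h0, hτ.2⟩ y).trans ?_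
    have := hτ.2
    gcongr

lemma IsCallHeatSolution.continuousOn_uApprox (h : IsCallHeatSolution u₀) (σ ρ : ℝ) :
    ContinuousOn (fun p : ℝ × ℝ => uApprox σ ρ u₀ p.1 p.2) (Ici 0 ×ˢ univ) :=
  (h.cont.add (continuousOn_const.mul (h.isSmoothSource₁ (σ := σ)).continuousOn_duhamel)).add
    (continuousOn_const.mul (h.isSmoothSource₂ (σ := σ)).continuousOn_duhamel)

lemma IsCallHeatSolution.exists_abs_uApprox_le (h : IsCallHeatSolution u₀) (σ ρ : ℝ) {τ₁ : ℝ}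
    (hτ₁ : 0 < τ₁) :
    ∃ C ≥ 0, ∀ τ ∈ Icc 0 τ₁, ∀ y, |uApprox σ ρ u₀ τ y| ≤ C * Real.exp (|y| / 2) := by
  obtain ⟨C₁, hC₁, hb₁⟩ := (h.isSmoothSource₁ (σ := σ)).exists_abs_duhamel_le hτ₁
  obtain ⟨C₂, hC₂, hb₂⟩ := (h.isSmoothSource₂ (σ := σ)).exists_abs_duhamel_le hτ₁
  have hJ := gaussConst_nonneg τ₁
  refine ⟨1 * gaussConst τ₁ + |ρ| * C₁ + ρ ^ 2 * C₂, by positivity, fun τ hτ y => ?_⟩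
  have h0 : |u₀ τ y| ≤ 1 * gaussConst τ₁ * Real.exp (|y| / 2) := by
    rw [h.eq_callHeat hτ.1]
    exact abs_heatAvg_le abs_payoff_le hτ.2 y
  have h1 : |ρ * U₁ σ u₀ τ y| ≤ |ρ| * (C₁ * Real.exp (|y| / 2)) := by
    rw [abs_mul]
    exact mul_le_mul_of_nonneg_left (hb₁ τ hτ y) (abs_nonneg ρ)
  have h2 : |ρ ^ 2 * U₂ σ u₀ τ y| ≤ ρ ^ 2 * (C₂ * Real.exp (|y| / 2)) := by
    rw [abs_mul, abs_of_nonneg (sq_nonneg ρ)]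
    exact mul_le_mul_of_nonneg_left (hb₂ τ hτ y) (sq_nonneg ρ)
  rw [uApprox]
  refine (abs_add_le _ _).trans ((add_le_add_left (abs_add_le _ _) _).trans ?_)
  linarith

end Approx

/-! ### Transformation to the price variables -/

section Transform

variable {σ K T : ℝ} {w wt wy wyy : ℝ → ℝ → ℝ}

/-- The prefactor `K e^{y/2 - τ/4}` of the transformation, in the price variables. -/
noncomputable def priceFactor (σ K T t x : ℝ) : ℝ :=
  K * Real.exp (1 / 2 * Real.log (x / K) - 1 / 8 * σ ^ 2 * (T - t))

/-- The function of `(t, x)` that corresponds to `w (τ, y)`. -/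
noncomputable def priceOf (σ K T : ℝ) (w : ℝ → ℝ → ℝ) (t x : ℝ) : ℝ :=
  priceFactor σ K T t x * w (1 / 2 * σ ^ 2 * (T - t)) (Real.log (x / K))

lemma callApprox_eq (σ ρ K T : ℝ) (u₀ : ℝ → ℝ → ℝ) :
    callApprox σ ρ K T u₀ = priceOf σ K T (uApprox σ ρ u₀) := rfl

lemma priceFactor_pos (hK : 0 < K) (t x : ℝ) : 0 < priceFactor σ K T t x := by
  unfold priceFactor
  positivity

lemma hasDerivAt_log_div (hK : 0 < K) {x : ℝ} (hx : 0 < x) :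
    HasDerivAt (fun x => Real.log (x / K)) x⁻¹ x := by
  refine (((hasDerivAt_id x).div_const K).log (by simpa using ⟨hx.ne', hK.ne'⟩)).congr_deriv ?_
  simp only [id]
  field_simp

lemma hasDerivAt_priceFactor_fst (t x : ℝ) :
    HasDerivAt (fun t => priceFactor σ K T t x) (σ ^ 2 / 8 * priceFactor σ K T t x) t := by
  have h1 : HasDerivAt (fun t : ℝ => 1 / 2 * Real.log (x / K) - 1 / 8 * σ ^ 2 * (T - t))
      (σ ^ 2 / 8) t := by
    refine ((((hasDerivAt_id t).const_sub T).const_mul (1 / 8 * σ ^ 2)).const_sub _).congr_deriv ?_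
    ring
  refine (h1.exp.const_mul K).congr_deriv ?_
  rw [priceFactor]
  ring

lemma hasDerivAt_priceFactor_snd (hK : 0 < K) (t : ℝ) {x : ℝ} (hx : 0 < x) :
    HasDerivAt (priceFactor σ K T t) (priceFactor σ K T t x / (2 * x)) x := by
  have h1 := ((hasDerivAt_log_div hK hx).const_mul (1 / 2)).sub_const (1 / 8 * σ ^ 2 * (T - t))
  refine (h1.exp.const_mul K).congr_deriv ?_
  rw [priceFactor]
  field_simp

/-- The `x`-derivative of `priceOf σ K T w`, where `wy` is the spatial derivative of `w`. -/
noncomputable def priceOfX (σ K T : ℝ) (w wy : ℝ → ℝ → ℝ) (t x : ℝ) : ℝ :=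
  priceOf σ K T (fun τ y => w τ y / 2 + wy τ y) t x / x

lemma heatTime_pos (hσ : 0 < σ) {t : ℝ} (ht : t < T) : 0 < 1 / 2 * σ ^ 2 * (T - t) :=
  mul_pos (by positivity) (sub_pos.2 ht)

lemma HasParabolicJet.hasDerivAt_priceOf_fst (h : HasParabolicJet w wt wy wyy) (hσ : 0 < σ)
    {t : ℝ} (ht : t < T) (x : ℝ) :
    HasDerivAt (fun t => priceOf σ K T w t x)
      (priceOf σ K T (fun τ y => σ ^ 2 / 8 * w τ y - σ ^ 2 / 2 * wt τ y) t x) t := by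
  have h1 : HasDerivAt (fun t : ℝ => 1 / 2 * σ ^ 2 * (T - t)) (-(σ ^ 2 / 2)) t := by
    refine (((hasDerivAt_id t).const_sub T).const_mul (1 / 2 * σ ^ 2)).congr_deriv ?_
    ring
  refine ((hasDerivAt_priceFactor_fst t x).mul
    ((h.dt _ (heatTime_pos hσ ht) (Real.log (x / K))).comp t h1)).congr_deriv ?_
  rw [priceOf]
  simp only [Function.comp_def]
  ring

lemma HasParabolicJet.hasDerivAt_priceOf_snd (h : HasParabolicJet w wt wy wyy) (hσ : 0 < σ)
    (hK : 0 < K) {t : ℝ} (ht : t < T) {x : ℝ} (hx : 0 < x) :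
    HasDerivAt (priceOf σ K T w t) (priceOfX σ K T w wy t x) x := by
  refine ((hasDerivAt_priceFactor_snd hK t hx).mul
    ((h.dy _ (heatTime_pos hσ ht) _).comp x (hasDerivAt_log_div hK hx))).congr_deriv ?_
  rw [priceOfX, priceOf]
  simp only [Function.comp_def]
  field_simp

lemma HasParabolicJet.hasDerivAt_priceOfX (h : HasParabolicJet w wt wy wyy) (hσ : 0 < σ)
    (hK : 0 < K) {t : ℝ} (ht : t < T) {x : ℝ} (hx : 0 < x) :
    HasDerivAt (priceOfX σ K T w wy t)
      (priceOf σ K T (fun τ y => wyy τ y - w τ y / 4) t x / x ^ 2) x := by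
  have hτ := heatTime_pos (T := T) hσ ht
  have h1 : HasDerivAt (fun y => w (1 / 2 * σ ^ 2 * (T - t)) y / 2
      + wy (1 / 2 * σ ^ 2 * (T - t)) y) _ (Real.log (x / K)) :=
    ((h.dy _ hτ _).div_const 2).add (h.dyy _ hτ _)
  refine (((hasDerivAt_priceFactor_snd hK t hx).mul
    (h1.comp x (hasDerivAt_log_div hK hx))).div (hasDerivAt_id x) hx.ne').congr_deriv ?_
  simp only [Function.comp_def, priceOf, id, Pi.mul_apply]
  field_simp
  ring

lemma HasParabolicJet.deriv_priceOf_eventuallyEq (h : HasParabolicJet w wt wy wyy) (hσ : 0 < σ)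
    (hK : 0 < K) {t : ℝ} (ht : t < T) {x : ℝ} (hx : 0 < x) :
    deriv (priceOf σ K T w t) =ᶠ[𝓝 x] priceOfX σ K T w wy t :=
  eventually_of_mem (Ioi_mem_nhds hx) fun _ hz => (h.hasDerivAt_priceOf_snd hσ hK ht hz).deriv

lemma continuousOn_priceOf {S : Set ℝ} {v : ℝ → ℝ → ℝ} (hK : 0 < K) {I : Set ℝ}
    (hv : ContinuousOn (fun p : ℝ × ℝ => v p.1 p.2) (S ×ˢ univ))
    (hI : ∀ t ∈ I, 1 / 2 * σ ^ 2 * (T - t) ∈ S) :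
    ContinuousOn (fun p : ℝ × ℝ => priceOf σ K T v p.1 p.2) (I ×ˢ Ioi 0) := by
  have hlog : ContinuousOn (fun p : ℝ × ℝ => Real.log (p.2 / K)) (I ×ˢ Ioi 0) :=
    (continuousOn_snd.div_const K).log fun p hp =>
      (div_pos (show 0 < p.2 from hp.2) hK).ne'
  have hf : ContinuousOn (fun p : ℝ × ℝ => priceFactor σ K T p.1 p.2) (I ×ˢ Ioi 0) := by
    unfold priceFactor
    fun_prop
  refine hf.mul (hv.comp (f := fun p : ℝ × ℝ => (1 / 2 * σ ^ 2 * (T - p.1), Real.log (p.2 / K))) ?_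
    fun p hp => ⟨hI p.1 hp.1, trivial⟩)
  exact (by fun_prop : Continuous fun p : ℝ × ℝ => 1 / 2 * σ ^ 2 * (T - p.1)).continuousOn.prodMk
    hlog

lemma HasParabolicJet.isC12On_priceOf (h : HasParabolicJet w wt wy wyy) (hσ : 0 < σ) (hK : 0 < K) :
    IsC12On (priceOf σ K T w) (Ioo 0 T ×ˢ Ioi 0) where
  diff_fst := fun p hp => (h.hasDerivAt_priceOf_fst hσ hp.1.2 p.2).differentiableAt
  diff_snd := fun p hp => (h.hasDerivAt_priceOf_snd hσ hK hp.1.2 hp.2).differentiableAt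
  diff_snd_snd := fun p hp =>
    ((h.hasDerivAt_priceOfX hσ hK hp.1.2 hp.2).congr_of_eventuallyEq
      (h.deriv_priceOf_eventuallyEq hσ hK hp.1.2 hp.2)).differentiableAt
  cont_fst := by
    refine (continuousOn_priceOf (S := Ioi 0) hK ?_ fun t ht => heatTime_pos hσ ht.2).congr
      fun p hp => (h.hasDerivAt_priceOf_fst hσ hp.1.2 p.2).deriv
    exact (continuousOn_const.mul h.cont).sub (continuousOn_const.mul h.cont_t)
  cont_snd := by
    refine ((continuousOn_priceOf (S := Ioi 0) hK ?_ fun t ht => heatTime_pos hσ ht.2).div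
      continuousOn_snd fun p hp => ne_of_gt hp.2).congr
      fun p hp => (h.hasDerivAt_priceOf_snd hσ hK hp.1.2 hp.2).deriv
    exact (h.cont.div_const 2).add h.cont_y
  cont_snd_snd := by
    refine ((continuousOn_priceOf (S := Ioi 0) hK ?_ fun t ht => heatTime_pos hσ ht.2).div
      (continuousOn_snd.pow 2) fun p hp => pow_ne_zero 2 (ne_of_gt hp.2)).congr
      fun p hp => ((h.hasDerivAt_priceOfX hσ hK hp.1.2 hp.2).congr_of_eventuallyEq
        (h.deriv_priceOf_eventuallyEq hσ hK hp.1.2 hp.2)).deriv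
    exact h.cont_yy.sub (h.cont.div_const 4)

/-- The Black-Scholes operator becomes the heat operator. -/
lemma priceOf_operator (σ K T : ℝ) (w wt wyy : ℝ → ℝ → ℝ) (t : ℝ) {x : ℝ} (hx : 0 < x) :
    priceOf σ K T (fun τ y => σ ^ 2 / 8 * w τ y - σ ^ 2 / 2 * wt τ y) t x
      + σ ^ 2 / 2 * x ^ 2 * (priceOf σ K T (fun τ y => wyy τ y - w τ y / 4) t x / x ^ 2)
      = -(σ ^ 2 / 2) * priceOf σ K T (fun τ y => wt τ y - wyy τ y) t x := by
  simp only [priceOf]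
  field_simp
  ring

/-- The nonlinear term in the price variables. -/
lemma sqrt_priceOf (hK : 0 < K) (w wy : ℝ → ℝ → ℝ) (t : ℝ) {x : ℝ} (hx : 0 < x) :
    √(priceOf σ K T w t x ^ 2 + (x * priceOfX σ K T w wy t x) ^ 2)
      = priceOf σ K T (fun τ y => √(w τ y ^ 2 + (w τ y / 2 + wy τ y) ^ 2)) t x := by
  have h1 : x * priceOfX σ K T w wy t x
      = priceOf σ K T (fun τ y => w τ y / 2 + wy τ y) t x := by
    rw [priceOfX]
    field_simp
  have h2 := priceFactor_pos (σ := σ) (T := T) hK t x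
  rw [h1]
  simp only [priceOf]
  rw [mul_pow, mul_pow, ← mul_add, Real.sqrt_mul (sq_nonneg _), Real.sqrt_sq h2.le]

lemma priceFactor_mul_exp_le (hK : 0 < K) {t : ℝ} (ht : t ≤ T) {x : ℝ} (hx : 0 < x) :
    priceFactor σ K T t x * Real.exp (|Real.log (x / K)| / 2) ≤ (1 + K) * (1 + x) := by
  have h1 : Real.exp (1 / 2 * Real.log (x / K) - 1 / 8 * σ ^ 2 * (T - t))
      ≤ Real.exp (Real.log (x / K) / 2) := by
    rw [Real.exp_le_exp]
    have : 0 ≤ 1 / 8 * σ ^ 2 * (T - t) := mul_nonneg (by positivity) (sub_nonneg.2 ht)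
    linarith
  have h2 : Real.exp (Real.log (x / K) / 2) * Real.exp (|Real.log (x / K)| / 2) ≤ x / K + 1 := by
    rw [← Real.exp_add]
    have hxK : 0 < x / K := div_pos hx hK
    rcases abs_choice (Real.log (x / K)) with h | h
    · rw [h, add_halves, Real.exp_log hxK]
      linarith
    · rw [h, show Real.log (x / K) / 2 + -Real.log (x / K) / 2 = 0 by ring, Real.exp_zero]
      linarith
  calc _ ≤ K * Real.exp (Real.log (x / K) / 2) * Real.exp (|Real.log (x / K)| / 2) := by
        rw [priceFactor]
        gcongr
    _ = K * (Real.exp (Real.log (x / K) / 2) * Real.exp (|Real.log (x / K)| / 2)) := by ring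
    _ ≤ K * (x / K + 1) := by gcongr
    _ = x + K := by field_simp
    _ ≤ _ := by nlinarith

lemma abs_priceOf_le (hK : 0 < K) {v : ℝ → ℝ → ℝ} {C t x : ℝ} (ht : t ≤ T) (hx : 0 < x)
    (hC : 0 ≤ C) (hv : |v (1 / 2 * σ ^ 2 * (T - t)) (Real.log (x / K))|
      ≤ C * Real.exp (|Real.log (x / K)| / 2)) :
    |priceOf σ K T v t x| ≤ C * ((1 + K) * (1 + x)) := by
  have h2 := priceFactor_pos (σ := σ) (T := T) hK t x
  rw [priceOf, abs_mul, abs_of_pos h2]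
  calc _ ≤ priceFactor σ K T t x * (C * Real.exp (|Real.log (x / K)| / 2)) := by gcongr
    _ = C * (priceFactor σ K T t x * Real.exp (|Real.log (x / K)| / 2)) := by ring
    _ ≤ _ := mul_le_mul_of_nonneg_left (priceFactor_mul_exp_le hK ht hx) hC

end Transform

/-! ### The modified Black-Scholes equation -/

lemma modifiedBSDefect_of_pos {σ ρ : ℝ} {Φ : ℝ → ℝ → ℝ} {t x : ℝ} (h : 0 < Φ t x) :
    modifiedBSDefect σ ρ Φ t x = deriv (fun t' => Φ t' x) t
      + σ ^ 2 / 2 * x ^ 2 * deriv (deriv (Φ t)) x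
      - ρ * √(Φ t x ^ 2 + (x * deriv (Φ t) x) ^ 2) := by
  rw [modifiedBSDefect, mul_assoc ρ]
  congr 2
  rw [← Real.sqrt_sq h.le, ← Real.sqrt_mul (sq_nonneg _), Real.sqrt_sq h.le]
  congr 1
  field_simp

/-- A solution has no zeros on a connected set, and its terminal values are not all zero. -/
lemma IsModifiedBSCall.pos {σ ρ K T : ℝ} {Φ : ℝ → ℝ → ℝ} (h : IsModifiedBSCall σ ρ K T Φ)
    (hK : 0 < K) (hT : 0 < T) {t x : ℝ} (ht : t ∈ Ioo 0 T) (hx : 0 < x) : 0 < Φ t x := by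
  have h2K : (0 : ℝ) < 2 * K := by positivity
  obtain ⟨t₁, ht₁, hpos⟩ : ∃ t₁ ∈ Ioo 0 T, 0 < Φ t₁ (2 * K) := by
    have hc : ContinuousWithinAt (fun s => Φ s (2 * K)) (Ioo 0 T) T :=
      ((h.cont.comp (f := fun s : ℝ => (s, 2 * K)) (by fun_prop) fun s hs => ⟨hs, h2K⟩) T
        ⟨hT.le, le_rfl⟩).mono Ioo_subset_Icc_self
    have hTpos : 0 < Φ T (2 * K) := by
      rw [h.terminal _ h2K]
      exact lt_max_of_lt_left (by linarith)
    have hev := (hc.eventually_const_lt hTpos).and self_mem_nhdsWithin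
    have hne : (𝓝[Ioo 0 T] T).NeBot := by
      rw [nhdsWithin_Ioo_eq_nhdsLT hT]
      infer_instance
    obtain ⟨s, hs1, hs2⟩ := hev.exists
    exact ⟨s, hs2, hs1⟩
  by_contra! hle
  have hconn : IsPreconnected (Ioo 0 T ×ˢ Ioi (0 : ℝ)) := isPreconnected_Ioo.prod isPreconnected_Ioi
  obtain ⟨p, hp, hp0⟩ := hconn.intermediate_value (a := (t, x)) (b := (t₁, 2 * K)) ⟨ht, hx⟩
    ⟨ht₁, h2K⟩ (h.cont.mono (prod_mono Ioo_subset_Icc_self le_rfl)) ⟨hle, hpos.le⟩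
  exact h.ne_zero p.1 hp.1 p.2 hp.2 hp0

lemma pow_le_pow_add_inv {k n : ℕ} (h : k ≤ n) {x : ℝ} (hx : 0 < x) :
    x ^ k ≤ x ^ n + (x ^ n)⁻¹ := by
  have h1 : 0 < x ^ n := by positivity
  have h2 : 0 < (x ^ n)⁻¹ := by positivity
  rcases le_total 1 x with hx1 | hx1
  · have := pow_le_pow_right₀ hx1 h
    linarith
  · have h3 : x ^ k ≤ 1 := pow_le_one₀ hx.le hx1
    have h4 : 1 ≤ (x ^ n)⁻¹ := (one_le_inv₀ h1).2 (pow_le_one₀ hx.le hx1)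
    linarith

section Final

variable {σ K T : ℝ} {u₀ : ℝ → ℝ → ℝ}

/-- The value of the differential operator on the approximation, with the nonlinearity in the form
that does not presuppose positivity. -/
noncomputable def approxResidual (σ ρ K T : ℝ) (u₀ : ℝ → ℝ → ℝ) (t x : ℝ) : ℝ :=
  priceOf σ K T (fun τ y => -(σ ^ 2 / 2) * (uApproxT σ ρ u₀ τ y - uApproxYY σ ρ u₀ τ y
    + 2 / σ ^ 2 * ρ * √(uApprox σ ρ u₀ τ y ^ 2
      + (uApprox σ ρ u₀ τ y / 2 + uApproxY σ ρ u₀ τ y) ^ 2))) t x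

lemma operator_callApprox (hσ : 0 < σ) (hK : 0 < K) (ρ t : ℝ) {x : ℝ} (hx : 0 < x) :
    priceOf σ K T (fun τ y => σ ^ 2 / 8 * uApprox σ ρ u₀ τ y - σ ^ 2 / 2 * uApproxT σ ρ u₀ τ y) t x
      + σ ^ 2 / 2 * x ^ 2
        * (priceOf σ K T (fun τ y => uApproxYY σ ρ u₀ τ y - uApprox σ ρ u₀ τ y / 4) t x / x ^ 2)
      = ρ * √(callApprox σ ρ K T u₀ t x ^ 2
          + (x * priceOfX σ K T (uApprox σ ρ u₀) (uApproxY σ ρ u₀) t x) ^ 2)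
        + approxResidual σ ρ K T u₀ t x := by
  rw [priceOf_operator _ _ _ _ _ _ _ hx, callApprox_eq, sqrt_priceOf hK _ _ _ hx, approxResidual]
  simp only [priceOf]
  field_simp
  ring

lemma IsCallHeatSolution.exists_abs_approxResidual_le (h : IsCallHeatSolution u₀) (hσ : 0 < σ)
    (hK : 0 < K) (hT : 0 < T) :
    ∃ C ≥ 0, ∀ ρ ≥ 0, ∀ t ∈ Ioo 0 T, ∀ x > 0,
      |approxResidual σ ρ K T u₀ t x| ≤ C * ρ ^ 3 * (1 + x) := by
  obtain ⟨C, hC, hb⟩ := h.exists_residual_le σ (heatTime_pos hσ hT)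
  refine ⟨σ ^ 2 / 2 * C * (1 + K), by positivity, fun ρ hρ t ht x hx => ?_⟩
  have hmem : 1 / 2 * σ ^ 2 * (T - t) ∈ Ioc 0 (1 / 2 * σ ^ 2 * (T - 0)) := by
    refine ⟨heatTime_pos hσ ht.2, ?_⟩
    have := ht.1
    gcongr
  have h1 := hb ρ hρ _ hmem (Real.log (x / K))
  have hσ2 : 0 ≤ σ ^ 2 / 2 := by positivity
  have h2 := mul_le_mul_of_nonneg_left h1 hσ2
  rw [← abs_of_nonneg hσ2, ← abs_neg (σ ^ 2 / 2), ← abs_mul, abs_neg, abs_of_nonneg hσ2,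
    ← mul_assoc] at h2
  exact (abs_priceOf_le hK ht.2.le hx (mul_nonneg hσ2 (by positivity)) h2).trans
    (le_of_eq (by ring))

lemma IsCallHeatSolution.callApprox_terminal (h : IsCallHeatSolution u₀) (hK : 0 < K) (ρ : ℝ)
    {x : ℝ} (hx : 0 < x) : callApprox σ ρ K T u₀ T x = max (x - K) 0 := by
  have hU1 : ∀ y, U₁ σ u₀ 0 y = 0 := fun y => duhamel_zero _ y
  have hU2 : ∀ y, U₂ σ u₀ 0 y = 0 := fun y => duhamel_zero _ y
  have hxK : 0 < x / K := div_pos hx hK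
  rw [callApprox, uApprox, sub_self, mul_zero, mul_zero, hU1, hU2, h.initial, mul_zero, mul_zero,
    add_zero, add_zero, sub_zero, mul_max_of_nonneg _ _ (by positivity), mul_zero, mul_sub,
    mul_assoc, mul_assoc, ← Real.exp_add, ← Real.exp_add]
  rw [show 1 / 2 * Real.log (x / K) + Real.log (x / K) / 2 = Real.log (x / K) by ring,
    show 1 / 2 * Real.log (x / K) + -(Real.log (x / K) / 2) = 0 by ring, Real.exp_log hxK,
    Real.exp_zero, mul_one, mul_div_cancel₀ _ hK.ne']

lemma IsCallHeatSolution.isBigO_defect (h : IsCallHeatSolution u₀) (hσ : 0 < σ) (hK : 0 < K)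
    {t : ℝ} (ht : t ∈ Ioo 0 T) {x : ℝ} (hx : 0 < x) :
    (fun ρ : ℝ => modifiedBSDefect σ ρ (callApprox σ ρ K T u₀) t x)
      =O[𝓝[>] 0] (fun ρ : ℝ => ρ ^ 3) := by
  obtain ⟨C, hC, hb⟩ := h.exists_abs_approxResidual_le hσ hK (ht.1.trans ht.2)
  have hτ := heatTime_pos (T := T) hσ ht.2
  have hpos : ∀ᶠ ρ in 𝓝[>] (0 : ℝ), 0 < callApprox σ ρ K T u₀ t x := by
    refine nhdsWithin_le_nhds ?_
    have hc : Continuous fun ρ => callApprox σ ρ K T u₀ t x := by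
      unfold callApprox uApprox
      fun_prop
    refine hc.continuousAt.eventually_const_lt ?_
    refine mul_pos (by positivity) ?_
    rw [uApprox, h.slice_eq hτ]
    simpa using callHeat_pos hτ _
  refine IsBigO.of_bound (C * (1 + x)) ?_
  filter_upwards [hpos, self_mem_nhdsWithin] with ρ hρpos hρ
  have hρ : 0 < ρ := hρ
  have hj := h.hasParabolicJet_uApprox σ ρ
  have hop := operator_callApprox (T := T) (u₀ := u₀) hσ hK ρ t hx
  have e : modifiedBSDefect σ ρ (callApprox σ ρ K T u₀) t x = approxResidual σ ρ K T u₀ t x := by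
    rw [modifiedBSDefect_of_pos hρpos]
    rw [callApprox_eq] at hop ⊢
    rw [(hj.hasDerivAt_priceOf_fst hσ ht.2 x).deriv,
      ((hj.hasDerivAt_priceOfX hσ hK ht.2 hx).congr_of_eventuallyEq
        (hj.deriv_priceOf_eventuallyEq hσ hK ht.2 hx)).deriv,
      (hj.hasDerivAt_priceOf_snd hσ hK ht.2 hx).deriv, hop, add_sub_cancel_left]
  rw [e, Real.norm_eq_abs, Real.norm_of_nonneg (by positivity)]
  exact (hb ρ hρ.le t ht x hx).trans (le_of_eq (by ring))

lemma IsCallHeatSolution.exists_abs_sub_callApprox_le (h : IsCallHeatSolution u₀) (hσ : 0 < σ)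
    (hK : 0 < K) (hT : 0 < T) :
    ∃ C : ℝ, ∀ ρ ∈ Ioo (0 : ℝ) 1, ∀ Φ, IsModifiedBSCall σ ρ K T Φ →
      ∀ t ∈ Icc 0 T, ∀ x > 0, |Φ t x - callApprox σ ρ K T u₀ t x| ≤ C * ρ ^ 3 * (1 + x) := by
  obtain ⟨C, hC, hb⟩ := h.exists_abs_approxResidual_le hσ hK hT
  refine ⟨C * Real.exp ((2 * 1 + 1) * T), fun ρ hρ Φ hΦ t ht x hx => ?_⟩
  have hρ0 := hρ.1
  have hj := h.hasParabolicJet_uApprox σ ρ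
  obtain ⟨A, m, hA⟩ := hΦ.growth
  obtain ⟨B, hB, hBb⟩ := h.exists_abs_uApprox_le σ ρ (heatTime_pos hσ hT)
  have hmem : ∀ t ∈ Icc 0 T, 1 / 2 * σ ^ 2 * (T - t) ∈ Icc 0 (1 / 2 * σ ^ 2 * (T - 0)) := by
    intro t ht
    have := ht.1
    refine ⟨mul_nonneg (by positivity) (sub_nonneg.2 ht.2), ?_⟩
    gcongr
  have key := abs_le_of_parabolic_inequality (κ := σ ^ 2 / 2) (L := 1) (M := C * ρ ^ 3) (T := T)
    (A := 2 * |A| + 2 * (B * (1 + K))) (m := m + 1)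
    (D := fun t x => Φ t x - priceOf σ K T (uApprox σ ρ u₀) t x)
    (Dt := fun t x => deriv (fun t => Φ t x) t - priceOf σ K T
      (fun τ y => σ ^ 2 / 8 * uApprox σ ρ u₀ τ y - σ ^ 2 / 2 * uApproxT σ ρ u₀ τ y) t x)
    (Dx := fun t x => deriv (Φ t) x - priceOfX σ K T (uApprox σ ρ u₀) (uApproxY σ ρ u₀) t x)
    (Dxx := fun t x => deriv (deriv (Φ t)) x - priceOf σ K T
      (fun τ y => uApproxYY σ ρ u₀ τ y - uApprox σ ρ u₀ τ y / 4) t x / x ^ 2)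
    (by positivity) zero_le_one (by positivity) hT ?_
    (fun t ht x hx => (hΦ.c12.diff_fst (t, x) ⟨ht, hx⟩).hasDerivAt.sub
      (hj.hasDerivAt_priceOf_fst hσ ht.2 x))
    (fun t ht x hx => (hΦ.c12.diff_snd (t, x) ⟨ht, hx⟩).hasDerivAt.sub
      (hj.hasDerivAt_priceOf_snd hσ hK ht.2 hx))
    (fun t ht x hx => (hΦ.c12.diff_snd_snd (t, x) ⟨ht, hx⟩).hasDerivAt.sub
      (hj.hasDerivAt_priceOfX hσ hK ht.2 hx)) ?_ ?_ ?_ ht hx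
  · rw [callApprox_eq]
    refine key.trans (le_of_eq (by ring))
  · exact hΦ.cont.sub (continuousOn_priceOf hK (h.continuousOn_uApprox σ ρ)
      fun t ht => (hmem t ht).1)
  · intro t ht x hx
    have hpde := hΦ.pde t ht x hx
    rw [modifiedBSDefect_of_pos (hΦ.pos hK hT ht hx), sub_eq_zero] at hpde
    have hop := operator_callApprox (T := T) (u₀ := u₀) hσ hK ρ t hx
    rw [callApprox_eq] at hop
    have hlip := abs_sqrt_sub_sqrt_le (Φ t x) (x * deriv (Φ t) x)
      (priceOf σ K T (uApprox σ ρ u₀) t x)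
      (x * priceOfX σ K T (uApprox σ ρ u₀) (uApproxY σ ρ u₀) t x)
    rw [← mul_sub] at hlip
    have hres := hb ρ hρ0.le t ht x hx
    set r₁ := √(Φ t x ^ 2 + (x * deriv (Φ t) x) ^ 2)
    set r₂ := √(priceOf σ K T (uApprox σ ρ u₀) t x ^ 2
      + (x * priceOfX σ K T (uApprox σ ρ u₀) (uApproxY σ ρ u₀) t x) ^ 2)
    have e : (deriv (fun t => Φ t x) t - priceOf σ K T
        (fun τ y => σ ^ 2 / 8 * uApprox σ ρ u₀ τ y - σ ^ 2 / 2 * uApproxT σ ρ u₀ τ y) t x)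
        + σ ^ 2 / 2 * x ^ 2 * (deriv (deriv (Φ t)) x - priceOf σ K T
          (fun τ y => uApproxYY σ ρ u₀ τ y - uApprox σ ρ u₀ τ y / 4) t x / x ^ 2)
        = ρ * (r₁ - r₂) - approxResidual σ ρ K T u₀ t x := by
      linear_combination hpde - hop
    rw [e]
    refine (abs_sub _ _).trans (add_le_add ?_ hres)
    rw [abs_mul, abs_of_pos hρ0]
    exact mul_le_mul hρ.2.le hlip (abs_nonneg _) zero_le_one
  · intro x hx
    have := h.callApprox_terminal (σ := σ) (T := T) hK ρ hx
    rw [callApprox_eq] at this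
    rw [hΦ.terminal x hx, this, sub_self]
  · intro t ht x hx
    have h1 := hA t ht x hx
    have h2 := abs_priceOf_le (v := uApprox σ ρ u₀) hK ht.2 hx hB (hBb _ (hmem t ht) _)
    have h3 := pow_le_pow_add_inv (Nat.zero_le (m + 1)) hx
    have h4 := pow_le_pow_add_inv (Nat.le_succ m) hx
    have h5 := pow_le_pow_add_inv (show 1 ≤ m + 1 by omega) hx
    rw [pow_zero] at h3
    rw [pow_one] at h5
    set X := x ^ (m + 1) + (x ^ (m + 1))⁻¹
    have h6 : A * (1 + x ^ m) ≤ |A| * (X + X) :=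
      mul_le_mul (le_abs_self A) (add_le_add h3 h4) (by positivity) (abs_nonneg A)
    have h7 : B * ((1 + K) * (1 + x)) ≤ B * ((1 + K) * (X + X)) := by gcongr
    refine (abs_sub _ _).trans ?_
    linarith

end Final

lemma IsCallHeatSolution.differentiableAt_bsNonlin {σ : ℝ} {u₀ : ℝ → ℝ → ℝ}
    (h : IsCallHeatSolution u₀) {τ : ℝ} (hτ : 0 < τ) (y : ℝ) :
    DifferentiableAt ℝ (fun v : ℝ × ℝ => bsNonlin σ v.1 v.2) (u₀ τ y, deriv (u₀ τ) y) := by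
  simp only [bsNonlin_eq]
  refine DifferentiableAt.const_mul (DifferentiableAt.sqrt (by fun_prop) ?_) _
  have h1 := callHeat_pos hτ y
  rw [← h.slice_eq hτ] at h1
  positivity

theorem mainTheorem9 (σ K T : ℝ) (hσ : 0 < σ) (hK : 0 < K) (hT : 0 < T) :
    (∃ u₀, IsCallHeatSolution u₀) ∧
    ∀ u₀, IsCallHeatSolution u₀ →
      -- the formulas for `U₁` and `U₂` are meaningful
      (∀ τ > 0, ∀ y,
        DifferentiableAt ℝ (fun v : ℝ × ℝ => bsNonlin σ v.1 v.2) (u₀ τ y, deriv (u₀ τ) y) ∧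
        DifferentiableAt ℝ (U₁ σ u₀ τ) y ∧
        IntegrableOn (fun p : ℝ × ℝ => heatG τ y p.1 p.2 * source₁ σ u₀ p.1 p.2)
          (Ioo 0 τ ×ˢ univ) ∧
        IntegrableOn (fun p : ℝ × ℝ => heatG τ y p.1 p.2 * source₂ σ u₀ p.1 p.2)
          (Ioo 0 τ ×ˢ univ)) ∧
      -- the approximation has the right terminal value and solves the equation up to `O(ρ³)`
      (∀ ρ > 0, IsC12On (callApprox σ ρ K T u₀) (Ioo 0 T ×ˢ Ioi 0) ∧
        ∀ x > 0, callApprox σ ρ K T u₀ T x = max (x - K) 0) ∧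
      (∀ t ∈ Ioo 0 T, ∀ x > 0,
        (fun ρ : ℝ => modifiedBSDefect σ ρ (callApprox σ ρ K T u₀) t x)
          =O[𝓝[>] 0] (fun ρ : ℝ => ρ ^ 3)) ∧
      -- it agrees with the solution up to `O(ρ³)`
      ∃ ρ₀ > 0, ∃ C : ℝ, ∀ ρ ∈ Ioo 0 ρ₀, ∀ Φ, IsModifiedBSCall σ ρ K T Φ →
        ∀ t ∈ Icc 0 T, ∀ x > 0,
          |Φ t x - callApprox σ ρ K T u₀ t x| ≤ C * ρ ^ 3 * (1 + x) :=
  ⟨⟨callHeat, isCallHeatSolution_callHeat⟩, fun _ h =>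
    ⟨fun τ hτ y => ⟨h.differentiableAt_bsNonlin hτ y,
        (h.hasParabolicJet_U₁.dy τ hτ y).differentiableAt,
        h.isSmoothSource₁.isSourceField.integrableOn_heatG_mul hτ y,
        h.isSmoothSource₂.isSourceField.integrableOn_heatG_mul hτ y⟩,
      fun ρ _ => ⟨(h.hasParabolicJet_uApprox σ ρ).isC12On_priceOf hσ hK,
        fun _ hx => h.callApprox_terminal hK ρ hx⟩,
      fun _ ht _ hx => h.isBigO_defect hσ hK ht hx,
      1, one_pos, h.exists_abs_sub_callApprox_le hσ hK hT⟩⟩
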